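/- Let $(M,g)$ be a Hermitian manifold: a complex manifold $M$ (Hausdorff, second countable, not necessarily compact or complete) with a smooth Riemannian metric $g$ for which the complex structure is an isometry. For integers $p,q\ge 0$ let $A_0^{p,q}$ be the space of smooth $(p,q)$-forms with compact support, and let $L^2\Lambda^{p,q}$ be the Hilbert space of (almost everywhere classes of) measurable $(p,q)$-forms $\varphi$ with $\int_M h(\varphi,\varphi)\,\mathrm{vol}<\infty$, where $h$ is the Hermitian metric on forms induced by $g$, $\mathrm{vol}$ is the Riemannian volume, and $\langle\varphi,\psi\rangle=\int_M h(\varphi,\psi)\,\mathrm{vol}$. Let $d=\partial+\overline\partial$ as usual, and let $P^*$ denote the $L^2$ formal adjoint of a differential operator $P$, so that $\langle Pu,v\rangle=\langle u,P^*v\rangle$ for all smooth compactly supported $u,v$. For a differential operator $P$ from $(p,q)$-forms to $(r,s)$-forms, let $P_0$ be its restriction to $A_0^{p,q}$, regarded as an unbounded operator $L^2\Lambda^{p,q}\to L^2\Lambda^{r,s}$. The strong extension $P_s$ is the operator whose graph is the closure of the graph of $P_0$. The weak extension $P_w$ is the operator with $P_wu=v$ if and only if $\langle v,w\rangle=\langle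 u,P^*w\rangle$ for all $w\in A_0^{r,s}$. An operator on a Hilbert space is called essentially self-adjoint if it has a unique self-adjoint extension. Put $$\square_{BC}=\partial\overline\partial\,\overline\partial^*\partial^*+(\partial^*\partial+\overline\partial^*\overline\partial)^2,\qquad \square_A=\overline\partial^*\partial^*\partial\overline\partial+(\partial\partial^*+\overline\partial\,\overline\partial^*)^2 .$$ Theorem. Fix $p,q\ge 0$. If $(\square_{BC})_0$ on $A_0^{p+1,q+1}$ is essentially self-adjoint in $L^2\Lambda^{p+1,q+1}$, or $(\square_A)_0$ on $A_0^{p,q}$ is essentially self-adjoint in $L^2\Lambda^{p,q}$, then $$(\partial\overline\partial)_s=(\partial\overline\partial)_w \quad\text{as operators } L^2\Lambda^{p,q}\to L^2\Lambda^{p+1,q+1},$$ $$(\overline\partial^*\partial^*)_s=(\overline\partial^*\partial^*)_w \quad\text{as operators } L^2\Lambda^{p+1,q+1}\to L^2\Lambda^{p,q}.$$ -/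

import Mathlib

open Set Filter Topology MeasureTheory
open scoped Manifold ContDiff ComplexConjugate Nat

noncomputable section

namespace ABC

section Forms

set_option linter.unusedSectionVars false

variable {E : Type*} [NormedAddCommGroup E] [NormedSpace ℂ E]
variable {M : Type*} [TopologicalSpace M] [ChartedSpace E M] [IsManifold 𝓘(ℂ, E) ω M]

/-- The differential, at the point `x`, of the inverse of the preferred chart at `c`. It maps
`E` to the tangent space `T_x M`, which in Mathlib is by definition the model space `E` (a tangent
vector is given by its coordinates in the preferred chart at `x`). It is `ℂ`-linear, and regarded
here as `ℝ`-linear. -/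
def frame (c x : M) : E →L[ℝ] E :=
  (tangentCoordChange 𝓘(ℂ, E) c x x).restrictScalars ℝ

variable (E M) in
/-- Complex-valued differential `k`-forms on `M`, without regularity: sections of the bundle of
alternating `ℝ`-multilinear maps `T_x M × ⋯ × T_x M → ℂ`. -/
abbrev Form (k : ℕ) : Type _ := M → E [⋀^Fin k]→L[ℝ] ℂ

variable {k p q : ℕ}

/-- The value at `x` of the form `α`, expressed in the coordinates of the chart at `c`. -/
def inChart (α : Form E M k) (c x : M) : E [⋀^Fin k]→L[ℝ] ℂ :=
  (α x).compContinuousLinearMap (frame c x)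

/-- The form `α` in the chart at `c`: its pullback by the inverse of this chart. -/
def coord (α : Form E M k) (c : M) (y : E) : E [⋀^Fin k]→L[ℝ] ℂ :=
  inChart α c ((extChartAt 𝓘(ℂ, E) c).symm y)

/-- Smoothness (over `ℝ`) of a complex-valued differential form. -/
def IsSmoothForm (α : Form E M k) : Prop :=
  ∀ c : M, ContDiffOn ℝ ∞ (coord α c) (extChartAt 𝓘(ℂ, E) c).target

/-- The form `α` on the complex vector space `E` has type `(p, q)`: the pullback by the scalar `z`
acts as multiplication by `z ^ p * conj z ^ q`. In degree `p + q`, these are exactly the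
combinations of the products of `p` complex linear and `q` conjugate linear functionals; in any
other degree, only `0` has this type. -/
def IsOfType (p q : ℕ) (α : E [⋀^Fin k]→L[ℝ] ℂ) : Prop :=
  ∀ (z : ℂ) (v : Fin k → E), α (fun i => z • v i) = z ^ p * conj z ^ q * α v

/-- Multiplication by the imaginary unit. -/
def imul : E →L[ℝ] E := (Complex.I • ContinuousLinearMap.id ℂ E).restrictScalars ℝ

/-- The complex linear part of a real linear map. -/
def linPart (T : E →L[ℝ] E [⋀^Fin k]→L[ℝ] ℂ) : E →L[ℝ] E [⋀^Fin k]→L[ℝ] ℂ :=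
  (1 / 2 : ℂ) • (T - Complex.I • T.comp imul)

/-- The conjugate linear part of a real linear map. -/
def conjPart (T : E →L[ℝ] E [⋀^Fin k]→L[ℝ] ℂ) : E →L[ℝ] E [⋀^Fin k]→L[ℝ] ℂ :=
  (1 / 2 : ℂ) • (T + Complex.I • T.comp imul)

/-- The operator `∂` on an open set of `E`:
`∂ (f dz_I ∧ dz̄_J) = ∑ j, (∂f/∂z_j) dz_j ∧ dz_I ∧ dz̄_J`. It is obtained from the exterior
derivative `extDeriv` by replacing the derivative of the form by its complex linear part. -/
def delFlat (w : E → E [⋀^Fin k]→L[ℝ] ℂ) (y : E) : E [⋀^Fin (k + 1)]→L[ℝ] ℂ :=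
  .alternatizeUncurryFin (linPart (fderiv ℝ w y))

/-- The operator `∂̄` on an open set of `E`. -/
def delbarFlat (w : E → E [⋀^Fin k]→L[ℝ] ℂ) (y : E) : E [⋀^Fin (k + 1)]→L[ℝ] ℂ :=
  .alternatizeUncurryFin (conjPart (fderiv ℝ w y))

/-- The operator `∂` on forms on `M`, computed in holomorphic coordinates. -/
def delForm (α : Form E M k) : Form E M (k + 1) :=
  fun x => delFlat (coord α x) (extChartAt 𝓘(ℂ, E) x x)

/-- The operator `∂̄` on forms on `M`, computed in holomorphic coordinates. -/
def delbarForm (α : Form E M k) : Form E M (k + 1) :=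
  fun x => delbarFlat (coord α x) (extChartAt 𝓘(ℂ, E) x x)

variable (E M) in
/-- `A₀^{p,q}`: the smooth forms (of degree `k`) of type `(p, q)` with compact support. This is
meant for `k = p + q`, and it is `0` otherwise. -/
def A0 (k p q : ℕ) : Submodule ℂ (Form E M k) where
  carrier := {α | IsSmoothForm α ∧ (∀ x, IsOfType p q (α x)) ∧ HasCompactSupport α}
  zero_mem' := by
    refine ⟨fun c => ?_, fun x z v => by simp, HasCompactSupport.zero⟩
    have : coord (0 : Form E M k) c = fun _ => 0 := by
      ext y v; simp [coord, inChart]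
    rw [this]; exact contDiffOn_const
  add_mem' := by
    rintro α β ⟨h1, h2, h3⟩ ⟨h1', h2', h3'⟩
    refine ⟨fun c => ?_, fun x z v => ?_, h3.add h3'⟩
    · have : coord (α + β) c = fun y => coord α c y + coord β c y := by
        ext y v; simp [coord, inChart]
      rw [this]; exact (h1 c).add (h1' c)
    · simp [h2 x z v, h2' x z v, mul_add]
  smul_mem' := by
    rintro a α ⟨h1, h2, h3⟩
    refine ⟨fun c => ?_, fun x z v => ?_, ?_⟩
    · have : coord (a • α) c = fun y => a • coord α c y := by
        ext y v; simp [coord, inChart]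
      rw [this]; exact (h1 c).const_smul a
    · simp only [Pi.smul_apply, ContinuousAlternatingMap.smul_apply, h2 x z v, smul_eq_mul]; ring
    · exact h3.mono fun x hx => by
        intro h; apply hx; simp [h]

/-! Facts that make `∂` and `∂̄` operators on `A₀`. -/

theorem linPart_add_conjPart (T : E →L[ℝ] E [⋀^Fin k]→L[ℝ] ℂ) : linPart T + conjPart T = T := by
  ext v w
  simp [linPart, conjPart]
  ring

theorem delFlat_add_delbarFlat (w : E → E [⋀^Fin k]→L[ℝ] ℂ) (y : E) :
    delFlat w y + delbarFlat w y = extDeriv w y := by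
  rw [delFlat, delbarFlat, extDeriv, ← ContinuousAlternatingMap.alternatizeUncurryFin_add,
    linPart_add_conjPart]

theorem linPart_smul (T : E →L[ℝ] E [⋀^Fin k]→L[ℝ] ℂ) (z : ℂ) (v : E) :
    linPart T (z • v) = z • linPart T v := by
  have h1 : z • v = z.re • v + z.im • (Complex.I • v) := by
    conv_lhs => rw [← Complex.re_add_im z]
    rw [add_smul, mul_smul]; rfl
  have h2 : Complex.I • z • v = z.re • (Complex.I • v) - z.im • v := by
    rw [h1, smul_add, smul_comm, smul_comm Complex.I z.im, smul_smul Complex.I Complex.I,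
      Complex.I_mul_I]
    simp [sub_eq_add_neg]
  simp only [linPart, imul, smul_apply, sub_apply,
    ContinuousLinearMap.comp_apply, ContinuousLinearMap.coe_restrictScalars',
    ContinuousLinearMap.id_apply]
  rw [h2, h1]
  ext w
  simp only [map_add, map_sub, map_smul, ContinuousAlternatingMap.smul_apply,
    ContinuousAlternatingMap.add_apply, ContinuousAlternatingMap.sub_apply, Complex.real_smul,
    smul_eq_mul]
  conv_rhs => rw [← Complex.re_add_im z]
  linear_combination ((1 / 2 : ℂ) * z.im * (T (Complex.I • v)) w) * Complex.I_mul_I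

theorem conjPart_smul (T : E →L[ℝ] E [⋀^Fin k]→L[ℝ] ℂ) (z : ℂ) (v : E) :
    conjPart T (z • v) = conj z • conjPart T v := by
  have h1 : z • v = z.re • v + z.im • (Complex.I • v) := by
    conv_lhs => rw [← Complex.re_add_im z]
    rw [add_smul, mul_smul]; rfl
  have h2 : Complex.I • z • v = z.re • (Complex.I • v) - z.im • v := by
    rw [h1, smul_add, smul_comm, smul_comm Complex.I z.im, smul_smul Complex.I Complex.I,
      Complex.I_mul_I]
    simp [sub_eq_add_neg]
  simp only [conjPart, imul, smul_apply, add_apply,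
    ContinuousLinearMap.comp_apply, ContinuousLinearMap.coe_restrictScalars',
    ContinuousLinearMap.id_apply]
  rw [h2, h1]
  ext w
  have h3 : conj z = (z.re : ℂ) - z.im * Complex.I := by
    apply Complex.ext <;> simp
  simp only [map_add, map_sub, map_smul, ContinuousAlternatingMap.smul_apply,
    ContinuousAlternatingMap.add_apply, ContinuousAlternatingMap.sub_apply, Complex.real_smul,
    smul_eq_mul, h3]
  linear_combination ((1 / 2 : ℂ) * z.im * (T (Complex.I • v)) w) * Complex.I_mul_I

theorem IsOfType.del {T : E →L[ℝ] E [⋀^Fin k]→L[ℝ] ℂ} (h : ∀ v, IsOfType p q (T v)) :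
    IsOfType (p + 1) q (.alternatizeUncurryFin (linPart T)) := by
  have h' : ∀ v, IsOfType p q (linPart T v) := by
    intro v z w
    simp only [linPart, imul, smul_apply, sub_apply, ContinuousLinearMap.comp_apply,
      ContinuousAlternatingMap.smul_apply, ContinuousAlternatingMap.sub_apply, h _ z w, smul_eq_mul]
    ring
  intro z v
  simp only [ContinuousAlternatingMap.alternatizeUncurryFin_apply, Finset.mul_sum]
  refine Finset.sum_congr rfl fun i _ => ?_
  have h2 := h' (v i) z (i.removeNth v)
  rw [linPart_smul, ContinuousAlternatingMap.smul_apply,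
    show (i.removeNth fun j => z • v j) = fun j => z • (i.removeNth v) j from rfl, h2]
  simp only [smul_eq_mul, zsmul_eq_mul]
  ring

theorem IsOfType.delbar {T : E →L[ℝ] E [⋀^Fin k]→L[ℝ] ℂ} (h : ∀ v, IsOfType p q (T v)) :
    IsOfType p (q + 1) (.alternatizeUncurryFin (conjPart T)) := by
  have h' : ∀ v, IsOfType p q (conjPart T v) := by
    intro v z w
    simp only [conjPart, imul, smul_apply, add_apply, ContinuousLinearMap.comp_apply,
      ContinuousAlternatingMap.smul_apply, ContinuousAlternatingMap.add_apply, h _ z w, smul_eq_mul]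
    ring
  intro z v
  simp only [ContinuousAlternatingMap.alternatizeUncurryFin_apply, Finset.mul_sum]
  refine Finset.sum_congr rfl fun i _ => ?_
  have h2 := h' (v i) z (i.removeNth v)
  rw [conjPart_smul, ContinuousAlternatingMap.smul_apply,
    show (i.removeNth fun j => z • v j) = fun j => z • (i.removeNth v) j from rfl, h2]
  simp only [smul_eq_mul, zsmul_eq_mul]
  ring

theorem IsOfType.fderiv {w : E → E [⋀^Fin k]→L[ℝ] ℂ} {y : E}
    (h : ∀ᶠ y' in 𝓝 y, IsOfType p q (w y')) (v : E) : IsOfType p q (fderiv ℝ w y v) := by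
  by_cases hd : DifferentiableAt ℝ w y
  swap
  · rw [fderiv_zero_of_not_differentiableAt hd]
    intro z u; simp
  intro z u
  have e : ∀ u : Fin k → E, HasFDerivAt (fun y' => w y' u)
      ((ContinuousAlternatingMap.apply ℝ E ℂ u).comp (_root_.fderiv ℝ w y)) y := fun u =>
    (ContinuousAlternatingMap.apply ℝ E ℂ u).hasFDerivAt.comp y hd.hasFDerivAt
  have h1 := (e (fun i => z • u i))
  have h2 := (e u).const_mul (z ^ p * conj z ^ q)
  have h3 := h1.congr_of_eventuallyEq (h.mono fun y' hy' => (hy' z u).symm)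
  have h4 := congrArg (fun T => T v) (h3.unique h2)
  simpa using h4

theorem IsOfType.eq_and_eq {a b a' b' : E [⋀^Fin k]→L[ℝ] ℂ} (ha : IsOfType (p + 1) q a)
    (ha' : IsOfType (p + 1) q a') (hb : IsOfType p (q + 1) b) (hb' : IsOfType p (q + 1) b')
    (h : a + b = a' + b') : a = a' ∧ b = b' := by
  have key : a = a' := by
    ext v
    have h1 : a v + b v = a' v + b' v := by
      simpa using congrArg (fun T : E [⋀^Fin k]→L[ℝ] ℂ => T v) h
    have h2 : a (fun i => Complex.I • v i) + b (fun i => Complex.I • v i)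
        = a' (fun i => Complex.I • v i) + b' (fun i => Complex.I • v i) := by
      simpa using congrArg (fun T : E [⋀^Fin k]→L[ℝ] ℂ => T (fun i => Complex.I • v i)) h
    rw [ha, ha', hb, Complex.conj_I] at h2
    have hc : (Complex.I ^ p * (-Complex.I) ^ q * (2 * Complex.I) : ℂ) ≠ 0 := by simp
    apply mul_left_cancel₀ hc
    rw [hb' Complex.I v, Complex.conj_I] at h2
    linear_combination h2 + Complex.I ^ p * (-Complex.I) ^ q * Complex.I * h1
  refine ⟨key, ?_⟩
  rw [key] at h
  exact add_left_cancel h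

theorem IsOfType.comp {a : E [⋀^Fin k]→L[ℝ] ℂ} (ha : IsOfType p q a) (L : E →L[ℂ] E) :
    IsOfType p q (a.compContinuousLinearMap (L.restrictScalars ℝ)) := by
  intro z v
  have := ha z (fun i => L (v i))
  simpa [Function.comp_def] using this

/-- The coordinate change from the chart at `c` to the chart at `c'`. -/
abbrev transition (c c' : M) : E → E :=
  extChartAt 𝓘(ℂ, E) c' ∘ (extChartAt 𝓘(ℂ, E) c).symm

theorem frame_tangentCoordChange {c c' x : M} (h : x ∈ (extChartAt 𝓘(ℂ, E) c).source)
    (h' : x ∈ (extChartAt 𝓘(ℂ, E) c').source) (v : E) :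
    frame c' x (tangentCoordChange 𝓘(ℂ, E) c c' x v) = frame c x v :=
  tangentCoordChange_comp ⟨⟨h, h'⟩, mem_extChartAt_source x⟩

theorem hasFDerivAt_transition {c c' : M} {y : E} (h : y ∈ (extChartAt 𝓘(ℂ, E) c).target)
    (h' : (extChartAt 𝓘(ℂ, E) c).symm y ∈ (extChartAt 𝓘(ℂ, E) c').source) :
    HasFDerivAt (transition c c')
      (tangentCoordChange 𝓘(ℂ, E) c c' ((extChartAt 𝓘(ℂ, E) c).symm y)) y := by
  have h1 := hasFDerivWithinAt_tangentCoordChange (I := 𝓘(ℂ, E))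
    ⟨(extChartAt 𝓘(ℂ, E) c).map_target h, h'⟩
  rw [(extChartAt 𝓘(ℂ, E) c).right_inv h] at h1
  rwa [modelWithCornersSelf_coe, range_id, hasFDerivWithinAt_univ] at h1

theorem inChart_change (α : Form E M k) {c c' x : M} (h : x ∈ (extChartAt 𝓘(ℂ, E) c).source)
    (h' : x ∈ (extChartAt 𝓘(ℂ, E) c').source) :
    inChart α c x = (inChart α c' x).compContinuousLinearMap
      ((tangentCoordChange 𝓘(ℂ, E) c c' x).restrictScalars ℝ) := by
  ext v
  simp only [inChart, ContinuousAlternatingMap.compContinuousLinearMap_apply]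
  congr 1
  ext i
  exact (frame_tangentCoordChange h h' (v i)).symm

theorem coord_change (α : Form E M k) {c c' : M} {y : E} (h : y ∈ (extChartAt 𝓘(ℂ, E) c).target)
    (h' : (extChartAt 𝓘(ℂ, E) c).symm y ∈ (extChartAt 𝓘(ℂ, E) c').source) :
    coord α c y = (coord α c' (transition c c' y)).compContinuousLinearMap
      (fderiv ℝ (transition c c') y) := by
  rw [((hasFDerivAt_transition h h').restrictScalars ℝ).fderiv, coord, coord,
    inChart_change α ((extChartAt 𝓘(ℂ, E) c).map_target h) h']
  simp only [transition, Function.comp_apply, (extChartAt 𝓘(ℂ, E) c').left_inv h']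

theorem contDiffAt_transition {c c' : M} {y : E} (h : y ∈ (extChartAt 𝓘(ℂ, E) c).target)
    (h' : (extChartAt 𝓘(ℂ, E) c).symm y ∈ (extChartAt 𝓘(ℂ, E) c').source) :
    ContDiffAt ℝ ω (transition c c') y := by
  have h1 : y ∈ ((extChartAt 𝓘(ℂ, E) c).symm ≫ extChartAt 𝓘(ℂ, E) c').source := by
    rw [PartialEquiv.trans_source]
    exact ⟨h, h'⟩
  have h2 := contDiffWithinAt_ext_coord_change (I := 𝓘(ℂ, E)) (n := ω) c' c h1
  simp only [modelWithCornersSelf_coe, range_id, contDiffWithinAt_univ] at h2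
  exact h2.restrict_scalars ℝ

theorem eventually_overlap {c c' : M} {y : E} (h : y ∈ (extChartAt 𝓘(ℂ, E) c).target)
    (h' : (extChartAt 𝓘(ℂ, E) c).symm y ∈ (extChartAt 𝓘(ℂ, E) c').source) :
    ∀ᶠ y' in 𝓝 y, y' ∈ (extChartAt 𝓘(ℂ, E) c).target ∧
      (extChartAt 𝓘(ℂ, E) c).symm y' ∈ (extChartAt 𝓘(ℂ, E) c').source :=
  Eventually.and ((isOpen_extChartAt_target c).mem_nhds h)
    ((continuousAt_extChartAt_symm'' h).eventually
      ((isOpen_extChartAt_source c').mem_nhds h'))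

theorem isOfType_coord {α : Form E M k} (h : ∀ x, IsOfType p q (α x)) (c : M) (y : E) :
    IsOfType p q (coord α c y) :=
  (h _).comp _

theorem coord_del_and_delbar {α : Form E M k} (hs : IsSmoothForm α)
    (ht : ∀ x, IsOfType p q (α x)) {c : M} {y : E} (h : y ∈ (extChartAt 𝓘(ℂ, E) c).target) :
    coord (delForm α) c y = delFlat (coord α c) y ∧
      coord (delbarForm α) c y = delbarFlat (coord α c) y := by
  set x := (extChartAt 𝓘(ℂ, E) c).symm y with hx
  have h' : (extChartAt 𝓘(ℂ, E) c).symm y ∈ (extChartAt 𝓘(ℂ, E) x).source := mem_extChartAt_source x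
  have hτ : transition c x y = extChartAt 𝓘(ℂ, E) x x := rfl
  have hd : DifferentiableAt ℝ (coord α x) (transition c x y) := by
    have := (hs x).contDiffAt (extChartAt_target_mem_nhds (I := 𝓘(ℂ, E)) x)
    exact this.differentiableAt (by simp)
  have hpull := extDeriv_pullback hd (contDiffAt_transition h h') (by simp)
  have hev : coord α c =ᶠ[𝓝 y] fun y' => (coord α x (transition c x y')).compContinuousLinearMap
      (fderiv ℝ (transition c x) y') :=
    (eventually_overlap h h').mono fun y' hy' => coord_change α hy'.1 hy'.2
  rw [← hev.extDeriv_eq, ← delFlat_add_delbarFlat, ← delFlat_add_delbarFlat,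
    ((hasFDerivAt_transition h h').restrictScalars ℝ).fderiv] at hpull
  have hT : ∀ c' : M, ∀ y' v, IsOfType p q (fderiv ℝ (coord α c') y' v) := fun c' y' v =>
    IsOfType.fderiv (Eventually.of_forall fun y'' => isOfType_coord ht c' y'') v
  have hadd : ∀ (a b : E [⋀^Fin (k + 1)]→L[ℝ] ℂ) (L : E →L[ℝ] E),
      (a + b).compContinuousLinearMap L
        = a.compContinuousLinearMap L + b.compContinuousLinearMap L := fun a b L => by
    ext v; simp
  rw [hadd] at hpull
  have := IsOfType.eq_and_eq (IsOfType.del (hT c y)) ((IsOfType.del (hT x _)).comp _)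
    (IsOfType.delbar (hT c y)) ((IsOfType.delbar (hT x _)).comp _) hpull
  exact ⟨this.1.symm, this.2.symm⟩

theorem isSmoothForm_del {α : Form E M k} (hs : IsSmoothForm α)
    (ht : ∀ x, IsOfType p q (α x)) : IsSmoothForm (delForm α) := by
  intro c
  have ho := isOpen_extChartAt_target (I := 𝓘(ℂ, E)) c
  have h1 : ContDiffOn ℝ ∞ (fderiv ℝ (coord α c)) (extChartAt 𝓘(ℂ, E) c).target :=
    (hs c).fderiv_of_isOpen ho (by simp)
  have h2 : ContDiffOn ℝ ∞ (fun y => linPart (fderiv ℝ (coord α c) y))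
      (extChartAt 𝓘(ℂ, E) c).target :=
    (h1.sub ((h1.clm_comp contDiffOn_const).const_smul Complex.I)).const_smul (1 / 2 : ℂ)
  have h3 := (ContinuousAlternatingMap.alternatizeUncurryFinCLM ℝ E ℂ).contDiff.comp_contDiffOn h2
  exact h3.congr fun y hy => (coord_del_and_delbar hs ht hy).1

theorem isSmoothForm_delbar {α : Form E M k} (hs : IsSmoothForm α)
    (ht : ∀ x, IsOfType p q (α x)) : IsSmoothForm (delbarForm α) := by
  intro c
  have ho := isOpen_extChartAt_target (I := 𝓘(ℂ, E)) c
  have h1 : ContDiffOn ℝ ∞ (fderiv ℝ (coord α c)) (extChartAt 𝓘(ℂ, E) c).target :=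
    (hs c).fderiv_of_isOpen ho (by simp)
  have h2 : ContDiffOn ℝ ∞ (fun y => conjPart (fderiv ℝ (coord α c) y))
      (extChartAt 𝓘(ℂ, E) c).target :=
    (h1.add ((h1.clm_comp contDiffOn_const).const_smul Complex.I)).const_smul (1 / 2 : ℂ)
  have h3 := (ContinuousAlternatingMap.alternatizeUncurryFinCLM ℝ E ℂ).contDiff.comp_contDiffOn h2
  exact h3.congr fun y hy => (coord_del_and_delbar hs ht hy).2

theorem fderiv_coord_eq_zero {α : Form E M k} {x : M} (hx : x ∉ tsupport α) :
    fderiv ℝ (coord α x) (extChartAt 𝓘(ℂ, E) x x) = 0 := by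
  have h0 : ∀ᶠ x' in 𝓝 x, α x' = 0 := by
    filter_upwards [(isClosed_tsupport α).isOpen_compl.mem_nhds hx] with x' hx'
    exact image_eq_zero_of_notMem_tsupport hx'
  have h1 : coord α x =ᶠ[𝓝 (extChartAt 𝓘(ℂ, E) x x)] fun _ => 0 := by
    have h2 := continuousAt_extChartAt_symm (I := 𝓘(ℂ, E)) x
    have h3 : ∀ᶠ y in 𝓝 (extChartAt 𝓘(ℂ, E) x x), α ((extChartAt 𝓘(ℂ, E) x).symm y) = 0 := by
      rw [← extChartAt_to_inv (I := 𝓘(ℂ, E)) x] at h0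
      exact h2.eventually h0
    refine h3.mono fun y hy => ?_
    ext v
    simp only [coord, inChart, hy, ContinuousAlternatingMap.compContinuousLinearMap_apply]
    rfl
  rw [h1.fderiv_eq]
  simp

theorem fderiv_coord_add {α β : Form E M k} (hα : IsSmoothForm α) (hβ : IsSmoothForm β) (x : M) :
    fderiv ℝ (coord (α + β) x) (extChartAt 𝓘(ℂ, E) x x) =
      fderiv ℝ (coord α x) (extChartAt 𝓘(ℂ, E) x x) +
        fderiv ℝ (coord β x) (extChartAt 𝓘(ℂ, E) x x) := by
  have hd : ∀ {γ : Form E M k}, IsSmoothForm γ →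
      DifferentiableAt ℝ (coord γ x) (extChartAt 𝓘(ℂ, E) x x) := fun hγ =>
    ((hγ x).contDiffAt (extChartAt_target_mem_nhds (I := 𝓘(ℂ, E)) x)).differentiableAt (by simp)
  have h1 : coord (α + β) x = coord α x + coord β x := by
    ext y v; simp [coord, inChart]
  rw [h1, fderiv_add (hd hα) (hd hβ)]

theorem fderiv_coord_smul {α : Form E M k} (hα : IsSmoothForm α) (a : ℂ) (x : M) :
    fderiv ℝ (coord (a • α) x) (extChartAt 𝓘(ℂ, E) x x) =
      a • fderiv ℝ (coord α x) (extChartAt 𝓘(ℂ, E) x x) := by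
  have hd : DifferentiableAt ℝ (coord α x) (extChartAt 𝓘(ℂ, E) x x) :=
    ((hα x).contDiffAt (extChartAt_target_mem_nhds (I := 𝓘(ℂ, E)) x)).differentiableAt (by simp)
  have h1 : coord (a • α) x = a • coord α x := by
    ext y v; simp [coord, inChart]
  rw [h1, fderiv_const_smul hd]

/-- The operator `∂ : A₀^{p,q} → A₀^{p+1,q}`. -/
def del : A0 E M k p q →ₗ[ℂ] A0 E M (k + 1) (p + 1) q where
  toFun α := ⟨delForm α.1, isSmoothForm_del α.2.1 α.2.2.1,
    fun x => IsOfType.del fun v => IsOfType.fderiv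
      (Eventually.of_forall fun y => isOfType_coord α.2.2.1 x y) v,
    α.2.2.2.mono' fun x hx => by
      by_contra h
      apply hx
      ext v
      simp only [delForm, delFlat, fderiv_coord_eq_zero h]
      simp [linPart, ContinuousAlternatingMap.alternatizeUncurryFin_apply]⟩
  map_add' α β := by
    ext x v
    simp only [Submodule.coe_add, Pi.add_apply, ContinuousAlternatingMap.add_apply]
    simp only [delForm, delFlat, fderiv_coord_add α.2.1 β.2.1, linPart,
      ContinuousAlternatingMap.alternatizeUncurryFin_apply, ← Finset.sum_add_distrib]
    refine Finset.sum_congr rfl fun i _ => ?_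
    simp
    ring
  map_smul' a α := by
    ext x v
    simp only [Submodule.coe_smul, Pi.smul_apply, ContinuousAlternatingMap.smul_apply,
      RingHom.id_apply]
    simp only [delForm, delFlat, fderiv_coord_smul α.2.1, linPart,
      ContinuousAlternatingMap.alternatizeUncurryFin_apply, Finset.smul_sum]
    refine Finset.sum_congr rfl fun i _ => ?_
    simp
    ring

/-- The operator `∂̄ : A₀^{p,q} → A₀^{p,q+1}`. -/
def delbar : A0 E M k p q →ₗ[ℂ] A0 E M (k + 1) p (q + 1) where
  toFun α := ⟨delbarForm α.1, isSmoothForm_delbar α.2.1 α.2.2.1,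
    fun x => IsOfType.delbar fun v => IsOfType.fderiv
      (Eventually.of_forall fun y => isOfType_coord α.2.2.1 x y) v,
    α.2.2.2.mono' fun x hx => by
      by_contra h
      apply hx
      ext v
      simp only [delbarForm, delbarFlat, fderiv_coord_eq_zero h]
      simp [conjPart, ContinuousAlternatingMap.alternatizeUncurryFin_apply]⟩
  map_add' α β := by
    ext x v
    simp only [Submodule.coe_add, Pi.add_apply, ContinuousAlternatingMap.add_apply]
    simp only [delbarForm, delbarFlat, fderiv_coord_add α.2.1 β.2.1, conjPart,
      ContinuousAlternatingMap.alternatizeUncurryFin_apply, ← Finset.sum_add_distrib]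
    refine Finset.sum_congr rfl fun i _ => ?_
    simp
    ring
  map_smul' a α := by
    ext x v
    simp only [Submodule.coe_smul, Pi.smul_apply, ContinuousAlternatingMap.smul_apply,
      RingHom.id_apply]
    simp only [delbarForm, delbarFlat, fderiv_coord_smul α.2.1, conjPart,
      ContinuousAlternatingMap.alternatizeUncurryFin_apply, Finset.smul_sum]
    refine Finset.sum_congr rfl fun i _ => ?_
    simp
    ring

end Forms

section LinearAlgebra

variable {E : Type*} [NormedAddCommGroup E] [NormedSpace ℂ E] [FiniteDimensional ℂ E] {k : ℕ}

variable (E) in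
/-- A basis of the real vector space underlying `E`, which serves as a reference. -/
def refBasis : Module.Basis (Fin (Module.finrank ℝ E)) ℝ E := Module.finBasis ℝ E

/-- The matrix of a real bilinear form. -/
def gram (G : E →L[ℝ] E →L[ℝ] ℝ) :
    Matrix (Fin (Module.finrank ℝ E)) (Fin (Module.finrank ℝ E)) ℝ :=
  Matrix.of fun i j => G (refBasis E i) (refBasis E j)

/-- The Hermitian inner product of complex-valued `k`-forms induced by a real inner product `G`:
`(1/k!) ∑ G^{i₁j₁} ⋯ G^{iₖjₖ} α_{i₁…iₖ} conj β_{j₁…jₖ}`. For a `G`-orthonormal basis `e`, this is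
the sum of `α (e_{i₁}, …, e_{iₖ}) * conj (β (e_{i₁}, …, e_{iₖ}))` over `i₁ < ⋯ < iₖ`. It does not
depend on the basis. -/
def formInner (G : E →L[ℝ] E →L[ℝ] ℝ) (α β : E [⋀^Fin k]→L[ℝ] ℂ) : ℂ :=
  (k ! : ℂ)⁻¹ * ∑ I : Fin k → Fin (Module.finrank ℝ E), ∑ J : Fin k → Fin (Module.finrank ℝ E),
    ((∏ a, (gram G)⁻¹ (I a) (J a) : ℝ) : ℂ) *
      (α (fun a => refBasis E (I a)) * conj (β (fun a => refBasis E (J a))))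

theorem map_sum_basis {m : ℕ} (α : E [⋀^Fin k]→L[ℝ] ℂ)
    (C : Matrix (Fin (Module.finrank ℝ E)) (Fin m) ℝ) (I : Fin k → Fin m) :
    α (fun a => ∑ i, C i (I a) • refBasis E i) =
      ∑ I' : Fin k → Fin (Module.finrank ℝ E),
        ((∏ a, C (I' a) (I a) : ℝ) : ℂ) * α (fun a => refBasis E (I' a)) := by
  have h1 := α.toMultilinearMap.map_sum (fun (a : Fin k) (i : Fin (Module.finrank ℝ E)) =>
    C i (I a) • refBasis E i)
  refine h1.trans (Finset.sum_congr rfl fun I' _ => ?_)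
  have h2 := α.toMultilinearMap.map_smul_univ (fun a => C (I' a) (I a))
    (fun a => refBasis E (I' a))
  refine h2.trans ?_
  rw [Complex.real_smul]
  rfl

theorem sum_change {m : ℕ} (α β : E [⋀^Fin k]→L[ℝ] ℂ)
    (C : Matrix (Fin (Module.finrank ℝ E)) (Fin m) ℝ) (H : Matrix (Fin m) (Fin m) ℝ) :
    (∑ I : Fin k → Fin m, ∑ J : Fin k → Fin m, ((∏ a, H (I a) (J a) : ℝ) : ℂ) *
      (α (fun a => ∑ i, C i (I a) • refBasis E i) *
        conj (β (fun a => ∑ i, C i (J a) • refBasis E i)))) =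
    ∑ I : Fin k → Fin (Module.finrank ℝ E), ∑ J : Fin k → Fin (Module.finrank ℝ E),
      ((∏ a, (C * H * C.transpose) (I a) (J a) : ℝ) : ℂ) *
      (α (fun a => refBasis E (I a)) * conj (β (fun a => refBasis E (J a)))) := by
  have hp : ∀ I' J' : Fin k → Fin (Module.finrank ℝ E),
      ((∏ a, (C * H * C.transpose) (I' a) (J' a) : ℝ) : ℂ) =
      ∑ I : Fin k → Fin m, ∑ J : Fin k → Fin m,
        ((∏ a, H (I a) (J a) : ℝ) : ℂ) * ((∏ a, C (I' a) (I a) : ℝ) : ℂ) *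
          ((∏ a, C (J' a) (J a) : ℝ) : ℂ) := by
    intro I' J'
    have e : ∀ a : Fin k, (C * H * C.transpose) (I' a) (J' a) =
        ∑ j, ∑ i, C (I' a) i * H i j * C (J' a) j := by
      intro a
      simp only [Matrix.mul_apply, Matrix.transpose_apply, Finset.sum_mul]
    simp only [e]
    rw [Finset.prod_univ_sum]
    simp only [Finset.prod_univ_sum, Fintype.piFinset_univ]
    rw [Finset.sum_comm]
    push_cast
    refine Finset.sum_congr rfl fun I _ => Finset.sum_congr rfl fun J _ => ?_
    simp only [← Finset.prod_mul_distrib]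
    exact Finset.prod_congr rfl fun a _ => by ring
  have swap : ∀ F : (Fin k → Fin m) → (Fin k → Fin m) →
      (Fin k → Fin (Module.finrank ℝ E)) → (Fin k → Fin (Module.finrank ℝ E)) → ℂ,
      ∑ I, ∑ J, ∑ J', ∑ I', F I J I' J' = ∑ I', ∑ J', ∑ I, ∑ J, F I J I' J' := by
    intro F
    have : ∀ I J, ∑ J', ∑ I', F I J I' J' = ∑ x : (Fin k → Fin (Module.finrank ℝ E)) ×
        (Fin k → Fin (Module.finrank ℝ E)), F I J x.1 x.2 := fun I J => by
      rw [Finset.sum_comm, Fintype.sum_prod_type]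
    simp only [this]
    rw [← Fintype.sum_prod_type' (f := fun I J => ∑ x : (Fin k → Fin (Module.finrank ℝ E)) ×
        (Fin k → Fin (Module.finrank ℝ E)), F I J x.1 x.2), Finset.sum_comm, Fintype.sum_prod_type]
    simp only [Fintype.sum_prod_type]
  simp only [map_sum_basis, map_sum, map_mul, Complex.conj_ofReal, hp, Finset.sum_mul,
    Finset.mul_sum]
  rw [swap]
  refine Finset.sum_congr rfl fun I' _ => Finset.sum_congr rfl fun J' _ =>
    Finset.sum_congr rfl fun I _ => Finset.sum_congr rfl fun J _ => ?_
  ring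

/-- A real inner product. -/
def IsInner (G : E →L[ℝ] E →L[ℝ] ℝ) : Prop :=
  (∀ v w, G v w = G w v) ∧ ∀ v, v ≠ 0 → 0 < G v v

theorem IsInner.posDef {G : E →L[ℝ] E →L[ℝ] ℝ} (h : IsInner G) : (gram G).PosDef := by
  refine Matrix.PosDef.of_dotProduct_mulVec_pos ?_ ?_
  · ext i j
    simp [gram, Matrix.conjTranspose, h.1 (refBasis E i) (refBasis E j)]
  · intro x hx
    have h1 : ∑ i, x i • refBasis E i ≠ 0 := by
      intro h0
      apply hx
      have := (Fintype.linearIndependent_iff.1 (refBasis E).linearIndependent) x h0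
      ext i; exact this i
    have h2 := h.2 _ h1
    refine lt_of_lt_of_eq h2 (Eq.symm ?_)
    simp only [dotProduct, Matrix.mulVec, gram, map_sum, map_smul, _root_.sum_apply,
      smul_apply, smul_eq_mul, Matrix.of_apply, Pi.star_apply, star_trivial, Finset.mul_sum]
    rw [Finset.sum_comm]
    exact Finset.sum_congr rfl fun i _ => Finset.sum_congr rfl fun j _ => by ring

theorem IsInner.exists_frame {G : E →L[ℝ] E →L[ℝ] ℝ} (h : IsInner G) (k : ℕ) :
    ∃ (m : ℕ) (e : Fin m → E), ∀ α β : E [⋀^Fin k]→L[ℝ] ℂ,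
      formInner G α β = (k ! : ℂ)⁻¹ * ∑ I : Fin k → Fin m,
        α (fun a => e (I a)) * conj (β (fun a => e (I a))) := by
  obtain ⟨m, v, hv⟩ := Matrix.posSemidef_iff_eq_sum_vecMulVec.1 h.posDef.inv.posSemidef
  refine ⟨m, fun l => ∑ i, v l i • refBasis E i, fun α β => ?_⟩
  set C : Matrix (Fin (Module.finrank ℝ E)) (Fin m) ℝ := Matrix.of fun i l => v l i with hC
  have h1 : (gram G)⁻¹ = C * (1 : Matrix (Fin m) (Fin m) ℝ) * C.transpose := by
    rw [hv, Matrix.mul_one]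
    ext i j
    simp [Matrix.sum_apply, Matrix.vecMulVec_apply, Matrix.mul_apply, hC]
  rw [formInner, h1, ← sum_change]
  congr 1
  refine Finset.sum_congr rfl fun I _ => ?_
  rw [Finset.sum_eq_single I]
  · simp [hC]
  · intro J _ hJ
    obtain ⟨a, ha⟩ := Function.ne_iff.1 hJ
    have h0 : (1 : Matrix (Fin m) (Fin m) ℝ) (I a) (J a) = 0 := Matrix.one_apply_ne (Ne.symm ha)
    rw [Finset.prod_eq_zero (Finset.mem_univ a) h0]
    simp
  · simp

theorem IsInner.self_nonneg {G : E →L[ℝ] E →L[ℝ] ℝ} (h : IsInner G) (α : E [⋀^Fin k]→L[ℝ] ℂ) :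
    0 ≤ (formInner G α α).re ∧ (formInner G α α).im = 0 := by
  obtain ⟨m, e, he⟩ := h.exists_frame k
  have : formInner G α α = (((k ! : ℝ)⁻¹ * ∑ I : Fin k → Fin m,
      ‖α (fun a => e (I a))‖ ^ 2 : ℝ) : ℂ) := by
    rw [he]
    push_cast
    congr 1
    exact Finset.sum_congr rfl fun I _ => Complex.mul_conj' _
  rw [this]
  refine ⟨?_, Complex.ofReal_im _⟩
  rw [Complex.ofReal_re]
  positivity

theorem IsInner.conj_symm {G : E →L[ℝ] E →L[ℝ] ℝ} (h : IsInner G) (α β : E [⋀^Fin k]→L[ℝ] ℂ) :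
    conj (formInner G α β) = formInner G β α := by
  obtain ⟨m, e, he⟩ := h.exists_frame k
  rw [he, he]
  simp [mul_comm]

theorem formInner_add_left (G : E →L[ℝ] E →L[ℝ] ℝ) (α α' β : E [⋀^Fin k]→L[ℝ] ℂ) :
    formInner G (α + α') β = formInner G α β + formInner G α' β := by
  simp only [formInner, ← mul_add, ← Finset.sum_add_distrib, ContinuousAlternatingMap.add_apply,
    add_mul]

theorem formInner_smul_left (G : E →L[ℝ] E →L[ℝ] ℝ) (c : ℂ) (α β : E [⋀^Fin k]→L[ℝ] ℂ) :
    formInner G (c • α) β = c * formInner G α β := by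
  simp only [formInner, Finset.mul_sum, ContinuousAlternatingMap.smul_apply, smul_eq_mul]
  refine Finset.sum_congr rfl fun I _ => Finset.sum_congr rfl fun J _ => by ring

theorem IsInner.norm_le {G : E →L[ℝ] E →L[ℝ] ℝ} (h : IsInner G) (α β : E [⋀^Fin k]→L[ℝ] ℂ) :
    ‖formInner G α β‖ ≤ (formInner G α α).re + (formInner G β β).re := by
  obtain ⟨m, e, he⟩ := h.exists_frame k
  have hs : ∀ α : E [⋀^Fin k]→L[ℝ] ℂ, (formInner G α α).re = (k ! : ℝ)⁻¹ *
      ∑ I : Fin k → Fin m, ‖α (fun a => e (I a))‖ ^ 2 := by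
    intro α
    have : formInner G α α = (((k ! : ℝ)⁻¹ * ∑ I : Fin k → Fin m,
        ‖α (fun a => e (I a))‖ ^ 2 : ℝ) : ℂ) := by
      rw [he]
      push_cast
      congr 1
      exact Finset.sum_congr rfl fun I _ => Complex.mul_conj' _
    rw [this, Complex.ofReal_re]
  rw [hs, hs, he, norm_mul, norm_inv, Complex.norm_natCast, ← mul_add, ← Finset.sum_add_distrib]
  gcongr
  refine norm_sum_le_of_le _ fun I _ => ?_
  rw [norm_mul, RCLike.norm_conj]
  nlinarith [sq_nonneg (‖α (fun a => e (I a))‖ - ‖β (fun a => e (I a))‖),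
    sq_nonneg (‖α (fun a => e (I a))‖), sq_nonneg (‖β (fun a => e (I a))‖)]

theorem gram_comp (G : E →L[ℝ] E →L[ℝ] ℝ) (L : E →L[ℝ] E) :
    gram (G.bilinearComp L L) =
      (LinearMap.toMatrix (refBasis E) (refBasis E) (L : E →ₗ[ℝ] E)).transpose * gram G *
        LinearMap.toMatrix (refBasis E) (refBasis E) (L : E →ₗ[ℝ] E) := by
  ext i j
  have hL : ∀ i, L (refBasis E i) = ∑ l,
      LinearMap.toMatrix (refBasis E) (refBasis E) (L : E →ₗ[ℝ] E) l i • refBasis E l := by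
    intro i
    conv_lhs => rw [← (refBasis E).sum_repr (L (refBasis E i))]
    simp [LinearMap.toMatrix_apply]
  simp only [gram, Matrix.of_apply, ContinuousLinearMap.bilinearComp_apply, Matrix.mul_apply,
    Matrix.transpose_apply]
  rw [hL i, hL j]
  simp only [map_sum, map_smul, _root_.sum_apply, smul_apply, smul_eq_mul,
    Finset.sum_mul, Finset.mul_sum]
  refine Finset.sum_congr rfl fun a _ => Finset.sum_congr rfl fun b _ => by ring

theorem det_gram_comp (G : E →L[ℝ] E →L[ℝ] ℝ) (L : E →L[ℝ] E) :
    (gram (G.bilinearComp L L)).det = L.det ^ 2 * (gram G).det := by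
  rw [gram_comp, Matrix.det_mul, Matrix.det_mul, Matrix.det_transpose, LinearMap.det_toMatrix]
  rw [ContinuousLinearMap.det]
  ring

theorem formInner_comp (G : E →L[ℝ] E →L[ℝ] ℝ) (L : E →L[ℝ] E) (hL : L.det ≠ 0)
    (α β : E [⋀^Fin k]→L[ℝ] ℂ) :
    formInner (G.bilinearComp L L) (α.compContinuousLinearMap L) (β.compContinuousLinearMap L) =
      formInner G α β := by
  set C := LinearMap.toMatrix (refBasis E) (refBasis E) (L : E →ₗ[ℝ] E) with hC
  have hLb : ∀ i, L (refBasis E i) = ∑ l, C l i • refBasis E l := by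
    intro i
    conv_lhs => rw [← (refBasis E).sum_repr (L (refBasis E i))]
    simp [hC, LinearMap.toMatrix_apply]
  have hdet : IsUnit C.det := by
    rw [hC, LinearMap.det_toMatrix]
    exact isUnit_iff_ne_zero.2 hL
  have hH : C * (gram (G.bilinearComp L L))⁻¹ * C.transpose = (gram G)⁻¹ := by
    rw [gram_comp, ← hC, Matrix.mul_inv_rev, Matrix.mul_inv_rev, ← Matrix.mul_assoc,
      ← Matrix.mul_assoc, Matrix.mul_nonsing_inv _ hdet, Matrix.one_mul, Matrix.mul_assoc,
      Matrix.nonsing_inv_mul _ (by rwa [Matrix.det_transpose]), Matrix.mul_one]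
  rw [formInner, formInner, ← hH, ← sum_change]
  simp only [ContinuousAlternatingMap.compContinuousLinearMap_apply, Function.comp_def, hLb]

theorem IsInner.comp {G : E →L[ℝ] E →L[ℝ] ℝ} (h : IsInner G) (L : E →L[ℝ] E) (hL : L.det ≠ 0) :
    IsInner (G.bilinearComp L L) := by
  refine ⟨fun v w => by simp [h.1 (L v)], fun v hv => ?_⟩
  rw [ContinuousLinearMap.bilinearComp_apply]
  refine h.2 _ fun h0 => hv ?_
  have hu : IsUnit (LinearMap.det (L : E →ₗ[ℝ] E)) := isUnit_iff_ne_zero.2 hL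
  have hi := ((LinearMap.isUnit_iff_isUnit_det _).2 hu)
  rw [Module.End.isUnit_iff] at hi
  exact hi.1 (by simpa using h0)

end LinearAlgebra

section Metric

variable (E : Type*) [NormedAddCommGroup E] [NormedSpace ℂ E]
variable (M : Type*) [TopologicalSpace M] [ChartedSpace E M] [IsManifold 𝓘(ℂ, E) ω M]

/-- A Hermitian metric on the complex manifold `M`: a smooth Riemannian metric for which the complex
structure is an isometry. -/
structure HermitianMetric where
  /-- The inner product on each tangent space. -/
  val : M → E →L[ℝ] E →L[ℝ] ℝ
  symm : ∀ x v w, val x v w = val x w v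
  pos : ∀ x v, v ≠ 0 → 0 < val x v v
  hermitian : ∀ x v w, val x (Complex.I • v) (Complex.I • w) = val x v w
  smooth : ∀ c : M, ContDiffOn ℝ ∞
    (fun y => (val ((extChartAt 𝓘(ℂ, E) c).symm y)).bilinearComp
      (frame c ((extChartAt 𝓘(ℂ, E) c).symm y)) (frame c ((extChartAt 𝓘(ℂ, E) c).symm y)))
    (extChartAt 𝓘(ℂ, E) c).target

end Metric

section Volume

set_option linter.unusedSectionVars false

variable {E : Type*} [NormedAddCommGroup E] [NormedSpace ℂ E] [FiniteDimensional ℂ E]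
variable {M : Type*} [TopologicalSpace M] [ChartedSpace E M] [IsManifold 𝓘(ℂ, E) ω M]

/-- The metric at `x`, expressed in the coordinates of the chart at `c`. -/
def HermitianMetric.inChart (g : HermitianMetric E M) (c x : M) : E →L[ℝ] E →L[ℝ] ℝ :=
  (g.val x).bilinearComp (frame c x) (frame c x)

variable [MeasurableSpace E] [BorelSpace E] [MeasurableSpace M] [BorelSpace M]

/-- The Riemannian volume of the domain of the chart at `c`: in this chart, it is
`√(det g_{ij}) dx₁ ⋯ dx_{2n}`. -/
def chartVolume (g : HermitianMetric E M) (c : M) : Measure M :=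
  (((refBasis E).addHaar.withDensity fun y => ENNReal.ofReal
    √(gram (g.inChart c ((extChartAt 𝓘(ℂ, E) c).symm y))).det).restrict
      (extChartAt 𝓘(ℂ, E) c).target).map (extChartAt 𝓘(ℂ, E) c).symm

/-- The Riemannian volume measure of `M`. On the domain of each chart, it agrees with the volume
computed in this chart, and it is the least measure that is at least as large as all of these. -/
def vol (g : HermitianMetric E M) : Measure M := ⨆ c : M, chartVolume g c

/-! The volume is finite on compact sets. -/

theorem det_frame_ne_zero {c x : M} (h : x ∈ (extChartAt 𝓘(ℂ, E) c).source) :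
    (frame c x : E →L[ℝ] E).det ≠ 0 := by
  have h1 : ((frame c x : E →L[ℝ] E) : E →ₗ[ℝ] E).comp
      (((tangentCoordChange 𝓘(ℂ, E) x c x).restrictScalars ℝ : E →L[ℝ] E) : E →ₗ[ℝ] E)
        = LinearMap.id := by
    ext v
    have h2 := tangentCoordChange_comp (I := 𝓘(ℂ, E)) (w := x) (x := c) (y := x) (z := x) (v := v)
      ⟨⟨mem_extChartAt_source x, h⟩, mem_extChartAt_source x⟩
    rw [tangentCoordChange_self (mem_extChartAt_source x)] at h2
    exact h2
  have h3 := congrArg LinearMap.det h1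
  rw [LinearMap.det_comp, LinearMap.det_id] at h3
  exact left_ne_zero_of_mul_eq_one h3

theorem isInner_val (g : HermitianMetric E M) (x : M) : IsInner (g.val x) := ⟨g.symm x, g.pos x⟩

theorem isInner_inChart (g : HermitianMetric E M) {c x : M}
    (h : x ∈ (extChartAt 𝓘(ℂ, E) c).source) : IsInner (g.inChart c x) :=
  (isInner_val g x).comp _ (det_frame_ne_zero h)

theorem continuousOn_inChart (g : HermitianMetric E M) (c : M) :
    ContinuousOn (g.inChart c) (extChartAt 𝓘(ℂ, E) c).source := by
  have h := (g.smooth c).continuousOn.comp (continuousOn_extChartAt c)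
    (extChartAt 𝓘(ℂ, E) c).mapsTo
  refine h.congr fun x hx => ?_
  simp only [Function.comp_apply, (extChartAt 𝓘(ℂ, E) c).left_inv hx]
  rfl

theorem continuousOn_inChart_symm (g : HermitianMetric E M) (c : M) :
    ContinuousOn (fun y => g.inChart c ((extChartAt 𝓘(ℂ, E) c).symm y))
      (extChartAt 𝓘(ℂ, E) c).target :=
  (g.smooth c).continuousOn

theorem continuous_gram : Continuous (gram : (E →L[ℝ] E →L[ℝ] ℝ) → _) := by
  refine continuous_matrix fun i j => ?_
  simp only [gram, Matrix.of_apply]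
  fun_prop

theorem measurableSet_symm_preimage (c : M) {A : Set M} (hA : MeasurableSet A) :
    MeasurableSet ((extChartAt 𝓘(ℂ, E) c).target ∩ (extChartAt 𝓘(ℂ, E) c).symm ⁻¹' A) := by
  have ho := (isOpen_extChartAt_target (I := 𝓘(ℂ, E)) c).measurableSet
  have hc := (continuousOn_iff_continuous_domRestrict.1
    (continuousOn_extChartAt_symm (I := 𝓘(ℂ, E)) c)).measurable hA
  have h2 := ho.subtype_image hc
  convert h2 using 1
  ext y
  simp [and_comm]

theorem chartVolume_apply (g : HermitianMetric E M) (c : M) {A : Set M} (hA : MeasurableSet A) :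
    chartVolume g c A =
      ∫⁻ y in (extChartAt 𝓘(ℂ, E) c).target ∩ (extChartAt 𝓘(ℂ, E) c).symm ⁻¹' A,
        ENNReal.ofReal √(gram (g.inChart c ((extChartAt 𝓘(ℂ, E) c).symm y))).det
          ∂(refBasis E).addHaar := by
  have ho := (isOpen_extChartAt_target (I := 𝓘(ℂ, E)) c).measurableSet
  have hc := continuousOn_extChartAt_symm (I := 𝓘(ℂ, E)) c
  rw [chartVolume, Measure.map_apply_of_aemeasurable (hc.aemeasurable ho) hA,
    Measure.restrict_apply' ho, inter_comm, withDensity_apply _ (measurableSet_symm_preimage c hA)]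

theorem inChart_metric_change (g : HermitianMetric E M) {c c' x : M}
    (h : x ∈ (extChartAt 𝓘(ℂ, E) c).source) (h' : x ∈ (extChartAt 𝓘(ℂ, E) c').source) :
    g.inChart c x = (g.inChart c' x).bilinearComp
      ((tangentCoordChange 𝓘(ℂ, E) c c' x).restrictScalars ℝ)
      ((tangentCoordChange 𝓘(ℂ, E) c c' x).restrictScalars ℝ) := by
  ext v w
  simp only [HermitianMetric.inChart, ContinuousLinearMap.bilinearComp_apply]
  rw [← frame_tangentCoordChange h h' v, ← frame_tangentCoordChange h h' w]
  rfl

theorem chartVolume_eq (g : HermitianMetric E M) (c c' : M) {A : Set M} (hA : MeasurableSet A)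
    (h : A ⊆ (extChartAt 𝓘(ℂ, E) c).source) (h' : A ⊆ (extChartAt 𝓘(ℂ, E) c').source) :
    chartVolume g c A = chartVolume g c' A := by
  rw [chartVolume_apply g c hA, chartVolume_apply g c' hA]
  have himg : (extChartAt 𝓘(ℂ, E) c').target ∩ (extChartAt 𝓘(ℂ, E) c').symm ⁻¹' A =
      transition c c' '' ((extChartAt 𝓘(ℂ, E) c).target ∩ (extChartAt 𝓘(ℂ, E) c).symm ⁻¹' A) := by
    ext y
    constructor
    · rintro ⟨hy, hyA⟩
      refine ⟨extChartAt 𝓘(ℂ, E) c ((extChartAt 𝓘(ℂ, E) c').symm y),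
        ⟨(extChartAt 𝓘(ℂ, E) c).map_source (h hyA), ?_⟩, ?_⟩
      · rw [mem_preimage, (extChartAt 𝓘(ℂ, E) c).left_inv (h hyA)]
        exact hyA
      · simp only [transition, Function.comp_apply]
        rw [(extChartAt 𝓘(ℂ, E) c).left_inv (h hyA), (extChartAt 𝓘(ℂ, E) c').right_inv hy]
    · rintro ⟨y, ⟨hy, hyA⟩, rfl⟩
      refine ⟨(extChartAt 𝓘(ℂ, E) c').map_source (h' hyA), ?_⟩
      simp only [transition, Function.comp_apply, mem_preimage]
      rw [(extChartAt 𝓘(ℂ, E) c').left_inv (h' hyA)]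
      exact hyA
  rw [himg, lintegral_image_eq_lintegral_abs_det_fderiv_mul _ (measurableSet_symm_preimage c hA)
    (f' := fun y => (tangentCoordChange 𝓘(ℂ, E) c c'
      ((extChartAt 𝓘(ℂ, E) c).symm y)).restrictScalars ℝ)
    (fun y hy => ((hasFDerivAt_transition hy.1 (h' hy.2)).restrictScalars ℝ).hasFDerivWithinAt)]
  · refine setLIntegral_congr_fun (measurableSet_symm_preimage c hA) fun y hy => ?_
    have hx := h hy.2
    have hx' := h' hy.2
    simp only [transition, Function.comp_apply]
    rw [(extChartAt 𝓘(ℂ, E) c').left_inv hx', inChart_metric_change g hx hx', det_gram_comp,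
      ← ENNReal.ofReal_mul (abs_nonneg _), Real.sqrt_mul (sq_nonneg _), Real.sqrt_sq_eq_abs]
  · intro y hy z hz hyz
    simp only [transition, Function.comp_apply] at hyz
    have h1 := (extChartAt 𝓘(ℂ, E) c').injOn (h' hy.2) (h' hz.2) hyz
    exact (extChartAt 𝓘(ℂ, E) c).symm.injOn hy.1 hz.1 h1

theorem chartVolume_compl (g : HermitianMetric E M) (c : M) {A : Set M} (hA : MeasurableSet A) :
    chartVolume g c A = chartVolume g c (A ∩ (extChartAt 𝓘(ℂ, E) c).source) := by
  have ho := (isOpen_extChartAt_source (I := 𝓘(ℂ, E)) c).measurableSet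
  rw [chartVolume_apply g c hA, chartVolume_apply g c (hA.inter ho)]
  congr 2
  ext y
  simp only [mem_inter_iff, mem_preimage]
  exact ⟨fun h => ⟨h.1, h.2, (extChartAt 𝓘(ℂ, E) c).map_target h.1⟩, fun h => ⟨h.1, h.2.1⟩⟩

theorem vol_apply [SecondCountableTopology M] (g : HermitianMetric E M) (c : M) {A : Set M}
    (hA : MeasurableSet A) (h : A ⊆ (extChartAt 𝓘(ℂ, E) c).source) :
    vol g A = chartVolume g c A := by
  apply le_antisymm _ ((le_iSup (chartVolume g) c) A)
  set U : M → Set M := fun c => (extChartAt 𝓘(ℂ, E) c).source with hU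
  have hm : ∀ c, MeasurableSet (U c) := fun c =>
    (isOpen_extChartAt_source (I := 𝓘(ℂ, E)) c).measurableSet
  obtain ⟨s, hs, hsU⟩ := TopologicalSpace.countable_cover_nhds
    (fun x : M => extChartAt_source_mem_nhds (I := 𝓘(ℂ, E)) x)
  have := hs.to_subtype
  set ν : Measure M := chartVolume g c +
    Measure.sum fun i : s => (chartVolume g i.1).restrict (U c)ᶜ with hν
  have hle : vol g ≤ ν := by
    refine iSup_le fun c' => Measure.le_iff.2 fun B hB => ?_
    rw [← measure_inter_add_sdiff B (hm c), hν, Measure.add_apply]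
    refine add_le_add ?_ ?_
    · rw [chartVolume_compl g c' (hB.inter (hm c)),
        chartVolume_eq g c' c ((hB.inter (hm c)).inter (hm c')) inter_subset_right
          (inter_subset_left.trans inter_subset_right)]
      exact measure_mono (inter_subset_left.trans inter_subset_left)
    · rw [Measure.sum_apply _ hB]
      have hcov : B \ U c ⊆ ⋃ i : s, (B \ U c) ∩ U i.1 := by
        intro x hx
        have hxu : x ∈ ⋃ x ∈ s, (extChartAt 𝓘(ℂ, E) x).source := hsU ▸ mem_univ x
        obtain ⟨i, hi, hxi⟩ := mem_iUnion₂.1 hxu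
        exact mem_iUnion.2 ⟨⟨i, hi⟩, hx, hxi⟩
      refine (measure_mono hcov).trans ((measure_iUnion_le _).trans
        (ENNReal.tsum_le_tsum fun i => ?_))
      rw [chartVolume_compl g c' ((hB.diff (hm c)).inter (hm i.1)),
        chartVolume_eq g c' i.1 (((hB.diff (hm c)).inter (hm i.1)).inter (hm c')) inter_subset_right
          (inter_subset_left.trans inter_subset_right), Measure.restrict_apply hB]
      exact measure_mono fun x hx => ⟨hx.1.1.1, hx.1.1.2⟩
  refine (hle A).trans ?_
  rw [hν, Measure.add_apply, Measure.sum_apply _ hA]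
  have h0 : ∀ i : s, (chartVolume g i.1).restrict (U c)ᶜ A = 0 := by
    intro i
    rw [Measure.restrict_apply hA, (disjoint_compl_right_iff_subset.2 h).inter_eq, measure_empty]
  simp [h0]

theorem isLocallyFiniteMeasure_vol [SecondCountableTopology M] (g : HermitianMetric E M) :
    IsLocallyFiniteMeasure (vol g) := by
  refine ⟨fun x => ?_⟩
  have : ProperSpace E := FiniteDimensional.proper ℂ E
  obtain ⟨K, hK, hKt, hKc⟩ := local_compact_nhds
    (extChartAt_target_mem_nhds (I := 𝓘(ℂ, E)) x)
  refine ⟨(extChartAt 𝓘(ℂ, E) x).source ∩ extChartAt 𝓘(ℂ, E) x ⁻¹' (interior K), ?_, ?_⟩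
  · exact inter_mem (extChartAt_source_mem_nhds x) ((continuousAt_extChartAt x)
      (interior_mem_nhds.2 hK))
  · have hmeas : MeasurableSet
        ((extChartAt 𝓘(ℂ, E) x).source ∩ extChartAt 𝓘(ℂ, E) x ⁻¹' (interior K)) :=
      (isOpen_extChartAt_preimage' x isOpen_interior).measurableSet
    rw [vol_apply g x hmeas inter_subset_left, chartVolume_apply g x hmeas]
    obtain ⟨C, hC⟩ := hKc.exists_bound_of_continuousOn (f := fun y =>
      √(gram (g.inChart x ((extChartAt 𝓘(ℂ, E) x).symm y))).det)
      ((Real.continuous_sqrt.comp continuous_gram.matrix_det).comp_continuousOn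
        ((continuousOn_inChart_symm g x).mono hKt))
    refine lt_of_le_of_lt (lintegral_mono_set (t := K) ?_) ?_
    · rintro y ⟨hy, hy2⟩
      have := hy2.2
      rw [mem_preimage, (extChartAt 𝓘(ℂ, E) x).right_inv hy] at this
      exact interior_subset this
    · refine lt_of_le_of_lt (setLIntegral_mono' (g := fun _ => ENNReal.ofReal C)
        hKc.isClosed.measurableSet fun y hy => ENNReal.ofReal_le_ofReal
          ((le_abs_self _).trans (hC y hy))) ?_
      rw [setLIntegral_const]
      exact ENNReal.mul_lt_top ENNReal.ofReal_lt_top hKc.measure_lt_top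

end Volume

section Hilbert

set_option linter.unusedSectionVars false

variable {E : Type*} [NormedAddCommGroup E] [NormedSpace ℂ E] [FiniteDimensional ℂ E]
variable {M : Type*} [TopologicalSpace M] [ChartedSpace E M] [IsManifold 𝓘(ℂ, E) ω M]
variable [MeasurableSpace E] [BorelSpace E] [MeasurableSpace M] [BorelSpace M]
variable {k p q : ℕ}

/-- The pointwise Hermitian inner product of two forms, linear in the first one. -/
def pointInner (g : HermitianMetric E M) (α β : Form E M k) (x : M) : ℂ :=
  formInner (g.val x) (α x) (β x)

/-- Measurability of a form: its coefficients in each chart are Borel measurable. -/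
def IsMeasurableForm (u : Form E M k) : Prop :=
  ∀ (c : M) (v : Fin k → E), Measurable fun x : (extChartAt 𝓘(ℂ, E) c).source => inChart u c x v

theorem pointInner_eq (g : HermitianMetric E M) (α β : Form E M k) {c x : M}
    (h : x ∈ (extChartAt 𝓘(ℂ, E) c).source) :
    pointInner g α β x = formInner (g.inChart c x) (inChart α c x) (inChart β c x) :=
  (formInner_comp (g.val x) (frame c x) (det_frame_ne_zero h) (α x) (β x)).symm

theorem continuousOn_gram_inv (g : HermitianMetric E M) (c : M)
    (i j : Fin (Module.finrank ℝ E)) :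
    ContinuousOn (fun x => (gram (g.inChart c x))⁻¹ i j) (extChartAt 𝓘(ℂ, E) c).source := by
  have h1 : ContinuousOn (fun x => gram (g.inChart c x)) (extChartAt 𝓘(ℂ, E) c).source :=
    continuous_gram.comp_continuousOn (continuousOn_inChart g c)
  have h2 : ContinuousOn (fun x => (gram (g.inChart c x)).det⁻¹ *
      (gram (g.inChart c x)).adjugate i j) (extChartAt 𝓘(ℂ, E) c).source := by
    refine ContinuousOn.mul (ContinuousOn.inv₀ ?_ fun x hx => ?_) ?_
    · exact (continuous_id.matrix_det).comp_continuousOn h1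
    · exact (isInner_inChart g hx).posDef.det_pos.ne'
    · exact ((continuous_id.matrix_adjugate).matrix_elem i j).comp_continuousOn h1
  refine h2.congr fun x _ => ?_
  simp [Matrix.inv_def, Ring.inverse_eq_inv']

theorem measurable_of_charts [SecondCountableTopology M] {f : M → ℂ}
    (h : ∀ c : M, Measurable fun x : (extChartAt 𝓘(ℂ, E) c).source => f x) : Measurable f := by
  obtain ⟨s, hs, hsU⟩ := TopologicalSpace.countable_cover_nhds
    (fun x : M => extChartAt_source_mem_nhds (I := 𝓘(ℂ, E)) x)
  intro t ht
  have h1 : f ⁻¹' t = ⋃ c ∈ s,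
      Subtype.val '' ((fun x : (extChartAt 𝓘(ℂ, E) c).source => f x) ⁻¹' t) := by
    ext x
    have hxu : x ∈ ⋃ x ∈ s, (extChartAt 𝓘(ℂ, E) x).source := hsU ▸ mem_univ x
    obtain ⟨i, hi, hxi⟩ := mem_iUnion₂.1 hxu
    constructor
    · intro hx
      exact mem_iUnion₂.2 ⟨i, hi, ⟨x, hxi⟩, hx, rfl⟩
    · intro hx
      obtain ⟨_, _, ⟨_, hy, rfl⟩⟩ := mem_iUnion₂.1 hx
      exact hy
  rw [h1]
  exact MeasurableSet.biUnion hs fun c _ =>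
    (isOpen_extChartAt_source (I := 𝓘(ℂ, E)) c).measurableSet.subtype_image (h c ht)

theorem measurable_pointInner [SecondCountableTopology M] (g : HermitianMetric E M)
    {α β : Form E M k} (hα : IsMeasurableForm α) (hβ : IsMeasurableForm β) :
    Measurable (pointInner g α β) := by
  refine measurable_of_charts (E := E) fun c => ?_
  have h1 : (fun x : (extChartAt 𝓘(ℂ, E) c).source => pointInner g α β x) =
      fun x : (extChartAt 𝓘(ℂ, E) c).source =>
        formInner (g.inChart c x) (inChart α c x) (inChart β c x) :=
    funext fun x => pointInner_eq g α β x.2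
  rw [h1]
  simp only [formInner]
  refine measurable_const.mul (Finset.measurable_sum _ fun I _ =>
    Finset.measurable_sum _ fun J _ => Measurable.mul ?_ ((hα c _).mul ?_))
  · refine Complex.measurable_ofReal.comp (Finset.measurable_prod _ fun a _ => ?_)
    exact (continuousOn_iff_continuous_domRestrict.1 (continuousOn_gram_inv g c _ _)).measurable
  · exact Complex.continuous_conj.measurable.comp (hβ c _)

theorem IsSmoothForm.continuousOn {α : Form E M k} (hα : IsSmoothForm α) (c : M) (v : Fin k → E) :
    ContinuousOn (fun x => inChart α c x v) (extChartAt 𝓘(ℂ, E) c).source := by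
  have h := (hα c).continuousOn.comp (continuousOn_extChartAt c)
    (extChartAt 𝓘(ℂ, E) c).mapsTo
  have h2 := (ContinuousAlternatingMap.apply ℝ E ℂ v).continuous.comp_continuousOn h
  refine h2.congr fun x hx => ?_
  simp [coord, -extChartAt, (extChartAt 𝓘(ℂ, E) c).left_inv hx]

theorem IsSmoothForm.isMeasurableForm {α : Form E M k} (hα : IsSmoothForm α) :
    IsMeasurableForm α := fun c v =>
  (continuousOn_iff_continuous_domRestrict.1 (hα.continuousOn c v)).measurable

theorem continuous_pointInner (g : HermitianMetric E M)
    {α β : Form E M k} (hα : IsSmoothForm α) (hβ : IsSmoothForm β) :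
    Continuous (pointInner g α β) := by
  rw [continuous_iff_continuousAt]
  intro c
  have h : ContinuousOn (fun x => formInner (g.inChart c x) (inChart α c x) (inChart β c x))
      (extChartAt 𝓘(ℂ, E) c).source := by
    simp only [formInner]
    refine continuousOn_const.mul (continuousOn_finsetSum _ fun I _ =>
      continuousOn_finsetSum _ fun J _ => ContinuousOn.mul ?_ ((hα.continuousOn c _).mul ?_))
    · exact Complex.continuous_ofReal.comp_continuousOn
        (continuousOn_finsetProd _ fun a _ => continuousOn_gram_inv g c _ _)
    · exact Complex.continuous_conj.comp_continuousOn (hβ.continuousOn c _)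
  exact (h.congr fun x hx => pointInner_eq g α β hx).continuousAt (extChartAt_source_mem_nhds c)

theorem inChart_add (α β : Form E M k) (c x : M) :
    inChart (α + β) c x = inChart α c x + inChart β c x := by
  ext v; simp [inChart]

theorem inChart_smul (a : ℂ) (α : Form E M k) (c x : M) :
    inChart (a • α) c x = a • inChart α c x := by
  ext v; simp [inChart]

theorem pointInner_add_left (g : HermitianMetric E M) (α α' β : Form E M k) (x : M) :
    pointInner g (α + α') β x = pointInner g α β x + pointInner g α' β x :=
  formInner_add_left _ _ _ _

theorem pointInner_smul_left (g : HermitianMetric E M) (a : ℂ) (α β : Form E M k) (x : M) :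
    pointInner g (a • α) β x = a * pointInner g α β x :=
  formInner_smul_left _ _ _ _

theorem pointInner_conj (g : HermitianMetric E M) (α β : Form E M k) (x : M) :
    conj (pointInner g α β x) = pointInner g β α x :=
  (isInner_val g x).conj_symm _ _

theorem integrable_pointInner [SecondCountableTopology M] (g : HermitianMetric E M)
    {α β : Form E M k} (hα : IsMeasurableForm α) (hβ : IsMeasurableForm β)
    (hα' : Integrable (pointInner g α α) (vol g)) (hβ' : Integrable (pointInner g β β) (vol g)) :
    Integrable (pointInner g α β) (vol g) :=
  (hα'.re.add hβ'.re).mono' (measurable_pointInner g hα hβ).aestronglyMeasurable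
    (Eventually.of_forall fun x => (isInner_val g x).norm_le (α x) (β x))

variable [SecondCountableTopology M]

/-- The measurable forms (of degree `k`) of type `(p, q)` with finite `L²` norm. -/
def l2Forms (g : HermitianMetric E M) (k p q : ℕ) : Submodule ℂ (Form E M k) where
  carrier := {u | IsMeasurableForm u ∧ (∀ x, IsOfType p q (u x)) ∧
    Integrable (pointInner g u u) (vol g)}
  zero_mem' := by
    refine ⟨fun c v => ?_, fun x z v => by simp, ?_⟩
    · have e : (fun x : (extChartAt 𝓘(ℂ, E) c).source => inChart (0 : Form E M k) c x v) =
          fun _ => 0 := by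
        ext x; simp [inChart]
      rw [e]
      exact measurable_const
    · have : pointInner g (0 : Form E M k) 0 = fun _ => 0 := by
        ext x; simp [pointInner, formInner]
      rw [this]
      exact integrable_zero _ _ _
  add_mem' := by
    rintro u v ⟨h1, h2, h3⟩ ⟨h1', h2', h3'⟩
    refine ⟨fun c w => ?_, fun x z w => ?_, ?_⟩
    · simp only [inChart_add, ContinuousAlternatingMap.add_apply]
      exact (h1 c w).add (h1' c w)
    · simp [h2 x z w, h2' x z w, mul_add]
    · have e : pointInner g (u + v) (u + v) = fun x => (pointInner g u u x + pointInner g u v x) +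
          (pointInner g v u x + pointInner g v v x) := by
        ext x
        rw [pointInner_add_left, ← pointInner_conj g (u + v) u, ← pointInner_conj g (u + v) v,
          pointInner_add_left, pointInner_add_left]
        simp only [map_add, pointInner_conj]
      rw [e]
      exact (h3.add (integrable_pointInner g h1 h1' h3 h3')).add
        ((integrable_pointInner g h1' h1 h3' h3).add h3')
  smul_mem' := by
    rintro a u ⟨h1, h2, h3⟩
    refine ⟨fun c w => ?_, fun x z w => ?_, ?_⟩
    · simp only [inChart_smul, ContinuousAlternatingMap.smul_apply]
      exact (h1 c w).const_smul a
    · simp only [Pi.smul_apply, ContinuousAlternatingMap.smul_apply, h2 x z w, smul_eq_mul]; ring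
    · have e : pointInner g (a • u) (a • u) = fun x => (a * conj a) * pointInner g u u x := by
        ext x
        rw [pointInner_smul_left, ← pointInner_conj g (a • u) u, pointInner_smul_left]
        simp only [map_mul, pointInner_conj]
        ring
      rw [e]
      exact h3.const_mul _

/-- The space of measurable square integrable `(p, q)`-forms, before almost everywhere equal forms
are identified. -/
def PreL2 (g : HermitianMetric E M) (k p q : ℕ) : Type _ := l2Forms g k p q

instance (g : HermitianMetric E M) (k p q : ℕ) : AddCommGroup (PreL2 g k p q) :=
  inferInstanceAs (AddCommGroup (l2Forms g k p q))

instance (g : HermitianMetric E M) (k p q : ℕ) : Module ℂ (PreL2 g k p q) :=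
  inferInstanceAs (Module ℂ (l2Forms g k p q))

/-- The form underlying an element of `PreL2`. -/
def PreL2.form {g : HermitianMetric E M} {k p q : ℕ} (u : PreL2 g k p q) : Form E M k :=
  Subtype.val (p := fun v => v ∈ l2Forms g k p q) u

theorem PreL2.mem {g : HermitianMetric E M} {k p q : ℕ} (u : PreL2 g k p q) :
    u.form ∈ l2Forms g k p q :=
  Subtype.property (p := fun v => v ∈ l2Forms g k p q) u

/-- The `L²` inner product `⟨v, u⟩ = ∫ h(v, u) vol`, written with Mathlib's convention: `inner u v`
is linear in `v`. -/
@[reducible]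
def preL2Core (g : HermitianMetric E M) (k p q : ℕ) :
    PreInnerProductSpace.Core ℂ (PreL2 g k p q) where
  inner u v := ∫ x, pointInner g v.form u.form x ∂(vol g)
  conj_inner_symm u v := by
    rw [← integral_conj]
    exact integral_congr_ae (Eventually.of_forall fun x => pointInner_conj g _ _ x)
  re_inner_nonneg u := by
    have h : ∀ x, pointInner g u.form u.form x = (((pointInner g u.form u.form x).re : ℝ) : ℂ) :=
      fun x => Complex.ext rfl ((isInner_val g x).self_nonneg (u.form x)).2
    have h2 : ∫ x, pointInner g u.form u.form x ∂(vol g) =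
        ((∫ x, (pointInner g u.form u.form x).re ∂(vol g) : ℝ) : ℂ) :=
      (integral_congr_ae (Eventually.of_forall h)).trans integral_ofReal
    rw [h2]
    exact integral_nonneg fun x => ((isInner_val g x).self_nonneg (u.form x)).1
  add_left u v w := by
    have e : pointInner g w.form (u + v).form =
        fun x => pointInner g w.form u.form x + pointInner g w.form v.form x := by
      ext x
      rw [← pointInner_conj, show (u + v).form = u.form + v.form from rfl, pointInner_add_left,
        map_add, pointInner_conj, pointInner_conj]
    rw [e]
    exact integral_add (integrable_pointInner g w.mem.1 u.mem.1 w.mem.2.2 u.mem.2.2)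
      (integrable_pointInner g w.mem.1 v.mem.1 w.mem.2.2 v.mem.2.2)
  smul_left u v a := by
    have e : pointInner g v.form (a • u).form = fun x => conj a * pointInner g v.form u.form x := by
      ext x
      rw [← pointInner_conj, show (a • u).form = a • u.form from rfl, pointInner_smul_left, map_mul,
        pointInner_conj]
    rw [e]
    exact integral_const_mul _ _

instance (g : HermitianMetric E M) (k p q : ℕ) : SeminormedAddCommGroup (PreL2 g k p q) :=
  letI := preL2Core g k p q
  InnerProductSpace.Core.toSeminormedAddCommGroup (𝕜 := ℂ)

instance (g : HermitianMetric E M) (k p q : ℕ) : InnerProductSpace ℂ (PreL2 g k p q) :=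
  InnerProductSpace.ofCore (preL2Core g k p q)

/-- The Hilbert space `L²Λ^{p,q}`: the measurable square integrable `(p, q)`-forms, modulo the forms
of norm `0`, that is, modulo equality almost everywhere. -/
abbrev L2 (g : HermitianMetric E M) (k p q : ℕ) : Type _ := SeparationQuotient (PreL2 g k p q)

theorem A0_le_l2Forms (g : HermitianMetric E M) (k p q : ℕ) : A0 E M k p q ≤ l2Forms g k p q := by
  rintro α ⟨h1, h2, h3⟩
  refine ⟨h1.isMeasurableForm, h2, ?_⟩
  have := isLocallyFiniteMeasure_vol g
  refine (continuous_pointInner g h1 h1).integrable_of_hasCompactSupport (h3.mono fun x hx h => ?_)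
  apply hx
  simp [pointInner, formInner, h]

/-- The inclusion of `A₀^{p,q}` in `L²Λ^{p,q}`. -/
def toL2 (g : HermitianMetric E M) {k p q : ℕ} : A0 E M k p q →ₗ[ℂ] L2 g k p q :=
  (SeparationQuotient.mkCLM ℂ (PreL2 g k p q)).toLinearMap ∘ₗ
    (Submodule.inclusion (A0_le_l2Forms g k p q) : A0 E M k p q →ₗ[ℂ] PreL2 g k p q)

variable {k₁ p₁ q₁ k₂ p₂ q₂ : ℕ}

/-- `Q` is the formal adjoint of `P`. -/
def IsFormalAdjoint (g : HermitianMetric E M) (P : A0 E M k₁ p₁ q₁ →ₗ[ℂ] A0 E M k₂ p₂ q₂)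
    (Q : A0 E M k₂ p₂ q₂ →ₗ[ℂ] A0 E M k₁ p₁ q₁) : Prop :=
  ∀ u v, inner ℂ (toL2 g (P u)) (toL2 g v) = inner ℂ (toL2 g u) (toL2 g (Q v))

open Classical in
/-- The formal adjoint `P*` of a differential operator `P` (on compactly supported forms). It exists
and is unique for the operators considered here; the value for an operator without
formal adjoint is irrelevant. -/
def formalAdjoint (g : HermitianMetric E M) (P : A0 E M k₁ p₁ q₁ →ₗ[ℂ] A0 E M k₂ p₂ q₂) :
    A0 E M k₂ p₂ q₂ →ₗ[ℂ] A0 E M k₁ p₁ q₁ :=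
  if h : ∃ Q, IsFormalAdjoint g P Q then h.choose else 0

/-- The graph of `P₀`: the operator `P` on compactly supported smooth forms, as an unbounded
operator between `L²` spaces. -/
def graph0 (g : HermitianMetric E M) (P : A0 E M k₁ p₁ q₁ →ₗ[ℂ] A0 E M k₂ p₂ q₂) :
    Submodule ℂ (L2 g k₁ p₁ q₁ × L2 g k₂ p₂ q₂) :=
  LinearMap.range ((toL2 g).prod (toL2 g ∘ₗ P))

/-- The (graph of the) strong extension of `P`: the closure of the graph of `P₀`. -/
def strongExt (g : HermitianMetric E M) (P : A0 E M k₁ p₁ q₁ →ₗ[ℂ] A0 E M k₂ p₂ q₂) :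
    Submodule ℂ (L2 g k₁ p₁ q₁ × L2 g k₂ p₂ q₂) :=
  (graph0 g P).topologicalClosure

/-- The (graph of the) weak extension of `P`: the pairs `(u, v)` with `⟨v, w⟩ = ⟨u, P* w⟩` for all
compactly supported smooth `w`. -/
def weakExt (g : HermitianMetric E M) (P : A0 E M k₁ p₁ q₁ →ₗ[ℂ] A0 E M k₂ p₂ q₂) :
    Submodule ℂ (L2 g k₁ p₁ q₁ × L2 g k₂ p₂ q₂) where
  carrier := {z | ∀ w : A0 E M k₂ p₂ q₂,
    inner ℂ (toL2 g w) z.2 = inner ℂ (toL2 g (formalAdjoint g P w)) z.1}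
  zero_mem' := by simp
  add_mem' := by
    intro a b ha hb w
    simp [inner_add_right, ha w, hb w]
  smul_mem' := by
    intro c a ha w
    simp [inner_smul_right, ha w]

/-- A (densely defined) operator on a Hilbert space is self-adjoint: it equals its adjoint, that is,
its graph is the graph of its adjoint. -/
def IsSelfAdjointOp {H : Type*} [NormedAddCommGroup H] [InnerProductSpace ℂ H]
    (T : H →ₗ.[ℂ] H) : Prop :=
  Dense (T.domain : Set H) ∧ T.graph.adjoint = T.graph

/-- `P₀` is essentially self-adjoint: it has a unique self-adjoint extension. -/
def IsEssentiallySelfAdjoint (g : HermitianMetric E M) (P : A0 E M k p q →ₗ[ℂ] A0 E M k p q) :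
    Prop :=
  ∃! T : L2 g k p q →ₗ.[ℂ] L2 g k p q, graph0 g P ≤ T.graph ∧ IsSelfAdjointOp T

/-- `∂* : A₀^{p+1,q} → A₀^{p,q}`. -/
def delStar (g : HermitianMetric E M) : A0 E M (k + 1) (p + 1) q →ₗ[ℂ] A0 E M k p q :=
  formalAdjoint g del

/-- `∂̄* : A₀^{p,q+1} → A₀^{p,q}`. -/
def delbarStar (g : HermitianMetric E M) : A0 E M (k + 1) p (q + 1) →ₗ[ℂ] A0 E M k p q :=
  formalAdjoint g delbar

/-- `∂∂* : A₀^{p,q} → A₀^{p,q}`, which is `0` for `p = 0`, where `∂*` vanishes. -/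
def delDelStar (g : HermitianMetric E M) : (k p q : ℕ) → A0 E M k p q →ₗ[ℂ] A0 E M k p q
  | _ + 1, _ + 1, _ => del ∘ₗ delStar g
  | _, _, _ => 0

/-- `∂̄∂̄* : A₀^{p,q} → A₀^{p,q}`, which is `0` for `q = 0`, where `∂̄*` vanishes. -/
def delbarDelbarStar (g : HermitianMetric E M) : (k p q : ℕ) → A0 E M k p q →ₗ[ℂ] A0 E M k p q
  | _ + 1, _, _ + 1 => delbar ∘ₗ delbarStar g
  | _, _, _ => 0

/-- `∂∂̄ : A₀^{p,q} → A₀^{p+1,q+1}`. -/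
def delDelbar : A0 E M k p q →ₗ[ℂ] A0 E M (k + 2) (p + 1) (q + 1) :=
  del ∘ₗ delbar

/-- `∂̄*∂* : A₀^{p+1,q+1} → A₀^{p,q}`. -/
def delbarStarDelStar (g : HermitianMetric E M) :
    A0 E M (k + 2) (p + 1) (q + 1) →ₗ[ℂ] A0 E M k p q :=
  delbarStar g ∘ₗ delStar g

/-- `□_BC = ∂∂̄∂̄*∂* + (∂*∂ + ∂̄*∂̄)²` on `A₀^{p+1,q+1}`. -/
def boxBC (g : HermitianMetric E M) (k p q : ℕ) :
    A0 E M (k + 2) (p + 1) (q + 1) →ₗ[ℂ] A0 E M (k + 2) (p + 1) (q + 1) :=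
  delDelbar ∘ₗ delbarStarDelStar g + (delStar g ∘ₗ del + delbarStar g ∘ₗ delbar) ^ 2

/-- `□_A = ∂̄*∂*∂∂̄ + (∂∂* + ∂̄∂̄*)²` on `A₀^{p,q}`. -/
def boxA (g : HermitianMetric E M) (k p q : ℕ) : A0 E M k p q →ₗ[ℂ] A0 E M k p q :=
  delbarStarDelStar g ∘ₗ delDelbar + (delDelStar g k p q + delbarDelbarStar g k p q) ^ 2

end Hilbert

end ABC

end

open ABC

noncomputable section

namespace ABC

set_option linter.unusedSectionVars false

/-! ### Linear relations between Hilbert spaces and their adjoints. -/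

section LinearRelations

variable {H K : Type*} [NormedAddCommGroup H] [InnerProductSpace ℂ H]
  [NormedAddCommGroup K] [InnerProductSpace ℂ K]

/-! The theorem is a statement about abstract unbounded operators. Let `P` have formal adjoint `P'`,
and let `S` be symmetric on the target of `P`, with `P' S = 0`. If `P P' + S²` has at most one
self-adjoint extension, then `P_s = P_w` (`closure_eq_adjoint_of_unique`). For `□_BC` one takes `P =
∂∂̄` and `S = ∂*∂ + ∂̄*∂̄`; for `□_A` one takes `P = ∂̄*∂*` and `S = ∂∂* + ∂̄∂̄*`. The condition `P'
S = 0` comes from `∂² = ∂̄² = ∂∂̄ + ∂̄∂ = 0`. Once the extensions of one of `∂∂̄`, `∂̄*∂*` agree,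
taking adjoints gives the same for the other.

Let `C = S*` be the maximal extension of `S`. For every closed `A` with `P₀ ⊆ A ⊆ P_w`, the range of
`A` lies in `ker C`, because `P' S = 0`. Split the space into `ker C` and its complement. On the
first part von Neumann's theorem makes `1 + A A*` surjective, on the second it makes `1 + C* C`
surjective, and the two solutions do not interfere. So `A A* + C* C` is symmetric with `1 +` it
surjective, hence self-adjoint (`adjoint_sumRel`), and it extends `P P' + S²`. The choices `A = P_s`
and `A = P_w` thus give two self-adjoint extensions, which uniqueness identifies.

It remains to recover `P_s = P_w` from `P_s P_s* + C* C = P_w P_w* + C* C`. Let `(a, b)` lie in the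
graph of `P_w`, orthogonal to that of `P_s`; then `P_s* b = -a`. Solve `u + P_s P_s* u = b`. Since
`u` is in `ker C`, the equality puts `u` in the domain of `P_w*`, and pairing with `(a, b)` gives
`‖b‖² = 0`, whence `a = 0`.

The geometry supplies the hypotheses: `L²` is complete (`completeSpace_preL2`), compactly supported
smooth forms are dense in it (`denseRange_toL2`), and `∂`, `∂̄` have formal adjoints
(`exists_isFormalAdjoint`). Neither ellipticity nor completeness of the metric enters. -/

theorem isClosed_adjoint (A : Submodule ℂ (H × K)) : IsClosed (A.adjoint : Set (K × H)) := by
  rw [Submodule.adjoint, Submodule.map_coe, LinearEquiv.coe_coe, LinearEquiv.image_eq_preimage_symm]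
  exact (Submodule.isClosed_orthogonal _).preimage (WithLp.prod_continuous_toLp _ _ _)

theorem adjoint_anti {A B : Submodule ℂ (H × K)} (h : A ≤ B) : B.adjoint ≤ A.adjoint := by
  intro x hx
  rw [Submodule.mem_adjoint_iff] at hx ⊢
  exact fun a b hab => hx a b (h hab)

theorem le_adjoint_adjoint (A : Submodule ℂ (H × K)) : A ≤ A.adjoint.adjoint := by
  rintro ⟨u, v⟩ huv
  rw [Submodule.mem_adjoint_iff]
  intro a b hab
  have h := (Submodule.mem_adjoint_iff _ _).1 hab u v huv
  dsimp only at h ⊢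
  rw [← inner_conj_symm, ← inner_conj_symm a v, ← map_sub, ← neg_sub, h]
  simp

/-- The double adjoint is closed and contains `A`, hence contains the closure of `A`; taking
adjoints once more gives the nontrivial inclusion. -/
theorem adjoint_topologicalClosure (A : Submodule ℂ (H × K)) :
    A.topologicalClosure.adjoint = A.adjoint := by
  refine le_antisymm (adjoint_anti A.le_topologicalClosure) ?_
  have h : A.topologicalClosure ≤ A.adjoint.adjoint :=
    A.topologicalClosure_minimal (le_adjoint_adjoint A) (isClosed_adjoint _)
  exact (le_adjoint_adjoint _).trans (adjoint_anti h)

theorem exists_orthogonal_decomposition [CompleteSpace H] [CompleteSpace K]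
    {A : Submodule ℂ (H × K)} (hA : IsClosed (A : Set (H × K))) (f : H) (g : K) :
    ∃ u v, (u, v) ∈ A ∧ ∀ a b, (a, b) ∈ A → inner ℂ a (f - u) + inner ℂ b (g - v) = 0 := by
  -- The product norm on `H × K` is not Hilbertian, so the projection is made in `WithLp 2 (H × K)`,
  -- which has the same topology.
  set A' : Submodule ℂ (WithLp 2 (H × K)) :=
    A.comap (WithLp.linearEquiv 2 ℂ (H × K) : WithLp 2 (H × K) →ₗ[ℂ] H × K)
  have hcl : IsClosed (A' : Set (WithLp 2 (H × K))) :=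
    hA.preimage (WithLp.prod_continuous_ofLp 2 H K)
  have : CompleteSpace A' := hcl.completeSpace_coe
  set z : WithLp 2 (H × K) := WithLp.toLp 2 (f, g)
  set y : WithLp 2 (H × K) := A'.starProjection z
  have hy : y ∈ A' := Submodule.starProjection_apply_mem A' z
  refine ⟨y.fst, y.snd, hy, fun a b hab => ?_⟩
  have h := Submodule.starProjection_inner_eq_zero (K := A') z (WithLp.toLp 2 (a, b)) hab
  rw [← inner_conj_symm, map_eq_zero] at h
  rw [WithLp.prod_inner_apply] at h
  exact h

theorem adjoint_adjoint [CompleteSpace H] [CompleteSpace K]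
    (A : Submodule ℂ (H × K)) : A.adjoint.adjoint = A.topologicalClosure := by
  refine le_antisymm ?_
    (A.topologicalClosure_minimal (le_adjoint_adjoint A) (isClosed_adjoint _))
  rintro ⟨f, g⟩ hfg
  obtain ⟨u, v, huv, h⟩ := exists_orthogonal_decomposition A.isClosed_topologicalClosure f g
  -- Rotating a vector orthogonal to `A` gives an element of the adjoint. Pairing it with `(f, g)`
  -- and with `(u, v)`, both in the double adjoint, shows that the remainder has norm zero.
  have h1 : (g - v, -(f - u)) ∈ A.adjoint := by
    rw [Submodule.mem_adjoint_iff]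
    intro a b hab
    rw [inner_neg_right, sub_neg_eq_add, add_comm]
    exact h a b (A.le_topologicalClosure hab)
  have h2 := (Submodule.mem_adjoint_iff _ _).1 hfg _ _ h1
  have h3 := (Submodule.mem_adjoint_iff _ _).1
    (A.topologicalClosure_minimal (le_adjoint_adjoint A) (isClosed_adjoint _) huv) _ _ h1
  have h4 : inner ℂ (f - u) (f - u) + inner ℂ (g - v) (g - v) = 0 := by
    simp only [inner_neg_left] at h2 h3
    rw [inner_sub_right, inner_sub_right]
    linear_combination h3 - h2
  have h5 : (‖f - u‖ ^ 2 + ‖g - v‖ ^ 2 : ℝ) = 0 := by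
    have := congrArg Complex.re h4
    simpa [← Complex.ofReal_pow, inner_self_eq_norm_sq_to_K] using this
  have h6 : f - u = 0 := by
    rw [← norm_eq_zero]; nlinarith [sq_nonneg ‖f - u‖, sq_nonneg ‖g - v‖]
  have h7 : g - v = 0 := by
    rw [← norm_eq_zero]; nlinarith [sq_nonneg ‖f - u‖, sq_nonneg ‖g - v‖]
  rw [sub_eq_zero.1 h6, sub_eq_zero.1 h7]
  exact huv

/-- Von Neumann: `1 + A* A` is surjective for a closed relation `A`. -/
theorem exists_add_adjoint_comp_eq [CompleteSpace H] [CompleteSpace K]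
    {A : Submodule ℂ (H × K)} (hA : IsClosed (A : Set (H × K))) (f : H) :
    ∃ u v w, (u, v) ∈ A ∧ (v, w) ∈ A.adjoint ∧ u + w = f := by
  -- Project `(f, 0)` onto `A`: the remainder `(f - u, -v)` is orthogonal to `A`, which says exactly
  -- that `(v, f - u)` belongs to the adjoint.
  obtain ⟨u, v, huv, h⟩ := exists_orthogonal_decomposition hA f 0
  refine ⟨u, v, f - u, huv, ?_, by abel⟩
  rw [Submodule.mem_adjoint_iff]
  intro a b hab
  have := h a b hab
  simp only [zero_sub, inner_neg_right] at this
  dsimp only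
  linear_combination -this

/-- The relation `A A* + C* C`. -/
def sumRel (A : Submodule ℂ (H × K)) (C : Submodule ℂ (K × K)) : Submodule ℂ (K × K) where
  carrier := {z | ∃ a s c t, (z.1, a) ∈ A.adjoint ∧ (a, s) ∈ A ∧ (z.1, c) ∈ C ∧
    (c, t) ∈ C.adjoint ∧ z.2 = s + t}
  zero_mem' := ⟨0, 0, 0, 0, zero_mem _, zero_mem _, zero_mem _, zero_mem _, by simp⟩
  add_mem' := by
    rintro z z' ⟨a, s, c, t, h1, h2, h3, h4, h5⟩ ⟨a', s', c', t', h1', h2', h3', h4', h5'⟩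
    refine ⟨a + a', s + s', c + c', t + t', add_mem h1 h1', add_mem h2 h2', add_mem h3 h3',
      add_mem h4 h4', ?_⟩
    rw [Prod.snd_add, h5, h5']; abel
  smul_mem' := by
    rintro x z ⟨a, s, c, t, h1, h2, h3, h4, h5⟩
    refine ⟨x • a, x • s, x • c, x • t, Submodule.smul_mem _ x h1, Submodule.smul_mem _ x h2,
      Submodule.smul_mem _ x h3, Submodule.smul_mem _ x h4, ?_⟩
    rw [Prod.smul_snd, h5, smul_add]

theorem sumRel_le_adjoint (A : Submodule ℂ (H × K)) (C : Submodule ℂ (K × K)) :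
    sumRel A C ≤ (sumRel A C).adjoint := by
  rintro ⟨u, f⟩ ⟨a, s, c, t, h1, h2, h3, h4, h5⟩
  rw [Submodule.mem_adjoint_iff]
  rintro u' f' ⟨a', s', c', t', h1', h2', h3', h4', h5'⟩
  have e1 := (Submodule.mem_adjoint_iff _ _).1 h1 _ _ h2'
  have e2 := (Submodule.mem_adjoint_iff _ _).1 h1' _ _ h2
  have e3 := (Submodule.mem_adjoint_iff _ _).1 h4 _ _ h3'
  have e4 := (Submodule.mem_adjoint_iff _ _).1 h4' _ _ h3
  dsimp only at *
  rw [sub_eq_zero] at e1 e2 e3 e4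
  have e2' : inner ℂ u' s = inner ℂ a' a := by
    rw [← inner_conj_symm, e2, inner_conj_symm]
  have e4' : inner ℂ t' u = inner ℂ c' c := by
    rw [← inner_conj_symm, ← e4, inner_conj_symm]
  rw [h5, h5', inner_add_left, inner_add_right, e1, e2', e4', e3]
  ring

/-- Split `f` along `N = ker C`. In `N`, solve with `A A*`: the solution stays in `ker C`, since the
range of `A` does. In the complement of `N`, solve with `C* C`: the solution stays orthogonal to
`ker C`, hence to the range of `A`, so `A*` sends it to `0`. Each solution is invisible to the other
summand, so they add up. -/
theorem exists_add_mem_sumRel [CompleteSpace H] [CompleteSpace K]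
    {A : Submodule ℂ (H × K)} {C : Submodule ℂ (K × K)} (hA : IsClosed (A : Set (H × K)))
    (hC : IsClosed (C : Set (K × K))) (hAC : ∀ a s, (a, s) ∈ A → (s, (0 : K)) ∈ C) (f : K) :
    ∃ u v, (u, v) ∈ sumRel A C ∧ u + v = f := by
  set N : Submodule ℂ K := C.comap (LinearMap.inl ℂ K K)
  have hN : IsClosed (N : Set K) := hC.preimage (by fun_prop : Continuous fun x : K => (x, (0 : K)))
  have : CompleteSpace N := hN.completeSpace_coe
  set f₁ := N.starProjection f
  have hf₁ : f₁ ∈ N := Submodule.starProjection_apply_mem N f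
  have hf₂ : ∀ x ∈ N, inner ℂ x (f - f₁) = 0 := fun x hx => by
    rw [← inner_conj_symm, Submodule.starProjection_inner_eq_zero (K := N) f x hx, map_zero]
  -- Von Neumann's theorem for `A*`; its adjoint is `A` again because `A` is closed.
  obtain ⟨u₁, a₁, s₁, h1, h2, h3⟩ := exists_add_adjoint_comp_eq (isClosed_adjoint A) f₁
  rw [adjoint_adjoint, hA.submodule_topologicalClosure_eq] at h2
  obtain ⟨u₂, c₂, t₂, h4, h5, h6⟩ := exists_add_adjoint_comp_eq hC (f - f₁)
  have hu₁ : (u₁, (0 : K)) ∈ C := by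
    have : u₁ ∈ N := by
      rw [eq_sub_of_add_eq h3]
      exact sub_mem hf₁ (hAC _ _ h2)
    exact this
  have hu₂ : (u₂, (0 : H)) ∈ A.adjoint := by
    rw [Submodule.mem_adjoint_iff]
    intro a b hab
    have hb := hAC _ _ hab
    have e := (Submodule.mem_adjoint_iff _ _).1 h5 _ _ hb
    simp only [inner_zero_left, zero_sub, neg_eq_zero] at e
    simp [eq_sub_of_add_eq h6, inner_sub_right _ _ t₂, e, hf₂ b hb]
  refine ⟨u₁ + u₂, s₁ + t₂, ⟨a₁, s₁, c₂, t₂, ?_, h2, ?_, h5, rfl⟩, ?_⟩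
  · simpa using add_mem h1 hu₂
  · simpa using add_mem hu₁ h4
  · rw [add_add_add_comm, h3, h6]; abel

/-- A symmetric relation `T` with `1 + T` surjective is self-adjoint. Given a pair in `T*`, subtract
a pair of `T` with the same sum of components: the difference is some `(d, -d)` in `T*`, so `d` is
orthogonal to the range of `1 + T` and vanishes. -/
theorem adjoint_sumRel [CompleteSpace H] [CompleteSpace K]
    {A : Submodule ℂ (H × K)} {C : Submodule ℂ (K × K)} (hA : IsClosed (A : Set (H × K)))
    (hC : IsClosed (C : Set (K × K))) (hAC : ∀ a s, (a, s) ∈ A → (s, (0 : K)) ∈ C) :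
    (sumRel A C).adjoint = sumRel A C := by
  refine le_antisymm ?_ (sumRel_le_adjoint A C)
  rintro ⟨u, f⟩ h
  obtain ⟨u', f', h', e'⟩ := exists_add_mem_sumRel hA hC hAC (u + f)
  have hd : (u - u', f - f') ∈ (sumRel A C).adjoint := sub_mem h (sumRel_le_adjoint A C h')
  obtain ⟨x, y, hxy, e⟩ := exists_add_mem_sumRel hA hC hAC (u - u')
  have h1 := (Submodule.mem_adjoint_iff _ _).1 hd _ _ hxy
  have hf : f - f' = -(u - u') := by
    rw [eq_sub_of_add_eq' e']; abel
  dsimp only at h1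
  rw [hf, inner_neg_right, sub_neg_eq_add, ← inner_add_left, add_comm y, e,
    inner_self_eq_zero] at h1
  rw [h1, neg_zero, sub_eq_zero] at hf
  rw [sub_eq_zero.1 h1, hf]
  exact h'

/-- A self-adjoint linear relation with dense domain is a self-adjoint operator. -/
theorem exists_isSelfAdjointOp {T : Submodule ℂ (K × K)} (hT : T.adjoint = T)
    (hd : Dense (T.map (LinearMap.fst ℂ K K) : Set K)) :
    ∃ S : K →ₗ.[ℂ] K, S.graph = T ∧ IsSelfAdjointOp S := by
  have hg : T.toLinearPMap.graph = T := by
    refine Submodule.toLinearPMap_graph_eq _ ?_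
    rintro ⟨x, y⟩ hx (rfl : x = 0)
    -- A pair `(0, y)` in `T = T*` has `y` orthogonal to the dense domain, so `T` is single-valued.
    refine hd.eq_zero_of_inner_right ℂ fun a ha => ?_
    obtain ⟨⟨a, b⟩, hab, rfl⟩ := ha
    rw [← hT] at hx
    simpa using (Submodule.mem_adjoint_iff _ _).1 hx a b hab
  refine ⟨T.toLinearPMap, hg, ?_, by rw [hg, hT]⟩
  rwa [← hg, LinearPMap.graph_map_fst_eq_domain] at hd

end LinearRelations

/-! ### From uniqueness of the self-adjoint extension to equality of the strong and weak extensions.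
-/

section FormalAdjoints

variable {H K : Type*} [NormedAddCommGroup H] [InnerProductSpace ℂ H]
  [NormedAddCommGroup K] [InnerProductSpace ℂ K]
  {V W : Type*} [AddCommMonoid V] [Module ℂ V] [AddCommMonoid W] [Module ℂ W]

/-- The graph of the operator `i v ↦ j (P v)`. -/
def opGraph (i : V →ₗ[ℂ] H) (j : W →ₗ[ℂ] K) (P : V →ₗ[ℂ] W) : Submodule ℂ (H × K) :=
  LinearMap.range (i.prod (j ∘ₗ P))

theorem mem_opGraph (i : V →ₗ[ℂ] H) (j : W →ₗ[ℂ] K) (P : V →ₗ[ℂ] W) (v : V) :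
    (i v, j (P v)) ∈ opGraph i j P := ⟨v, rfl⟩

theorem mem_adjoint_opGraph {i : V →ₗ[ℂ] H} {j : W →ₗ[ℂ] K} {P : V →ₗ[ℂ] W} {z : K × H} :
    z ∈ (opGraph i j P).adjoint ↔ ∀ v, inner ℂ (j (P v)) z.1 = inner ℂ (i v) z.2 := by
  rw [Submodule.mem_adjoint_iff]
  constructor
  · exact fun h v => sub_eq_zero.1 (h _ _ (mem_opGraph i j P v))
  · rintro h _ _ ⟨v, e⟩
    obtain ⟨rfl, rfl⟩ := Prod.ext_iff.1 e
    exact sub_eq_zero.2 (h v)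

variable [CompleteSpace H] [CompleteSpace K]

/-- If `P P' + S²` is essentially self-adjoint, where `P'` is a formal adjoint of `P` and `S` is a
symmetric operator with `P' S = 0`, then the strong and weak extensions of `P` agree. -/
theorem closure_eq_adjoint_of_unique {i : V →ₗ[ℂ] H} {j : W →ₗ[ℂ] K}
    (hi : DenseRange i) (hj : DenseRange j) {P : V →ₗ[ℂ] W} {P' : W →ₗ[ℂ] V} {S : W →ₗ[ℂ] W}
    (hP : ∀ v w, inner ℂ (j (P v)) (j w) = inner ℂ (i v) (i (P' w)))
    (hS : ∀ v w, inner ℂ (j (S v)) (j w) = inner ℂ (j v) (j (S w)))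
    (hP'S : ∀ w, i (P' (S w)) = 0)
    (hu : ∀ T T' : K →ₗ.[ℂ] K, opGraph j j (P ∘ₗ P' + S ^ 2) ≤ T.graph → IsSelfAdjointOp T →
      opGraph j j (P ∘ₗ P' + S ^ 2) ≤ T'.graph → IsSelfAdjointOp T' → T = T') :
    (opGraph i j P).topologicalClosure = (opGraph j i P').adjoint := by
  have hP' : ∀ w v, inner ℂ (i (P' w)) (i v) = inner ℂ (j w) (j (P v)) := fun w v => by
    rw [← inner_conj_symm, ← hP, inner_conj_symm]
  set Ps := (opGraph i j P).topologicalClosure with hPs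
  set Pw := (opGraph j i P').adjoint with hPw
  -- The largest extension of `S` is needed here: its kernel is the whole orthogonal complement of
  -- the range of `S`, and so contains the range of `Pw`.
  set C := (opGraph j j S).adjoint with hC
  have hle0 : opGraph i j P ≤ Pw := by
    rintro _ ⟨v, rfl⟩
    exact mem_adjoint_opGraph.2 fun w => hP' w v
  have hsw : Ps ≤ Pw := Submodule.topologicalClosure_minimal _ hle0 (isClosed_adjoint _)
  have hPsc : IsClosed (Ps : Set (H × K)) := Submodule.isClosed_topologicalClosure _
  have hPwc : IsClosed (Pw : Set (H × K)) := isClosed_adjoint _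
  have hCc : IsClosed (C : Set (K × K)) := isClosed_adjoint _
  have hwC : ∀ a s, (a, s) ∈ Pw → (s, (0 : K)) ∈ C := fun a s has =>
    mem_adjoint_opGraph.2 fun w => by
      have := mem_adjoint_opGraph.1 has (S w)
      dsimp only at this ⊢
      rw [← this, hP'S, inner_zero_left, inner_zero_right]
  -- On the image of `W`, the relations `A*` and `A` act as `P'` and `P`, and both `C` and `C*` act
  -- as `S`, by symmetry.
  have hgraph : ∀ A : Submodule ℂ (H × K), opGraph i j P ≤ A → A ≤ Pw →
      opGraph j j (P ∘ₗ P' + S ^ 2) ≤ sumRel A C := by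
    rintro A h1 h2 _ ⟨w, rfl⟩
    refine ⟨i (P' w), j (P (P' w)), j (S w), j (S (S w)), ?_, h1 (mem_opGraph i j P _), ?_, ?_, ?_⟩
    · exact adjoint_anti h2 (le_adjoint_adjoint _ (mem_opGraph j i P' w))
    · exact mem_adjoint_opGraph.2 fun v => hS v w
    · exact le_adjoint_adjoint _ (mem_opGraph j j S _)
    · simp [pow_two]
  have hsa : ∀ A : Submodule ℂ (H × K), IsClosed (A : Set (H × K)) → opGraph i j P ≤ A → A ≤ Pw →
      ∃ T : K →ₗ.[ℂ] K, T.graph = sumRel A C ∧ IsSelfAdjointOp T := by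
    intro A hA h1 h2
    refine exists_isSelfAdjointOp (adjoint_sumRel hA hCc fun a s h => hwC a s (h2 h)) ?_
    refine hj.mono ?_
    rintro _ ⟨w, rfl⟩
    exact ⟨_, hgraph A h1 h2 (mem_opGraph j j _ w), rfl⟩
  -- Both relations are self-adjoint extensions of `P P' + S²`, so they coincide.
  have hTT : sumRel Ps C = sumRel Pw C := by
    obtain ⟨T, hT, hT'⟩ := hsa Ps hPsc (Submodule.le_topologicalClosure _) hsw
    obtain ⟨T₂, hT₂, hT₂'⟩ := hsa Pw hPwc hle0 le_rfl
    rw [← hT, ← hT₂, hu T T₂ (hT ▸ hgraph Ps (Submodule.le_topologicalClosure _) hsw) hT'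
      (hT₂ ▸ hgraph Pw hle0 le_rfl) hT₂']
  -- `Ps` is densely defined, so its adjoint is single-valued.
  have hPs' : ∀ a : H, ((0 : K), a) ∈ Ps.adjoint → a = 0 := by
    intro a ha
    rw [hPs, adjoint_topologicalClosure] at ha
    refine hi.eq_zero_of_inner_right ℂ fun v => ?_
    have := mem_adjoint_opGraph.1 ha v
    rw [← this, inner_zero_right]
  refine le_antisymm hsw ?_
  rintro ⟨f, g⟩ hfg
  -- Orthogonal projection of `(f, g)` onto `Ps`; the goal is that the remainder `(a, b)`, which
  -- lies in `Pw`, is zero.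
  obtain ⟨x, y, hxy, hort⟩ := exists_orthogonal_decomposition hPsc f g
  have hab : (f - x, g - y) ∈ Pw := sub_mem hfg (hsw hxy)
  set a := f - x with ha
  set b := g - y with hb
  have hba : (b, -a) ∈ Ps.adjoint := by
    rw [Submodule.mem_adjoint_iff]
    intro a' b' h
    rw [inner_neg_right, sub_neg_eq_add, add_comm]
    exact hort a' b' h
  -- Solve `u + Ps Ps* u = b`, with `e = Ps* u` and `s = Ps e`.
  obtain ⟨u, e, s, h1, h2, h3⟩ := exists_add_adjoint_comp_eq (isClosed_adjoint Ps) b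
  rw [adjoint_adjoint, hPsc.submodule_topologicalClosure_eq] at h2
  -- Both `b` and `s` are in the range of `Pw`, hence in `ker C`, and `u = b - s`.
  have hu0 : (u, (0 : K)) ∈ C := by
    rw [eq_sub_of_add_eq h3]
    simpa using sub_mem (hwC _ _ hab) (hwC _ _ (hsw h2))
  -- The equality of the two self-adjoint extensions serves to put `u` in the domain of `Pw*`, a
  -- priori smaller than that of `Ps*`.
  have hus : (u, s) ∈ sumRel Pw C := by
    rw [← hTT]
    exact ⟨e, s, 0, 0, h1, h2, hu0, zero_mem _, by simp⟩
  obtain ⟨e', -, -, -, h4, -⟩ := hus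
  have hee : e = e' := by
    rw [← sub_eq_zero]
    refine hPs' _ ?_
    simpa using sub_mem h1 (adjoint_anti hsw h4)
  have i1 := (Submodule.mem_adjoint_iff _ _).1 hba _ _ h2
  have i2 := (Submodule.mem_adjoint_iff _ _).1 h4 _ _ hab
  dsimp only at i1 i2
  rw [inner_neg_right, sub_neg_eq_add] at i1
  -- Write `⟨b, b⟩ = ⟨u, b⟩ + ⟨s, b⟩`. The first term is `⟨e, a⟩`, since `Pw* u = e`; the second is
  -- `-⟨e, a⟩`, since `Ps* b = -a`.
  have hb0 : b = 0 := by
    rw [← inner_self_eq_zero (𝕜 := ℂ)]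
    nth_rewrite 1 [← h3]
    rw [inner_add_left, ← inner_conj_symm, sub_eq_zero.1 i2, inner_conj_symm, ← hee, add_comm]
    exact i1
  rw [hb0] at hba
  have ha0 : a = 0 := neg_eq_zero.1 (hPs' _ hba)
  rw [sub_eq_zero.1 ha0, sub_eq_zero.1 hb0]
  exact hxy

end FormalAdjoints

/-! ### The pointwise inner product of forms as a finite-dimensional Hilbert structure. -/

section PointwiseInner

variable {E : Type*} [NormedAddCommGroup E] [NormedSpace ℂ E] [FiniteDimensional ℂ E] {k : ℕ}

theorem form_ext_refBasis {α β : E [⋀^Fin k]→L[ℝ] ℂ}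
    (h : ∀ I : Fin k → Fin (Module.finrank ℝ E),
      α (fun a => refBasis E (I a)) = β (fun a => refBasis E (I a))) : α = β := by
  have : α.toMultilinearMap = β.toMultilinearMap :=
    Module.Basis.ext_multilinear (fun _ => refBasis E) h
  ext v
  exact congrArg (fun f => f v) this

instance finiteDimensional_forms : FiniteDimensional ℂ (E [⋀^Fin k]→L[ℝ] ℂ) := by
  let f : (E [⋀^Fin k]→L[ℝ] ℂ) →ₗ[ℂ] (Fin k → Fin (Module.finrank ℝ E)) → ℂ :=
    { toFun := fun α I => α (fun a => refBasis E (I a))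
      map_add' := fun α β => rfl
      map_smul' := fun c α => rfl }
  exact FiniteDimensional.of_injective f fun α β h => form_ext_refBasis fun I => congrFun h I

open scoped MatrixOrder Matrix.Norms.L2Operator in
/-- The inner product of forms is the pullback of a standard inner product by an injective linear
map. -/
theorem IsInner.exists_linearMap {G : E →L[ℝ] E →L[ℝ] ℝ} (h : IsInner G) (k : ℕ) :
    ∃ Φ : (E [⋀^Fin k]→L[ℝ] ℂ) →ₗ[ℂ] EuclideanSpace ℂ (Fin k → Fin (Module.finrank ℝ E)),
      Function.Injective Φ ∧ ∀ α β, formInner G α β = inner ℂ (Φ β) (Φ α) := by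
  -- A square factorization `BᵀB` of the inverse Gram matrix, so `B` is invertible and `Bᵀ` turns
  -- the reference basis into a `G`-orthonormal basis `e`. Because `e` is a basis, evaluation on its
  -- tuples is injective.
  obtain ⟨B, hB⟩ := CStarAlgebra.nonneg_iff_eq_star_mul_self.1 h.posDef.inv.posSemidef.nonneg
  rw [Matrix.star_eq_conjTranspose, Matrix.conjTranspose_eq_transpose_of_trivial] at hB
  have hdet : IsUnit B.transpose.det := by
    have h1 := h.posDef.inv.det_pos.ne'
    rw [hB, Matrix.det_mul] at h1
    exact isUnit_iff_ne_zero.2 (left_ne_zero_of_mul h1)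
  set e : Module.Basis (Fin (Module.finrank ℝ E)) ℝ E :=
    (refBasis E).map (Matrix.toLinearEquiv (refBasis E) B.transpose hdet)
  have he : ∀ l, e l = ∑ i, B.transpose i l • refBasis E i := fun l => by
    simp only [e, Module.Basis.map_apply]
    exact Matrix.toLin_self _ _ _ _
  have hf : ∀ α β : E [⋀^Fin k]→L[ℝ] ℂ, formInner G α β = (k ! : ℂ)⁻¹ *
      ∑ I : Fin k → Fin (Module.finrank ℝ E),
        α (fun a => e (I a)) * conj (β (fun a => e (I a))) := by
    intro α β
    have h1 : (gram G)⁻¹ = B.transpose * (1 : Matrix _ _ ℝ) * B.transpose.transpose := by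
      rw [hB, Matrix.mul_one, Matrix.transpose_transpose]
    rw [formInner, h1, ← sum_change]
    simp only [he]
    congr 1
    refine Finset.sum_congr rfl fun I _ => ?_
    rw [Finset.sum_eq_single I]
    · simp
    · intro J _ hJ
      obtain ⟨a, ha⟩ := Function.ne_iff.1 hJ
      have h0 : (1 : Matrix (Fin (Module.finrank ℝ E)) (Fin (Module.finrank ℝ E)) ℝ) (I a) (J a) =
          0 := Matrix.one_apply_ne (Ne.symm ha)
      rw [Finset.prod_eq_zero (Finset.mem_univ a) h0]
      simp
    · simp
  -- The sum runs over all multi-indices and not only increasing ones; the weight `1/k!` is shared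
  -- between the two factors.
  set c : ℂ := ((√((k ! : ℝ)⁻¹) : ℝ) : ℂ) with hc
  have hc0 : c ≠ 0 := by
    rw [hc, Complex.ofReal_ne_zero, Real.sqrt_ne_zero']
    positivity
  have hcc : c * conj c = (k ! : ℂ)⁻¹ := by
    rw [hc, Complex.conj_ofReal, ← Complex.ofReal_mul, Real.mul_self_sqrt (by positivity)]
    simp
  refine ⟨{ toFun := fun α => WithLp.toLp 2 fun I => c * α (fun a => e (I a))
            map_add' := fun α β => by ext I; simp [mul_add]
            map_smul' := fun z α => by ext I; simp; ring }, ?_, ?_⟩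
  · intro α β hαβ
    have h1 : ∀ I : Fin k → Fin (Module.finrank ℝ E),
        α (fun a => e (I a)) = β (fun a => e (I a)) := fun I => by
      have := congrArg (fun v : EuclideanSpace ℂ (Fin k → Fin (Module.finrank ℝ E)) => v I) hαβ
      exact mul_left_cancel₀ hc0 this
    have h2 : α.toMultilinearMap = β.toMultilinearMap :=
      Module.Basis.ext_multilinear (fun _ => e) h1
    ext v
    exact congrArg (fun f => f v) h2
  · intro α β
    rw [hf, ← hcc, Finset.mul_sum]
    simp only [PiLp.inner_apply, LinearMap.coe_mk, AddHom.coe_mk, RCLike.inner_apply, map_mul]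
    exact Finset.sum_congr rfl fun I _ => by ring

theorem IsInner.eq_zero_of_formInner_self {G : E →L[ℝ] E →L[ℝ] ℝ} (h : IsInner G)
    {α : E [⋀^Fin k]→L[ℝ] ℂ} (hα : formInner G α α = 0) : α = 0 := by
  obtain ⟨Φ, hΦ, hi⟩ := h.exists_linearMap k
  rw [hi, inner_self_eq_zero] at hα
  exact hΦ (by rw [hα, map_zero])

theorem continuous_formInner_self (G : E →L[ℝ] E →L[ℝ] ℝ) :
    Continuous fun α : E [⋀^Fin k]→L[ℝ] ℂ => formInner G α α := by
  simp only [formInner]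
  fun_prop

theorem formInner_zero_left (G : E →L[ℝ] E →L[ℝ] ℝ) (β : E [⋀^Fin k]→L[ℝ] ℂ) :
    formInner G 0 β = 0 := by simp [formInner]

theorem formInner_zero_right (G : E →L[ℝ] E →L[ℝ] ℝ) (α : E [⋀^Fin k]→L[ℝ] ℂ) :
    formInner G α 0 = 0 := by simp [formInner]

theorem formInner_sum_left {ι : Type*} (s : Finset ι) (G : E →L[ℝ] E →L[ℝ] ℝ)
    (a : ι → ℂ) (α : ι → E [⋀^Fin k]→L[ℝ] ℂ) (β : E [⋀^Fin k]→L[ℝ] ℂ) :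
    formInner G (∑ i ∈ s, a i • α i) β = ∑ i ∈ s, a i * formInner G (α i) β := by
  classical
  induction s using Finset.induction_on with
  | empty => simp [formInner_zero_left]
  | insert i s hi ih => rw [Finset.sum_insert hi, Finset.sum_insert hi, formInner_add_left,
      formInner_smul_left, ih]

theorem IsInner.formInner_smul_right {G : E →L[ℝ] E →L[ℝ] ℝ} (hG : IsInner G) (a : ℂ)
    (α β : E [⋀^Fin k]→L[ℝ] ℂ) : formInner G α (a • β) = conj a * formInner G α β := by
  rw [← hG.conj_symm, formInner_smul_left, map_mul, hG.conj_symm]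

theorem IsInner.formInner_sum_right {ι : Type*} (s : Finset ι) {G : E →L[ℝ] E →L[ℝ] ℝ}
    (hG : IsInner G) (a : ι → ℂ) (α : E [⋀^Fin k]→L[ℝ] ℂ) (β : ι → E [⋀^Fin k]→L[ℝ] ℂ) :
    formInner G α (∑ i ∈ s, a i • β i) = ∑ i ∈ s, conj (a i) * formInner G α (β i) := by
  rw [← hG.conj_symm, formInner_sum_left, map_sum]
  exact Finset.sum_congr rfl fun i _ => by rw [map_mul, hG.conj_symm]

/-- Forms whose successive pointwise distances are controlled converge pointwise. -/
theorem exists_tendsto_of_tsum_lt_top {G : E →L[ℝ] E →L[ℝ] ℝ} (hG : IsInner G)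
    (a : ℕ → E [⋀^Fin k]→L[ℝ] ℂ)
    (h : ∑' n, 2 ^ n * ENNReal.ofReal (formInner G (a (n + 1) - a n) (a (n + 1) - a n)).re < ⊤) :
    ∃ b, Tendsto a atTop (𝓝 b) := by
  obtain ⟨Φ, hΦ, hi⟩ := hG.exists_linearMap k
  obtain ⟨K, hK, hanti⟩ := LinearMap.exists_antilipschitzWith Φ (LinearMap.ker_eq_bot.2 hΦ)
  set C := (∑' n, 2 ^ n * ENNReal.ofReal
    (formInner G (a (n + 1) - a n) (a (n + 1) - a n)).re).toReal
  -- Each term of the series is at most its sum `C`, so consecutive distances are at most `√C ·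
  -- 2^(-n/2)`, a geometric bound.
  have hb : ∀ n, dist (Φ (a n)) (Φ (a (n + 1))) ≤ √C * (√2)⁻¹ ^ n := by
    intro n
    have h1 : (2 : ENNReal) ^ n * ENNReal.ofReal
        (formInner G (a (n + 1) - a n) (a (n + 1) - a n)).re ≤ ENNReal.ofReal C := by
      rw [ENNReal.ofReal_toReal h.ne]
      exact ENNReal.le_tsum n
    have h2 : (formInner G (a (n + 1) - a n) (a (n + 1) - a n)).re =
        ‖Φ (a (n + 1)) - Φ (a n)‖ ^ 2 := by
      rw [hi, ← map_sub]
      exact inner_self_eq_norm_sq (𝕜 := ℂ) _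
    rw [h2, show (2 : ENNReal) ^ n = ENNReal.ofReal (2 ^ n) by
      rw [ENNReal.ofReal_pow (by norm_num)]; simp, ← ENNReal.ofReal_mul (by positivity),
      ENNReal.ofReal_le_ofReal_iff ENNReal.toReal_nonneg] at h1
    rw [dist_comm, dist_eq_norm]
    refine le_of_sq_le_sq ?_ (by positivity)
    rw [mul_pow, Real.sq_sqrt ENNReal.toReal_nonneg, ← pow_mul, mul_comm n, pow_mul, inv_pow,
      Real.sq_sqrt (by norm_num), inv_pow, ← div_eq_mul_inv, le_div_iff₀ (by positivity)]
    linarith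
  have hc : CauchySeq fun n => Φ (a n) :=
    cauchySeq_of_le_geometric _ _ (inv_lt_one_of_one_lt₀ (by
      rw [Real.lt_sqrt (by norm_num)]; norm_num)) hb
  -- An injective linear map from a finite-dimensional space is bounded below, so the Cauchy
  -- property passes back to the norm of the space of forms.
  have hu : IsUniformInducing Φ :=
    hanti.isUniformInducing (LinearMap.toContinuousLinearMap Φ).uniformContinuous
  have : CompleteSpace (E [⋀^Fin k]→L[ℝ] ℂ) := FiniteDimensional.complete ℂ _
  have hc' : CauchySeq a := by
    rw [CauchySeq, ← hu.cauchy_map_iff]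
    rwa [Filter.map_map]
  exact cauchySeq_tendsto_of_complete hc'

end PointwiseInner

/-! ### Completeness of `L²` (Riesz–Fischer). -/

section Complete

variable {E : Type*} [NormedAddCommGroup E] [NormedSpace ℂ E] [FiniteDimensional ℂ E]
variable {M : Type*} [TopologicalSpace M] [ChartedSpace E M] [IsManifold 𝓘(ℂ, E) ω M]
variable [MeasurableSpace E] [BorelSpace E] [MeasurableSpace M] [BorelSpace M]
variable {k p q : ℕ}

theorem pointInner_self_eq_ofReal (g : HermitianMetric E M) (u : Form E M k) (x : M) :
    pointInner g u u x = (((pointInner g u u x).re : ℝ) : ℂ) :=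
  Complex.ext rfl ((isInner_val g x).self_nonneg (u x)).2

theorem pointInner_self_re_nonneg (g : HermitianMetric E M) (u : Form E M k) (x : M) :
    0 ≤ (pointInner g u u x).re :=
  ((isInner_val g x).self_nonneg (u x)).1

variable [SecondCountableTopology M]

theorem measurable_pointInner_self_re (g : HermitianMetric E M) {u : Form E M k}
    (hu : IsMeasurableForm u) :
    Measurable fun x => ENNReal.ofReal (pointInner g u u x).re :=
  (Complex.measurable_re.comp (measurable_pointInner g hu hu)).ennreal_ofReal

theorem PreL2.ofReal_norm_sq {g : HermitianMetric E M} (u : PreL2 g k p q) :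
    ENNReal.ofReal (‖u‖ ^ 2) = ∫⁻ x, ENNReal.ofReal (pointInner g u.form u.form x).re ∂(vol g) := by
  have h1 : ‖u‖ ^ 2 = (inner ℂ u u).re := (inner_self_eq_norm_sq (𝕜 := ℂ) u).symm
  have h2 : inner ℂ u u = ∫ x, pointInner g u.form u.form x ∂(vol g) := rfl
  rw [h1, h2, show (∫ x, pointInner g u.form u.form x ∂(vol g)).re =
    ∫ x, (pointInner g u.form u.form x).re ∂(vol g) from (integral_re u.mem.2.2).symm]
  exact ofReal_integral_eq_lintegral_ofReal u.mem.2.2.re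
    (Eventually.of_forall fun x => pointInner_self_re_nonneg g _ x)

theorem integrable_pointInner_self (g : HermitianMetric E M) {u : Form E M k}
    (hu : IsMeasurableForm u)
    (h : ∫⁻ x, ENNReal.ofReal (pointInner g u u x).re ∂(vol g) ≠ ⊤) :
    Integrable (pointInner g u u) (vol g) := by
  refine ⟨(measurable_pointInner g hu hu).aestronglyMeasurable, ?_⟩
  rw [hasFiniteIntegral_iff_norm]
  refine lt_of_eq_of_lt (lintegral_congr fun x => ?_) h.lt_top
  rw [pointInner_self_eq_ofReal, Complex.norm_real, Real.norm_of_nonneg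
    (pointInner_self_re_nonneg g u x), Complex.ofReal_re]

theorem IsMeasurableForm.sub {u v : Form E M k} (hu : IsMeasurableForm u)
    (hv : IsMeasurableForm v) : IsMeasurableForm (u - v) := by
  intro c w
  have : (fun x : (extChartAt 𝓘(ℂ, E) c).source => inChart (u - v) c x w) =
      fun x : (extChartAt 𝓘(ℂ, E) c).source => inChart u c x w - inChart v c x w := by
    ext x; simp [inChart]
  rw [this]
  exact (hu c w).sub (hv c w)

/-- The Riesz–Fischer argument: a rapidly Cauchy sequence converges pointwise almost everywhere, and
Fatou's lemma shows that the pointwise limit is also the limit in norm. -/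
instance completeSpace_preL2 (g : HermitianMetric E M) (k p q : ℕ) :
    CompleteSpace (PreL2 g k p q) := by
  refine Metric.complete_of_convergent_controlled_sequences (fun n => (1 / 2 : ℝ) ^ n)
    (fun n => by positivity) fun u hu => ?_
  have hn : ∀ N n m, N ≤ n → N ≤ m →
      ∫⁻ x, ENNReal.ofReal (pointInner g ((u n).form - (u m).form) ((u n).form - (u m).form) x).re
        ∂(vol g) ≤ (4⁻¹ : ENNReal) ^ N := by
    intro N n m h1 h2
    have h3 := (hu N n m h1 h2).le
    rw [dist_eq_norm] at h3
    refine ((u n - u m).ofReal_norm_sq.symm.le.trans (ENNReal.ofReal_le_ofReal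
      (pow_le_pow_left₀ (norm_nonneg _) h3 2))).trans_eq ?_
    rw [← pow_mul, mul_comm, pow_mul, ENNReal.ofReal_pow (by positivity)]
    congr 1
    rw [show ((1 / 2 : ℝ) ^ 2) = 4⁻¹ by norm_num, ENNReal.ofReal_inv_of_pos (by norm_num)]
    simp
  have hsub : ∀ n m, IsMeasurableForm ((u n).form - (u m).form) := fun n m =>
    (u n).mem.1.sub (u m).mem.1
  -- The squared increments have integral at most `4⁻ⁿ`. The weight `2ⁿ` keeps the sum integrable
  -- and still forces geometric decay at each point where `F` is finite.
  set F : M → ENNReal := fun x => ∑' n, 2 ^ n * ENNReal.ofReal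
    (pointInner g ((u (n + 1)).form - (u n).form) ((u (n + 1)).form - (u n).form) x).re with hF
  have hFm : Measurable F := Measurable.tsum fun n =>
    (measurable_pointInner_self_re g (hsub _ _)).const_mul _
  have hFi : ∫⁻ x, F x ∂(vol g) ≠ ⊤ := by
    rw [hF, lintegral_tsum fun n =>
      ((measurable_pointInner_self_re g (hsub _ _)).const_mul _).aemeasurable]
    refine ne_top_of_le_ne_top (b := ∑' n : ℕ, (2⁻¹ : ENNReal) ^ n) ?_
      (ENNReal.tsum_le_tsum fun n => ?_)
    · rw [ENNReal.tsum_geometric]; simp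
    · rw [lintegral_const_mul _ (measurable_pointInner_self_re g (hsub _ _))]
      refine (mul_le_mul_right (hn n (n + 1) n (Nat.le_succ n) le_rfl) _).trans_eq ?_
      rw [← mul_pow]
      congr 1
      rw [show (4 : ENNReal) = 2 * 2 by norm_num, ENNReal.mul_inv (by simp) (by simp), ← mul_assoc,
        ENNReal.mul_inv_cancel (by simp) (by simp), one_mul]
  set S : Set M := {x | F x < ⊤} with hS
  have hSm : MeasurableSet S := measurableSet_lt hFm measurable_const
  have hSae : ∀ᵐ x ∂(vol g), x ∈ S := ae_lt_top hFm hFi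
  -- Cutting off to the set `S` of convergence gives a limit at every point, so that measurability
  -- and type of the limit hold without exceptional points.
  have hlim : ∀ x, ∃ b, Tendsto (fun n => S.indicator (u n).form x) atTop (𝓝 b) := by
    intro x
    by_cases hx : x ∈ S
    · simp only [indicator_of_mem hx]
      exact exists_tendsto_of_tsum_lt_top (isInner_val g x) (fun n => (u n).form x) hx
    · simp only [indicator_of_notMem hx]
      exact ⟨0, tendsto_const_nhds⟩
  choose w hw using hlim
  have hwS : ∀ x ∈ S, Tendsto (fun n => (u n).form x) atTop (𝓝 (w x)) := fun x hx => by
    simpa only [indicator_of_mem hx] using hw x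
  have hwm : IsMeasurableForm w := by
    intro c v
    refine measurable_of_tendsto_metrizable (f := fun n (x : (extChartAt 𝓘(ℂ, E) c).source) =>
      inChart (S.indicator (u n).form) c x v) (fun n => ?_) (tendsto_pi_nhds.2 fun x => ?_)
    · have h1 : (fun x : (extChartAt 𝓘(ℂ, E) c).source =>
          inChart (S.indicator (u n).form) c x v) = (Subtype.val ⁻¹' S).indicator
            fun x : (extChartAt 𝓘(ℂ, E) c).source => inChart (u n).form c x v := by
        ext x
        by_cases hx : (x : M) ∈ S
        · rw [indicator_of_mem (s := Subtype.val ⁻¹' S) hx]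
          simp [inChart, hx]
        · rw [indicator_of_notMem (s := Subtype.val ⁻¹' S) hx]
          simp [inChart, hx]
      rw [h1]
      exact ((u n).mem.1 c v).indicator (measurable_subtype_coe hSm)
    · exact ((ContinuousAlternatingMap.apply ℝ E ℂ
        (fun i => frame c (x : M) (v i))).continuous.tendsto _).comp (hw x)
  have hwt : ∀ x, IsOfType p q (w x) := by
    intro x z v
    have e : ∀ v : Fin k → E, Tendsto (fun n => S.indicator (u n).form x v) atTop (𝓝 (w x v)) :=
      fun v => ((ContinuousAlternatingMap.apply ℝ E ℂ v).continuous.tendsto _).comp (hw x)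
    refine tendsto_nhds_unique (e _) (((e v).const_mul _).congr fun n => ?_)
    by_cases hx : x ∈ S
    · rw [indicator_of_mem hx]; exact ((u n).mem.2.1 x z v).symm
    · rw [indicator_of_notMem hx]; simp
  -- Fatou's lemma for `m → ∞` in the bounds on `u m - u n`.
  have hfat : ∀ n, ∫⁻ x, ENNReal.ofReal (pointInner g (w - (u n).form) (w - (u n).form) x).re
      ∂(vol g) ≤ (4⁻¹ : ENNReal) ^ n := by
    intro n
    have h1 : ∫⁻ x, ENNReal.ofReal (pointInner g (w - (u n).form) (w - (u n).form) x).re ∂(vol g) =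
        ∫⁻ x, liminf (fun m => ENNReal.ofReal (pointInner g ((u m).form - (u n).form)
          ((u m).form - (u n).form) x).re) atTop ∂(vol g) := by
      refine lintegral_congr_ae ?_
      filter_upwards [hSae] with x hx
      refine (Tendsto.liminf_eq ?_).symm
      refine (ENNReal.continuous_ofReal.tendsto _).comp ((Complex.continuous_re.tendsto _).comp ?_)
      exact ((continuous_formInner_self (g.val x)).tendsto _).comp ((hwS x hx).sub_const _)
    rw [h1]
    refine (lintegral_liminf_le fun m => measurable_pointInner_self_re g (hsub m n)).trans ?_
    refine liminf_le_of_frequently_le' (Eventually.frequently ?_)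
    exact (eventually_ge_atTop n).mono fun m hm => hn n m n hm le_rfl
  have hmem : ∀ n, w - (u n).form ∈ l2Forms g k p q := by
    intro n
    refine ⟨hwm.sub (u n).mem.1, fun x z v => ?_, integrable_pointInner_self g
      (hwm.sub (u n).mem.1) (ne_top_of_le_ne_top (by simp) (hfat n))⟩
    simp only [Pi.sub_apply, ContinuousAlternatingMap.sub_apply, hwt x z v, (u n).mem.2.1 x z v]
    ring
  have hw2 : w ∈ l2Forms g k p q := by
    have := add_mem (hmem 0) (u 0).mem
    rwa [sub_add_cancel] at this
  set W : PreL2 g k p q := ⟨w, hw2⟩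
  refine ⟨W, ?_⟩
  rw [tendsto_iff_norm_sub_tendsto_zero]
  refine squeeze_zero (fun n => norm_nonneg _) (fun n => ?_)
    (tendsto_pow_atTop_nhds_zero_of_lt_one (r := (1 / 2 : ℝ)) (by norm_num) (by norm_num))
  rw [norm_sub_rev]
  have h1 := (W - u n).ofReal_norm_sq.le.trans (hfat n)
  rw [show (4⁻¹ : ENNReal) ^ n = ENNReal.ofReal (((1 / 2 : ℝ) ^ n) ^ 2) by
    rw [← pow_mul, mul_comm, pow_mul, ENNReal.ofReal_pow (by positivity)]
    congr 1
    rw [show ((1 / 2 : ℝ) ^ 2) = 4⁻¹ by norm_num, ENNReal.ofReal_inv_of_pos (by norm_num)]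
    simp, ENNReal.ofReal_le_ofReal_iff (by positivity)] at h1
  exact le_of_sq_le_sq h1 (by positivity)

end Complete

/-! ### The identities `∂² = 0`, `∂̄² = 0` and `∂∂̄ + ∂̄∂ = 0`. -/

section DoubleComplex

variable {E : Type*} [NormedAddCommGroup E] [NormedSpace ℂ E]
variable {M : Type*} [TopologicalSpace M] [ChartedSpace E M] [IsManifold 𝓘(ℂ, E) ω M]
variable {k p q : ℕ}

/-- Pulling back by a scalar `z ≠ 0` and dividing by `z^p z̄^q` gives `z² a + |z|² b + z̄² c = 0`.
Three values of `z` determine the three terms. -/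
theorem IsOfType.eq_zero_of_add_eq_zero {a b c : E [⋀^Fin k]→L[ℝ] ℂ}
    (ha : IsOfType (p + 2) q a) (hb : IsOfType (p + 1) (q + 1) b) (hc : IsOfType p (q + 2) c)
    (h : a + b + c = 0) : a = 0 ∧ b = 0 ∧ c = 0 := by
  have key : ∀ v, a v = 0 ∧ b v = 0 ∧ c v = 0 := by
    intro v
    have e : ∀ z : ℂ, z ≠ 0 → z ^ 2 * a v + z * conj z * b v + conj z ^ 2 * c v = 0 := by
      intro z hz
      have h1 : a (fun i => z • v i) + b (fun i => z • v i) + c (fun i => z • v i) = 0 := by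
        simpa using congrArg (fun T : E [⋀^Fin k]→L[ℝ] ℂ => T (fun i => z • v i)) h
      rw [ha, hb, hc] at h1
      have hz' : z ^ p * conj z ^ q ≠ 0 := by simp [hz]
      apply mul_left_cancel₀ hz'
      rw [mul_zero, ← h1]; ring
    -- The values `1` and `i` give `b = 0` and `a + c = 0`; then `1 + i`, whose square is `2i`,
    -- gives `a = c`.
    have h1 := e 1 one_ne_zero
    have h2 := e Complex.I Complex.I_ne_zero
    have h3 := e (1 + Complex.I) (by
      intro h0; simpa using congrArg Complex.re h0)
    simp only [map_one, map_add, Complex.conj_I] at h1 h2 h3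
    have hI := Complex.I_mul_I
    have hb0 : b v = 0 := by linear_combination (h1 + h2) / 2 - (a v - b v + c v) / 2 * hI
    rw [hb0] at h1 h2 h3
    have hac : a v + c v = 0 := by linear_combination h1
    have hac' : Complex.I * (a v - c v) = 0 := by
      linear_combination h3 / 2 - (a v + c v) / 2 * hI
    have hac'' : a v - c v = 0 := (mul_eq_zero.1 hac').resolve_left Complex.I_ne_zero
    exact ⟨by linear_combination (hac + hac'') / 2, hb0, by linear_combination (hac - hac'') / 2⟩
  exact ⟨by ext v; exact (key v).1, by ext v; exact (key v).2.1, by ext v; exact (key v).2.2⟩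

theorem _root_.Filter.EventuallyEq.delFlat_eq {w w' : E → E [⋀^Fin k]→L[ℝ] ℂ} {y : E}
    (h : w =ᶠ[𝓝 y] w') : delFlat w y = delFlat w' y := by
  rw [delFlat, delFlat, h.fderiv_eq]

theorem _root_.Filter.EventuallyEq.delbarFlat_eq {w w' : E → E [⋀^Fin k]→L[ℝ] ℂ} {y : E}
    (h : w =ᶠ[𝓝 y] w') : delbarFlat w y = delbarFlat w' y := by
  rw [delbarFlat, delbarFlat, h.fderiv_eq]

/-- This is `d² = 0` in the preferred chart at `x`, grouped by bidegree. The coordinate formula for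
`∂` and `∂̄` holds on a neighbourhood of the point, as required to differentiate once more. -/
theorem sum_second_derivatives (α : A0 E M k p q) (x : M) :
    (del (del α)).1 x + ((del (delbar α)).1 x + (delbar (del α)).1 x) +
      (delbar (delbar α)).1 x = 0 := by
  set y := extChartAt 𝓘(ℂ, E) x x
  set w := coord α.1 x with hw
  have hsm : ∀ {l r s : ℕ} (β : A0 E M l r s), ContDiffAt ℝ ∞ (coord β.1 x) y := fun β =>
    (β.2.1 x).contDiffAt (extChartAt_target_mem_nhds x)
  have h1 : coord (del α).1 x =ᶠ[𝓝 y] delFlat w :=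
    Filter.mem_of_superset (extChartAt_target_mem_nhds (I := 𝓘(ℂ, E)) x) fun y' hy' =>
      (coord_del_and_delbar α.2.1 α.2.2.1 hy').1
  have h2 : coord (delbar α).1 x =ᶠ[𝓝 y] delbarFlat w :=
    Filter.mem_of_superset (extChartAt_target_mem_nhds (I := 𝓘(ℂ, E)) x) fun y' hy' =>
      (coord_del_and_delbar α.2.1 α.2.2.1 hy').2
  have d1 : DifferentiableAt ℝ (delFlat w) y :=
    ((hsm (del α)).congr_of_eventuallyEq h1.symm).differentiableAt (by simp)
  have d2 : DifferentiableAt ℝ (delbarFlat w) y :=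
    ((hsm (delbar α)).congr_of_eventuallyEq h2.symm).differentiableAt (by simp)
  have e1 : (del (del α)).1 x = delFlat (delFlat w) y := h1.delFlat_eq
  have e2 : (del (delbar α)).1 x = delFlat (delbarFlat w) y := h2.delFlat_eq
  have e3 : (delbar (del α)).1 x = delbarFlat (delFlat w) y := h1.delbarFlat_eq
  have e4 : (delbar (delbar α)).1 x = delbarFlat (delbarFlat w) y := h2.delbarFlat_eq
  have hd : extDeriv (extDeriv w) y = 0 :=
    extDeriv_extDeriv_apply (hsm α) (by simp; norm_cast)
  have hfun : extDeriv w = fun y' => delFlat w y' + delbarFlat w y' :=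
    funext fun y' => (delFlat_add_delbarFlat w y').symm
  rw [hfun, extDeriv_fun_add d1 d2, ← delFlat_add_delbarFlat, ← delFlat_add_delbarFlat] at hd
  rw [e1, e2, e3, e4, ← hd]
  abel

theorem del_del (α : A0 E M k p q) : del (del α) = 0 := by
  ext1; funext x
  exact (IsOfType.eq_zero_of_add_eq_zero ((del (del α)).2.2.1 x)
    ((del (delbar α) + delbar (del α)).2.2.1 x) ((delbar (delbar α)).2.2.1 x)
    (sum_second_derivatives α x)).1

theorem delbar_delbar (α : A0 E M k p q) : delbar (delbar α) = 0 := by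
  ext1; funext x
  exact (IsOfType.eq_zero_of_add_eq_zero ((del (del α)).2.2.1 x)
    ((del (delbar α) + delbar (del α)).2.2.1 x) ((delbar (delbar α)).2.2.1 x)
    (sum_second_derivatives α x)).2.2

theorem del_delbar_add_delbar_del (α : A0 E M k p q) :
    del (delbar α) + delbar (del α) = 0 := by
  ext1; funext x
  exact (IsOfType.eq_zero_of_add_eq_zero ((del (del α)).2.2.1 x)
    ((del (delbar α) + delbar (del α)).2.2.1 x) ((delbar (delbar α)).2.2.1 x)
    (sum_second_derivatives α x)).2.1

end DoubleComplex

/-! ### Smooth dependence of the algebraic constructions, and bases of forms of a given type. -/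

section Smoothness

variable {E : Type*} [NormedAddCommGroup E] [NormedSpace ℂ E] [FiniteDimensional ℂ E] {k p q : ℕ}
variable {X : Type*} [NormedAddCommGroup X] [NormedSpace ℝ X]

/-- Evaluation of forms on the tuples of vectors of the reference basis. -/
def evalRefBasis (E : Type*) [NormedAddCommGroup E] [NormedSpace ℂ E] [FiniteDimensional ℂ E]
    (k : ℕ) : (E [⋀^Fin k]→L[ℝ] ℂ) →ₗ[ℝ] (Fin k → Fin (Module.finrank ℝ E)) → ℂ where
  toFun α I := α (fun a => refBasis E (I a))
  map_add' _ _ := rfl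
  map_smul' _ _ := rfl

/-- Evaluation on basis tuples is injective and linear on a finite-dimensional space, so it has a
continuous linear left inverse, through which smoothness of the coefficients is transferred to the
form. -/
theorem contDiffAt_of_refBasis {f : X → E [⋀^Fin k]→L[ℝ] ℂ} {y : X}
    (h : ∀ I : Fin k → Fin (Module.finrank ℝ E),
      ContDiffAt ℝ ∞ (fun y' => f y' (fun a => refBasis E (I a))) y) : ContDiffAt ℝ ∞ f y := by
  obtain ⟨L, hL⟩ := (evalRefBasis E k).exists_leftInverse_of_injective
    (LinearMap.ker_eq_bot.2 fun α β h => form_ext_refBasis fun I => congrFun h I)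
  have h1 : ContDiffAt ℝ ∞ (fun y' => evalRefBasis E k (f y')) y := contDiffAt_pi.2 h
  have h2 := (LinearMap.toContinuousLinearMap L).contDiff.contDiffAt.comp y h1
  refine h2.congr_of_eventuallyEq (Eventually.of_forall fun y' => ?_)
  exact (congrArg (fun T => T (f y')) hL).symm

theorem contDiffAt_apply {f : X → E [⋀^Fin k]→L[ℝ] ℂ} {y : X}
    (h : ContDiffAt ℝ ∞ f y) (v : Fin k → E) : ContDiffAt ℝ ∞ (fun y' => f y' v) y :=
  (ContinuousAlternatingMap.apply ℝ E ℂ v).contDiff.contDiffAt.comp y h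

theorem contDiffAt_ofReal {f : X → ℝ} {y : X} (h : ContDiffAt ℝ ∞ f y) :
    ContDiffAt ℝ ∞ (fun y' => (f y' : ℂ)) y :=
  Complex.ofRealCLM.contDiff.contDiffAt.comp y h

theorem contDiffAt_compContinuousLinearMap {f : X → E [⋀^Fin k]→L[ℝ] ℂ} {L : X → E →L[ℝ] E}
    {y : X} (hf : ContDiffAt ℝ ∞ f y) (hL : ContDiffAt ℝ ∞ L y) :
    ContDiffAt ℝ ∞ (fun y' => (f y').compContinuousLinearMap (L y')) y := by
  refine contDiffAt_of_refBasis fun I => ?_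
  have h1 : ∀ y', (f y').compContinuousLinearMap (L y') (fun a => refBasis E (I a)) =
      ∑ I' : Fin k → Fin (Module.finrank ℝ E),
        ((∏ a, (refBasis E).repr (L y' (refBasis E (I a))) (I' a) : ℝ) : ℂ) *
          f y' (fun a => refBasis E (I' a)) := by
    intro y'
    have := map_sum_basis (f y')
      (Matrix.of fun i j => (refBasis E).repr (L y' (refBasis E j)) i) I
    simp only [Matrix.of_apply, Module.Basis.sum_repr] at this
    rw [← this]
    rfl
  simp only [h1]
  refine ContDiffAt.sum fun I' _ => ContDiffAt.mul ?_ (contDiffAt_apply hf _)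
  refine contDiffAt_ofReal (contDiffAt_prod fun a _ => ?_)
  have hc : ContDiff ℝ ∞ fun v : E => (refBasis E).repr v (I' a) :=
    (LinearMap.toContinuousLinearMap ((refBasis E).coord (I' a))).contDiff
  exact hc.contDiffAt.comp y (hL.clm_apply contDiffAt_const)

theorem contDiffAt_det {𝕜 n : Type*} [RCLike 𝕜] [Fintype n] [DecidableEq n]
    {A : X → Matrix n n 𝕜} {y : X} (h : ∀ i j, ContDiffAt ℝ ∞ (fun y' => A y' i j) y) :
    ContDiffAt ℝ ∞ (fun y' => (A y').det) y := by
  simp only [Matrix.det_apply']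
  exact ContDiffAt.sum fun σ _ => contDiffAt_const.mul (contDiffAt_prod fun i _ => h _ _)

theorem contDiffAt_matrix_inv {𝕜 n : Type*} [RCLike 𝕜] [Fintype n] [DecidableEq n]
    {A : X → Matrix n n 𝕜} {y : X}
    (h : ∀ i j, ContDiffAt ℝ ∞ (fun y' => A y' i j) y) (h0 : (A y).det ≠ 0) (i j : n) :
    ContDiffAt ℝ ∞ (fun y' => (A y')⁻¹ i j) y := by
  simp only [Matrix.inv_def, Ring.inverse_eq_inv', Matrix.smul_apply, smul_eq_mul,
    Matrix.adjugate_apply]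
  refine ((contDiffAt_det h).inv h0).mul (contDiffAt_det fun a b => ?_)
  simp only [Matrix.updateRow_apply]
  split_ifs
  · exact contDiffAt_const
  · exact h a b

theorem contDiffAt_gram {G : X → E →L[ℝ] E →L[ℝ] ℝ} {y : X} (h : ContDiffAt ℝ ∞ G y)
    (i j : Fin (Module.finrank ℝ E)) : ContDiffAt ℝ ∞ (fun y' => gram (G y') i j) y :=
  (h.clm_apply contDiffAt_const).clm_apply contDiffAt_const

theorem contDiffAt_formInner {G : X → E →L[ℝ] E →L[ℝ] ℝ} {a b : X → E [⋀^Fin k]→L[ℝ] ℂ} {y : X}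
    (hG : ContDiffAt ℝ ∞ G y) (hi : IsInner (G y)) (ha : ContDiffAt ℝ ∞ a y)
    (hb : ContDiffAt ℝ ∞ b y) : ContDiffAt ℝ ∞ (fun y' => formInner (G y') (a y') (b y')) y := by
  simp only [formInner]
  refine contDiffAt_const.mul (ContDiffAt.sum fun I _ => ContDiffAt.sum fun J _ =>
    ContDiffAt.mul ?_ ((contDiffAt_apply ha _).mul ?_))
  · exact contDiffAt_ofReal (contDiffAt_prod fun l _ =>
      contDiffAt_matrix_inv (contDiffAt_gram hG) hi.posDef.det_pos.ne' _ _)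
  · exact Complex.conjCLE.contDiff.contDiffAt.comp y (contDiffAt_apply hb _)

theorem contDiffAt_sqrt_det_gram {G : X → E →L[ℝ] E →L[ℝ] ℝ} {y : X}
    (hG : ContDiffAt ℝ ∞ G y) (hi : IsInner (G y)) :
    ContDiffAt ℝ ∞ (fun y' => √(gram (G y')).det) y :=
  (contDiffAt_det (contDiffAt_gram hG)).sqrt hi.posDef.det_pos.ne'

theorem contDiff_of_eq_zero_off {F : Type*} [NormedAddCommGroup F] [NormedSpace ℝ F] {f : X → F}
    {U K : Set X} (hK : IsClosed K) (hKU : K ⊆ U) (h : ∀ y ∈ U, ContDiffAt ℝ ∞ f y)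
    (h0 : ∀ y ∉ K, f y = 0) : ContDiff ℝ ∞ f := by
  rw [contDiff_iff_contDiffAt]
  intro y
  by_cases hy : y ∈ K
  · exact h y (hKU hy)
  · refine (contDiffAt_const (c := (0 : F))).congr_of_eventuallyEq ?_
    filter_upwards [hK.isOpen_compl.mem_nhds hy] with y' hy'
    exact h0 y' hy'

variable (E) in
/-- The space of alternating forms of type `(p, q)` on `E`. -/
def typeSubmodule (k p q : ℕ) : Submodule ℂ (E [⋀^Fin k]→L[ℝ] ℂ) where
  carrier := {α | IsOfType p q α}
  zero_mem' := fun z v => by simp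
  add_mem' := fun {α β} hα hβ z v => by simp [hα z v, hβ z v, mul_add]
  smul_mem' := fun a α hα z v => by
    simp only [ContinuousAlternatingMap.smul_apply, hα z v, smul_eq_mul]; ring

/-- The coordinate functionals of `S` are extended to all of `V`. Thus coefficients of an `S`-valued
map are its compositions with continuous linear functionals, and inherit its smoothness. -/
theorem exists_submodule_basis {V : Type*} [NormedAddCommGroup V] [NormedSpace ℂ V]
    [FiniteDimensional ℂ V] (S : Submodule ℂ V) :
    ∃ (n : ℕ) (β : Fin n → V) (θ : Fin n → V →L[ℂ] ℂ), LinearIndependent ℂ β ∧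
      (∀ j, β j ∈ S) ∧ ∀ a ∈ S, a = ∑ j, θ j a • β j := by
  let b := Module.finBasis ℂ S
  choose θ hθ using fun j => (b.coord j).exists_extend
  refine ⟨_, fun j => (b j : V), fun j => LinearMap.toContinuousLinearMap (θ j),
    ?_, fun j => (b j).2, fun a ha => ?_⟩
  · exact b.linearIndependent.map' S.subtype (Submodule.ker_subtype _)
  · have h1 := congrArg Subtype.val (b.sum_repr ⟨a, ha⟩)
    rw [Submodule.coe_sum] at h1
    refine h1.symm.trans (Finset.sum_congr rfl fun j _ => ?_)
    have h2 := congrArg (fun T => T (⟨a, ha⟩ : S)) (hθ j)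
    simp only [LinearMap.comp_apply, Submodule.subtype_apply, Module.Basis.coord_apply] at h2
    simp [h2]

variable (E) in
theorem exists_type_basis (k p q : ℕ) : ∃ (n : ℕ) (β : Fin n → E [⋀^Fin k]→L[ℝ] ℂ)
    (θ : Fin n → (E [⋀^Fin k]→L[ℝ] ℂ) →L[ℂ] ℂ), LinearIndependent ℂ β ∧
      (∀ j, IsOfType p q (β j)) ∧ ∀ a, IsOfType p q a → a = ∑ j, θ j a • β j :=
  exists_submodule_basis (typeSubmodule E k p q)

end Smoothness

/-! ### Transporting forms from a chart to the manifold. -/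

section Push

variable {E : Type*} [NormedAddCommGroup E] [NormedSpace ℂ E] [FiniteDimensional ℂ E]
variable {M : Type*} [TopologicalSpace M] [ChartedSpace E M] [IsManifold 𝓘(ℂ, E) ω M]
variable {k p q : ℕ}

open Classical in
/-- The form on `M` given by `w` in the chart at `c`, extended by zero. -/
def pushForm (c : M) (w : E → E [⋀^Fin k]→L[ℝ] ℂ) : Form E M k := fun x =>
  if x ∈ (extChartAt 𝓘(ℂ, E) c).source then
    (w (extChartAt 𝓘(ℂ, E) c x)).compContinuousLinearMap
      ((tangentCoordChange 𝓘(ℂ, E) x c x).restrictScalars ℝ)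
  else 0

theorem pushForm_of_notMem {c x : M} (w : E → E [⋀^Fin k]→L[ℝ] ℂ)
    (h : x ∉ (extChartAt 𝓘(ℂ, E) c).source) : pushForm c w x = 0 := if_neg h

theorem inChart_pushForm {c x : M} (w : E → E [⋀^Fin k]→L[ℝ] ℂ)
    (h : x ∈ (extChartAt 𝓘(ℂ, E) c).source) :
    inChart (pushForm c w) c x = w (extChartAt 𝓘(ℂ, E) c x) := by
  ext v
  simp only [inChart, pushForm, if_pos h, ContinuousAlternatingMap.compContinuousLinearMap_apply]
  congr 1
  ext i
  have h2 := tangentCoordChange_comp (I := 𝓘(ℂ, E)) (w := c) (x := x) (y := c) (z := x) (v := v i)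
    ⟨⟨h, mem_extChartAt_source x⟩, h⟩
  rw [tangentCoordChange_self h] at h2
  exact h2

theorem coord_pushForm {c : M} {y : E} (w : E → E [⋀^Fin k]→L[ℝ] ℂ)
    (h : y ∈ (extChartAt 𝓘(ℂ, E) c).target) : coord (pushForm c w) c y = w y := by
  rw [coord, inChart_pushForm w ((extChartAt 𝓘(ℂ, E) c).map_target h),
    (extChartAt 𝓘(ℂ, E) c).right_inv h]

theorem coord_eq_zero {α : Form E M k} (c : M) {y : E}
    (h : α ((extChartAt 𝓘(ℂ, E) c).symm y) = 0) : coord α c y = 0 := by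
  ext v
  simp only [coord, inChart, h, ContinuousAlternatingMap.compContinuousLinearMap_apply]
  rfl

theorem eq_of_inChart_eq {α β : Form E M k} {c x : M} (hx : x ∈ (extChartAt 𝓘(ℂ, E) c).source)
    (h : inChart α c x = inChart β c x) : α x = β x := by
  ext v
  have h1 := congrArg (fun T : E [⋀^Fin k]→L[ℝ] ℂ =>
    T fun i => tangentCoordChange 𝓘(ℂ, E) x c x (v i)) h
  simp only [inChart, ContinuousAlternatingMap.compContinuousLinearMap_apply] at h1
  have h2 : ∀ u, frame c x (tangentCoordChange 𝓘(ℂ, E) x c x u) = u := fun u => by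
    have h3 := tangentCoordChange_comp (I := 𝓘(ℂ, E)) (w := x) (x := c) (y := x) (z := x) (v := u)
      ⟨⟨mem_extChartAt_source x, hx⟩, mem_extChartAt_source x⟩
    rwa [tangentCoordChange_self (mem_extChartAt_source x)] at h3
  simpa only [Function.comp_def, h2] using h1

/-- In another chart, the form is the pullback of `w` by a transition map near the image of `K`, and
is zero near every other point. The latter uses that `M` is Hausdorff, so that the compact image of
`K` is closed. -/
theorem pushForm_mem_A0 [T2Space M] {c : M} {w : E → E [⋀^Fin k]→L[ℝ] ℂ} (hw : ContDiff ℝ ∞ w)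
    {K : Set E} (hK : IsCompact K) (hKt : K ⊆ (extChartAt 𝓘(ℂ, E) c).target)
    (hw0 : ∀ y ∉ K, w y = 0) (ht : ∀ y, IsOfType p q (w y)) :
    pushForm c w ∈ A0 E M k p q := by
  set K' : Set M := (extChartAt 𝓘(ℂ, E) c).symm '' K
  have hK' : IsCompact K' := hK.image_of_continuousOn
    ((continuousOn_extChartAt_symm (I := 𝓘(ℂ, E)) c).mono hKt)
  have h0 : ∀ x ∉ K', pushForm c w x = 0 := by
    intro x hx
    by_cases hs : x ∈ (extChartAt 𝓘(ℂ, E) c).source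
    · have h1 : extChartAt 𝓘(ℂ, E) c x ∉ K := fun h =>
        hx ⟨_, h, (extChartAt 𝓘(ℂ, E) c).left_inv hs⟩
      rw [pushForm, if_pos hs, hw0 _ h1]
      ext v; simp
    · exact pushForm_of_notMem w hs
  have hK's : K' ⊆ (extChartAt 𝓘(ℂ, E) c).source := by
    rintro _ ⟨y, hy, rfl⟩
    exact (extChartAt 𝓘(ℂ, E) c).map_target (hKt hy)
  refine ⟨fun c' y hy => ContDiffAt.contDiffWithinAt ?_, fun x => ?_,
    HasCompactSupport.intro hK' h0⟩
  · set x := (extChartAt 𝓘(ℂ, E) c').symm y with hx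
    by_cases hs : x ∈ K'
    · have h' := hK's hs
      have hev : coord (pushForm c w) c' =ᶠ[𝓝 y] fun y' =>
          (w (transition c' c y')).compContinuousLinearMap
            (fderiv ℝ (transition c' c) y') := by
        refine (eventually_overlap hy h').mono fun y' hy' => ?_
        rw [coord_change _ hy'.1 hy'.2, coord_pushForm w]
        exact (extChartAt 𝓘(ℂ, E) c).map_source hy'.2
      refine ContDiffAt.congr_of_eventuallyEq ?_ hev
      have hτ := contDiffAt_transition hy h'
      exact contDiffAt_compContinuousLinearMap
        (hw.contDiffAt.comp y (hτ.of_le (by simp))) (hτ.fderiv_right (by simp))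
    · refine (contDiffAt_const (c := 0)).congr_of_eventuallyEq ?_
      filter_upwards [(continuousAt_extChartAt_symm'' hy).eventually
        (hK'.isClosed.isOpen_compl.mem_nhds hs)] with y' hy'
      exact coord_eq_zero c' (h0 _ hy')
  · by_cases hs : x ∈ (extChartAt 𝓘(ℂ, E) c).source
    · rw [pushForm, if_pos hs]
      exact (ht _).comp _
    · rw [pushForm_of_notMem w hs]
      intro z v; simp

end Push

/-! ### Integrals in a chart, and density of the smooth compactly supported forms. -/

section ChartIntegral

variable {E : Type*} [NormedAddCommGroup E] [NormedSpace ℂ E] [FiniteDimensional ℂ E]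
variable {M : Type*} [TopologicalSpace M] [ChartedSpace E M] [IsManifold 𝓘(ℂ, E) ω M]
variable [MeasurableSpace E] [BorelSpace E] [MeasurableSpace M] [BorelSpace M]
variable {k p q : ℕ}

/-- The metric in the coordinates of the chart at `c`. -/
def metricCoord (g : HermitianMetric E M) (c : M) (y : E) : E →L[ℝ] E →L[ℝ] ℝ :=
  g.inChart c ((extChartAt 𝓘(ℂ, E) c).symm y)

/-- The density of the volume in the coordinates of the chart at `c`. -/
def chartDensity (g : HermitianMetric E M) (c : M) (y : E) : ℝ := √(gram (metricCoord g c y)).det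

theorem isInner_metricCoord (g : HermitianMetric E M) {c : M} {y : E}
    (hy : y ∈ (extChartAt 𝓘(ℂ, E) c).target) : IsInner (metricCoord g c y) :=
  isInner_inChart g ((extChartAt 𝓘(ℂ, E) c).map_target hy)

theorem contDiffAt_metricCoord (g : HermitianMetric E M) {c : M} {y : E}
    (hy : y ∈ (extChartAt 𝓘(ℂ, E) c).target) : ContDiffAt ℝ ∞ (metricCoord g c) y :=
  (g.smooth c).contDiffAt ((isOpen_extChartAt_target c).mem_nhds hy)

theorem chartDensity_pos (g : HermitianMetric E M) {c : M} {y : E}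
    (hy : y ∈ (extChartAt 𝓘(ℂ, E) c).target) : 0 < chartDensity g c y :=
  Real.sqrt_pos.2 (isInner_metricCoord g hy).posDef.det_pos

theorem contDiffAt_chartDensity (g : HermitianMetric E M) {c : M} {y : E}
    (hy : y ∈ (extChartAt 𝓘(ℂ, E) c).target) : ContDiffAt ℝ ∞ (chartDensity g c) y :=
  contDiffAt_sqrt_det_gram (contDiffAt_metricCoord g hy) (isInner_metricCoord g hy)

theorem aemeasurable_chartDensity (g : HermitianMetric E M) (c : M) :
    AEMeasurable (fun y => ENNReal.ofReal (chartDensity g c y))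
      ((refBasis E).addHaar.restrict (extChartAt 𝓘(ℂ, E) c).target) := by
  have h : ContinuousOn (chartDensity g c) (extChartAt 𝓘(ℂ, E) c).target := fun y hy =>
    (contDiffAt_chartDensity g hy).continuousAt.continuousWithinAt
  exact (h.aemeasurable (isOpen_extChartAt_target c).measurableSet).ennreal_ofReal

theorem pointInner_symm (g : HermitianMetric E M) (α β : Form E M k) {c : M} {y : E}
    (hy : y ∈ (extChartAt 𝓘(ℂ, E) c).target) :
    pointInner g α β ((extChartAt 𝓘(ℂ, E) c).symm y) =
      formInner (metricCoord g c y) (coord α c y) (coord β c y) :=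
  pointInner_eq g α β ((extChartAt 𝓘(ℂ, E) c).map_target hy)

theorem aemeasurable_symm (c : M) {ν : Measure E} :
    AEMeasurable (extChartAt 𝓘(ℂ, E) c).symm
      (ν.restrict (extChartAt 𝓘(ℂ, E) c).target) :=
  (continuousOn_extChartAt_symm c).aemeasurable (isOpen_extChartAt_target c).measurableSet

theorem chartVolume_eq_map (g : HermitianMetric E M) (c : M) :
    chartVolume g c = (((refBasis E).addHaar.restrict (extChartAt 𝓘(ℂ, E) c).target).withDensity
      fun y => ENNReal.ofReal (chartDensity g c y)).map (extChartAt 𝓘(ℂ, E) c).symm := by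
  rw [← restrict_withDensity (isOpen_extChartAt_target c).measurableSet]
  rfl

variable [SecondCountableTopology M]

theorem vol_restrict_source (g : HermitianMetric E M) (c : M) :
    (vol g).restrict (extChartAt 𝓘(ℂ, E) c).source = chartVolume g c := by
  have ho := (isOpen_extChartAt_source (I := 𝓘(ℂ, E)) c).measurableSet
  ext A hA
  rw [Measure.restrict_apply hA, vol_apply g c (hA.inter ho) inter_subset_right,
    ← chartVolume_compl g c hA]

theorem integral_vol_eq (g : HermitianMetric E M) (c : M) {f : M → ℂ} (hf : Measurable f)
    (h0 : ∀ x ∉ (extChartAt 𝓘(ℂ, E) c).source, f x = 0) :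
    ∫ x, f x ∂(vol g) = ∫ y in (extChartAt 𝓘(ℂ, E) c).target,
      (chartDensity g c y : ℂ) * f ((extChartAt 𝓘(ℂ, E) c).symm y) ∂(refBasis E).addHaar := by
  rw [← setIntegral_eq_integral_of_forall_compl_eq_zero h0, vol_restrict_source,
    chartVolume_eq_map, integral_map ?_ hf.aestronglyMeasurable,
    integral_withDensity_eq_integral_toReal_smul₀ (aemeasurable_chartDensity g c)
      (Eventually.of_forall fun y => ENNReal.ofReal_lt_top)]
  · refine integral_congr_ae (Eventually.of_forall fun y => ?_)
    simp only [ENNReal.toReal_ofReal (show 0 ≤ chartDensity g c y from Real.sqrt_nonneg _)]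
    rfl
  · exact (aemeasurable_symm c).mono_ac (withDensity_absolutelyContinuous _ _)

theorem integrableOn_of_integrable_vol (g : HermitianMetric E M) (c : M) {f : M → ℂ}
    (hf : Integrable f (vol g)) :
    IntegrableOn (fun y => (chartDensity g c y : ℂ) * f ((extChartAt 𝓘(ℂ, E) c).symm y))
      (extChartAt 𝓘(ℂ, E) c).target (refBasis E).addHaar := by
  have h1 := hf.restrict (s := (extChartAt 𝓘(ℂ, E) c).source)
  rw [vol_restrict_source, chartVolume_eq_map] at h1
  have h2 := h1.comp_aemeasurable
    ((aemeasurable_symm c).mono_ac (withDensity_absolutelyContinuous _ _))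
  rw [integrable_withDensity_iff_integrable_smul₀' (aemeasurable_chartDensity g c)
      (Eventually.of_forall fun y => ENNReal.ofReal_lt_top)] at h2
  refine h2.congr (Eventually.of_forall fun y => ?_)
  simp only [ENNReal.toReal_ofReal (show 0 ≤ chartDensity g c y from Real.sqrt_nonneg _)]
  rfl

theorem inner_toL2 (g : HermitianMetric E M) (a b : A0 E M k p q) :
    inner ℂ (toL2 g a) (toL2 g b) = ∫ x, pointInner g b.1 a.1 x ∂(vol g) := rfl

/-- A square integrable form that is orthogonal to `A₀` vanishes near each point, up to a null
set. -/
theorem exists_nhds_null_of_orthogonal [T2Space M] (g : HermitianMetric E M) (u : PreL2 g k p q)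
    (hu : ∀ w : A0 E M k p q, ∫ x, pointInner g u.form w.1 x ∂(vol g) = 0) (c : M) :
    ∃ U ∈ 𝓝 c, vol g (U ∩ {x | pointInner g u.form u.form x ≠ 0}) = 0 := by
  obtain ⟨χ, hχt, hχc, hχs, -, hχ1⟩ := exists_contDiff_tsupport_subset (n := ⊤)
    (extChartAt_target_mem_nhds (I := 𝓘(ℂ, E)) c)
  obtain ⟨n, β, θ, -, hβ, hθ⟩ := exists_type_basis E k p q
  have hpush : ∀ (ψ : E → ℝ), ContDiff ℝ ∞ ψ → ∀ j,
      pushForm c (fun y => ((ψ y * χ y : ℝ) : ℂ) • β j) ∈ A0 E M k p q := by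
    intro ψ hψ j
    refine pushForm_mem_A0 ?_ hχc hχt (fun y hy => ?_)
      fun y => (typeSubmodule E k p q).smul_mem _ (hβ j)
    · exact (Complex.ofRealCLM.contDiff.comp (hψ.mul hχs)).smul contDiff_const
    · rw [image_eq_zero_of_notMem_tsupport hy, mul_zero, Complex.ofReal_zero]
      exact zero_smul ℂ (β j)
  -- `F j` is the density times the pairing of `u` with `χ β j`. Testing `u` against the forms `ψ χ
  -- β j` says that `F j` has zero integral against every test function `ψ`.
  set F : Fin n → E → ℂ := fun j y => (chartDensity g c y : ℂ) *
    ((χ y : ℂ) * formInner (metricCoord g c y) (coord u.form c y) (β j)) with hF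
  have hF0 : ∀ j, ∀ y ∉ (extChartAt 𝓘(ℂ, E) c).target, F j y = 0 := fun j y hy => by
    simp [F, image_eq_zero_of_notMem_tsupport fun h => hy (hχt h)]
  have hval : ∀ (ψ : E → ℝ) (j), ∀ y ∈ (extChartAt 𝓘(ℂ, E) c).target,
      (chartDensity g c y : ℂ) * pointInner g u.form
        (pushForm c (fun y => ((ψ y * χ y : ℝ) : ℂ) • β j)) ((extChartAt 𝓘(ℂ, E) c).symm y) =
      ψ y • F j y := by
    intro ψ j y hy
    rw [pointInner_symm g _ _ hy, coord_pushForm _ hy,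
      (isInner_metricCoord g hy).formInner_smul_right, Complex.conj_ofReal, hF, Complex.real_smul]
    push_cast
    ring
  -- With `ψ = 1`, `F j` is the coordinate expression of the pairing of two square integrable forms.
  have hFint : ∀ j, Integrable (F j) (refBasis E).addHaar := by
    intro j
    have hm := hpush (fun _ => 1) contDiff_const j
    have h1 := integrable_pointInner g u.mem.1 hm.1.isMeasurableForm u.mem.2.2
      (A0_le_l2Forms g k p q hm).2.2
    have h2 := integrableOn_of_integrable_vol g c h1
    have h3 : IntegrableOn (F j) (extChartAt 𝓘(ℂ, E) c).target (refBasis E).addHaar :=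
      h2.congr_fun (fun y hy => (hval (fun _ => 1) j y hy).trans (one_smul ℝ _))
        (isOpen_extChartAt_target c).measurableSet
    exact h3.integrable_of_forall_notMem_eq_zero (hF0 j)
  have hFae : ∀ j, ∀ᵐ y ∂(refBasis E).addHaar, F j y = 0 := by
    intro j
    refine ae_eq_zero_of_integral_contDiff_smul_eq_zero (hFint j).locallyIntegrable
      fun ψ hψ _ => ?_
    have hm := hpush ψ hψ j
    have h1 := hu ⟨_, hm⟩
    rw [integral_vol_eq g c (measurable_pointInner g u.mem.1 hm.1.isMeasurableForm)
      (fun x hx => by rw [pointInner, pushForm_of_notMem _ hx, formInner_zero_right])] at h1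
    rw [← setIntegral_eq_integral_of_forall_compl_eq_zero
      (s := (extChartAt 𝓘(ℂ, E) c).target) fun y hy => by rw [hF0 j y hy, smul_zero]]
    rw [← h1]
    exact (setIntegral_congr_fun (isOpen_extChartAt_target c).measurableSet
      fun y hy => hval ψ j y hy).symm
  set U := (extChartAt 𝓘(ℂ, E) c).source ∩ extChartAt 𝓘(ℂ, E) c ⁻¹' {y | χ y ≠ 0} with hU
  have hUo : IsOpen U := isOpen_extChartAt_preimage' c
    (isOpen_ne_fun hχs.continuous continuous_const)
  refine ⟨U, hUo.mem_nhds ⟨mem_extChartAt_source c, ?_⟩, ?_⟩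
  · exact hχ1.trans_ne one_ne_zero
  · have hm : MeasurableSet (U ∩ {x | pointInner g u.form u.form x ≠ 0}) :=
      hUo.measurableSet.inter
        ((measurableSet_singleton (0 : ℂ)).compl.preimage (measurable_pointInner g u.mem.1 u.mem.1))
    rw [vol_apply g c hm (inter_subset_left.trans inter_subset_left), chartVolume_apply g c hm]
    refine setLIntegral_measure_zero _ _ (measure_mono_null ?_ (ae_all_iff.2 hFae))
    rintro y ⟨hy, ⟨-, hχy⟩, hne⟩ hall
    rw [mem_preimage, (extChartAt 𝓘(ℂ, E) c).right_inv hy] at hχy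
    apply hne
    rw [pointInner_symm g _ _ hy]
    have hG := isInner_metricCoord g hy
    -- Expanding only the second copy of `u` in the basis `β` reduces `h(u, u)` to the pairings
    -- `h(u, β j)`. These vanish wherever `χ ≠ 0` and every `F j` is zero.
    nth_rewrite 2 [hθ _ (isOfType_coord u.mem.2.1 c y)]
    rw [hG.formInner_sum_right]
    refine Finset.sum_eq_zero fun j _ => ?_
    have h1 := hall j
    simp only [hF, mul_eq_zero, Complex.ofReal_eq_zero] at h1
    rw [(h1.resolve_left (chartDensity_pos g hy).ne').resolve_left hχy, mul_zero]

/-- By completeness it suffices that the orthogonal complement is trivial. An orthogonal form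
vanishes almost everywhere near each point, and second countability makes a locally null set null.
-/
theorem denseRange_toL2 [T2Space M] (g : HermitianMetric E M) (k p q : ℕ) :
    DenseRange (toL2 g : A0 E M k p q →ₗ[ℂ] L2 g k p q) := by
  have h : (LinearMap.range (toL2 g : A0 E M k p q →ₗ[ℂ] L2 g k p q)).topologicalClosure = ⊤ := by
    rw [Submodule.topologicalClosure_eq_top_iff, Submodule.eq_bot_iff]
    intro U hU
    obtain ⟨u, rfl⟩ := SeparationQuotient.surjective_mk U
    have hu : ∀ w : A0 E M k p q, ∫ x, pointInner g u.form w.1 x ∂(vol g) = 0 := fun w =>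
      (Submodule.mem_orthogonal _ _).1 hU (toL2 g w) ⟨w, rfl⟩
    have h0 : vol g {x | pointInner g u.form u.form x ≠ 0} = 0 := by
      refine measure_null_of_locally_null _ fun x _ => ?_
      obtain ⟨V, hV, hV0⟩ := exists_nhds_null_of_orthogonal g u hu x
      exact ⟨_, inter_comm V _ ▸ inter_mem_nhdsWithin _ hV, hV0⟩
    rw [← inner_self_eq_zero (𝕜 := ℂ)]
    exact integral_eq_zero_of_ae h0
  exact Submodule.dense_iff_topologicalClosure_eq_top.2 h

end ChartIntegral

/-! ### The operators `∂` and `∂̄` as linear functions of the first derivative. -/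

section Symbols

variable {E : Type*} [NormedAddCommGroup E] [NormedSpace ℂ E] {k : ℕ}

/-- The operator `∂` as a function of the derivative of a form. -/
def delSymbol : (E →L[ℝ] E [⋀^Fin k]→L[ℝ] ℂ) →ₗ[ℂ] E [⋀^Fin (k + 1)]→L[ℝ] ℂ where
  toFun T := .alternatizeUncurryFin (linPart T)
  map_add' T T' := by
    ext v
    simp only [ContinuousAlternatingMap.add_apply, linPart,
      ContinuousAlternatingMap.alternatizeUncurryFin_apply, ← Finset.sum_add_distrib]
    refine Finset.sum_congr rfl fun i _ => ?_
    simp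
    ring
  map_smul' a T := by
    ext v
    simp only [ContinuousAlternatingMap.smul_apply, linPart, RingHom.id_apply,
      ContinuousAlternatingMap.alternatizeUncurryFin_apply, Finset.smul_sum]
    refine Finset.sum_congr rfl fun i _ => ?_
    simp
    ring

/-- The operator `∂̄` as a function of the derivative of a form. -/
def delbarSymbol : (E →L[ℝ] E [⋀^Fin k]→L[ℝ] ℂ) →ₗ[ℂ] E [⋀^Fin (k + 1)]→L[ℝ] ℂ where
  toFun T := .alternatizeUncurryFin (conjPart T)
  map_add' T T' := by
    ext v
    simp only [ContinuousAlternatingMap.add_apply, conjPart,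
      ContinuousAlternatingMap.alternatizeUncurryFin_apply, ← Finset.sum_add_distrib]
    refine Finset.sum_congr rfl fun i _ => ?_
    simp
    ring
  map_smul' a T := by
    ext v
    simp only [ContinuousAlternatingMap.smul_apply, conjPart, RingHom.id_apply,
      ContinuousAlternatingMap.alternatizeUncurryFin_apply, Finset.smul_sum]
    refine Finset.sum_congr rfl fun i _ => ?_
    simp
    ring

variable [FiniteDimensional ℂ E]

/-- The real linear map that takes the `i`-th vector of the reference basis to `a`, and the others
to `0`. -/
def basisSingle (i : Fin (Module.finrank ℝ E)) (a : E [⋀^Fin k]→L[ℝ] ℂ) :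
    E →L[ℝ] E [⋀^Fin k]→L[ℝ] ℂ :=
  (LinearMap.toContinuousLinearMap ((refBasis E).coord i)).smulRight a

theorem basisSingle_sum {n : ℕ} (i : Fin (Module.finrank ℝ E)) (z : Fin n → ℂ)
    (β : Fin n → E [⋀^Fin k]→L[ℝ] ℂ) :
    basisSingle i (∑ j, z j • β j) = ∑ j, z j • basisSingle i (β j) := by
  ext v w
  simp only [basisSingle, ContinuousLinearMap.smulRight_apply, ContinuousAlternatingMap.smul_apply,
    ContinuousAlternatingMap.sum_apply, _root_.sum_apply, smul_apply, Finset.smul_sum, smul_eq_mul]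
  refine Finset.sum_congr rfl fun j _ => ?_
  simp
  ring

theorem sum_basisSingle (T : E →L[ℝ] E [⋀^Fin k]→L[ℝ] ℂ) :
    T = ∑ i, basisSingle i (T (refBasis E i)) := by
  ext v w
  conv_lhs => rw [← (refBasis E).sum_repr v, map_sum]
  simp [basisSingle, _root_.sum_apply, ContinuousAlternatingMap.sum_apply]

end Symbols

/-! ### Existence of formal adjoints of first order operators, by localization and integration by
parts. -/

section FormalAdjointExists

variable {E : Type*} [NormedAddCommGroup E] [NormedSpace ℂ E] [FiniteDimensional ℂ E]
variable {M : Type*} [TopologicalSpace M] [ChartedSpace E M] [IsManifold 𝓘(ℂ, E) ω M]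
variable {k p q l r s : ℕ}

/-- A vector in the kernel of the Gram matrix gives, after conjugating its entries, a combination of
the `β j` orthogonal to all of them, hence to itself. -/
theorem IsInner.det_formInner_ne_zero {G : E →L[ℝ] E →L[ℝ] ℝ} (hG : IsInner G) {n : ℕ}
    {β : Fin n → E [⋀^Fin k]→L[ℝ] ℂ} (hβ : LinearIndependent ℂ β) :
    (Matrix.of fun i j => formInner G (β i) (β j)).det ≠ 0 := by
  intro h0
  obtain ⟨x, hx, hx0⟩ := Matrix.exists_mulVec_eq_zero_iff.2 h0
  apply hx
  have h1 : ∀ i, formInner G (β i) (∑ j, conj (x j) • β j) = 0 := fun i => by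
    rw [hG.formInner_sum_right]
    simpa [Matrix.mulVec, dotProduct, mul_comm] using congrFun hx0 i
  have h2 : ∑ j, conj (x j) • β j = 0 := by
    refine hG.eq_zero_of_formInner_self ?_
    rw [formInner_sum_left]
    exact Finset.sum_eq_zero fun i _ => by rw [h1, mul_zero]
  ext j
  have h3 := Fintype.linearIndependent_iff.1 hβ (fun j => conj (x j)) h2 j
  simpa using h3

/-- Localization of forms near a point by a cutoff function. -/
theorem exists_cutoff [T2Space M] (c : M) : ∃ U ∈ 𝓝 c, ∀ v : A0 E M k p q, ∃ v' : A0 E M k p q,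
    tsupport v'.1 ⊆ (extChartAt 𝓘(ℂ, E) c).source ∧ (∀ x ∈ U, v'.1 x = v.1 x) ∧
      ∀ x, v.1 x = 0 → v'.1 x = 0 := by
  have : ProperSpace E := FiniteDimensional.proper ℂ E
  set κ := extChartAt 𝓘(ℂ, E) c with hκ
  obtain ⟨ε, hε, hball⟩ := Metric.isOpen_iff.1 (isOpen_extChartAt_target c) _
    (mem_extChartAt_target (I := 𝓘(ℂ, E)) c)
  -- The bump is `1` on the ball of radius `ε / 4`, and its support is a closed ball of radius `ε /
  -- 2`, well inside the chart.
  let χ : ContDiffBump (κ c) := ⟨ε / 4, ε / 2, by positivity, by linarith⟩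
  have hχt : tsupport χ ⊆ κ.target := by
    rw [χ.tsupport_eq]
    exact (Metric.closedBall_subset_ball (by change ε / 2 < ε; linarith)).trans hball
  refine ⟨κ.source ∩ κ ⁻¹' Metric.ball (κ c) (ε / 4), ?_, fun v => ?_⟩
  · exact inter_mem (extChartAt_source_mem_nhds c) ((continuousAt_extChartAt c)
      (Metric.ball_mem_nhds _ (by positivity)))
  set w : E → E [⋀^Fin k]→L[ℝ] ℂ := fun y => ((χ y : ℝ) : ℂ) • coord v.1 c y with hw
  have hw0 : ∀ y ∉ tsupport χ, w y = 0 := fun y hy => by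
    simp only [hw, image_eq_zero_of_notMem_tsupport hy]
    exact zero_smul ℂ (coord v.1 c y)
  have hws : ContDiff ℝ ∞ w := contDiff_of_eq_zero_off (isClosed_tsupport _) hχt
    (fun y hy => (contDiffAt_ofReal χ.contDiff.contDiffAt).smul
      ((v.2.1 c).contDiffAt ((isOpen_extChartAt_target c).mem_nhds hy))) hw0
  have hwm := pushForm_mem_A0 (p := p) (q := q) hws χ.hasCompactSupport hχt hw0 fun y =>
    (typeSubmodule E k p q).smul_mem _ (isOfType_coord v.2.2.1 c y)
  have hval : ∀ x ∈ κ.source, pushForm c w x = ((χ (κ x) : ℝ) : ℂ) • v.1 x := by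
    intro x hx
    refine eq_of_inChart_eq (β := fun x => ((χ (κ x) : ℝ) : ℂ) • v.1 x) hx ?_
    rw [inChart_pushForm w hx, hw]
    ext e
    simp only [coord, inChart, κ.left_inv hx, ← hκ]
    rfl
  refine ⟨⟨pushForm c w, hwm⟩, ?_, fun x hx => ?_, fun x hx => ?_⟩
  · have hKc : IsCompact (κ.symm '' tsupport χ) := χ.hasCompactSupport.image_of_continuousOn
      ((continuousOn_extChartAt_symm (I := 𝓘(ℂ, E)) c).mono hχt)
    refine (closure_minimal (fun x hx => ?_) hKc.isClosed).trans
      (image_subset_iff.2 fun y hy => κ.map_target (hχt hy))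
    by_cases hs : x ∈ κ.source
    · refine ⟨κ x, ?_, κ.left_inv hs⟩
      by_contra h
      apply hx
      change pushForm c w x = 0
      rw [hval x hs, image_eq_zero_of_notMem_tsupport h]
      exact zero_smul ℂ (v.1 x)
    · exact absurd (pushForm_of_notMem w hs) hx
  · change pushForm c w x = v.1 x
    rw [hval x hx.1, χ.one_of_mem_closedBall (Metric.ball_subset_closedBall hx.2)]
    exact one_smul ℂ (v.1 x)
  · change pushForm c w x = 0
    by_cases hs : x ∈ κ.source
    · rw [hval x hs, hx]
      exact smul_zero (A := E [⋀^Fin k]→L[ℝ] ℂ) ((χ (κ x) : ℝ) : ℂ)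
    · exact pushForm_of_notMem w hs

/-- A submodule of `A₀` that contains all forms supported in a chart is everything. -/
theorem eq_top_of_chart_supported [T2Space M] {S : Submodule ℂ (A0 E M k p q)}
    (h : ∀ (c : M) (v : A0 E M k p q), tsupport v.1 ⊆ (extChartAt 𝓘(ℂ, E) c).source → v ∈ S) :
    S = ⊤ := by
  choose U hU hcut using fun c : M => exists_cutoff (E := E) (k := k) (p := p) (q := q) c
  -- Induction on the number of cutoff neighbourhoods replaces a partition of unity. Subtracting the
  -- cut-off form `v'` kills `v` on `U c` and creates no new nonzero values, so the remaining
  -- neighbourhoods cover what is left.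
  have key : ∀ t : Finset M, ∀ v : A0 E M k p q, (∀ x, v.1 x ≠ 0 → ∃ c ∈ t, x ∈ U c) → v ∈ S := by
    classical
    intro t
    induction t using Finset.induction_on with
    | empty =>
      intro v hv
      have : v = 0 := by
        ext1; funext x
        by_contra hx
        obtain ⟨c, hc, -⟩ := hv x hx
        simp at hc
      rw [this]; exact S.zero_mem
    | insert c t _ ih =>
      intro v hv
      obtain ⟨v', h1, h2, h3⟩ := hcut c v
      rw [← sub_add_cancel v v']
      refine S.add_mem (ih _ fun x hx => ?_) (h c v' h1)
      have hx' : v.1 x - v'.1 x ≠ 0 := hx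
      have hv0 : v.1 x ≠ 0 := fun h0 => hx' (by rw [h0, h3 x h0, sub_zero])
      have hxU : x ∉ U c := fun hxU => hx' (by rw [h2 x hxU, sub_self])
      obtain ⟨c', hc', hxc'⟩ := hv x hv0
      rcases Finset.mem_insert.1 hc' with rfl | hc'
      · exact absurd hxc' hxU
      · exact ⟨c', hc', hxc'⟩
  rw [Submodule.eq_top_iff']
  intro v
  obtain ⟨t, -, ht⟩ := IsCompact.elim_nhds_subcover v.2.2.2 U fun x _ => hU x
  refine key t v fun x hx => ?_
  obtain ⟨c, hc, hxc⟩ := mem_iUnion₂.1 (ht (subset_tsupport _ hx))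
  exact ⟨c, hc, hxc⟩

variable [MeasurableSpace E] [BorelSpace E] [MeasurableSpace M] [BorelSpace M]
  [SecondCountableTopology M] [T2Space M]

/-- Pointwise Riesz representation, smooth in the point: prescribed pairings with the `β j` are
realized by inverting their Gram matrix, whose entries are smooth. The conjugates in the witness
reflect conjugate linearity in the second argument. -/
theorem exists_representative (g : HermitianMetric E M) (c : M) {n : ℕ}
    {β : Fin n → E [⋀^Fin k]→L[ℝ] ℂ} (hβ : LinearIndependent ℂ β) (hβt : ∀ j, IsOfType p q (β j))
    {K : Set E} (hK : IsCompact K) (hKt : K ⊆ (extChartAt 𝓘(ℂ, E) c).target)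
    {B : Fin n → E → ℂ} (hB : ∀ j, ContDiff ℝ ∞ (B j)) (hB0 : ∀ j, ∀ y ∉ K, B j y = 0) :
    ∃ w : E → E [⋀^Fin k]→L[ℝ] ℂ, pushForm c w ∈ A0 E M k p q ∧
      ∀ y ∈ (extChartAt 𝓘(ℂ, E) c).target, ∀ j,
        (chartDensity g c y : ℂ) * formInner (metricCoord g c y) (β j) (w y) = B j y := by
  set H : E → Matrix (Fin n) (Fin n) ℂ := fun y =>
    Matrix.of fun i j => formInner (metricCoord g c y) (β i) (β j) with hH
  have hdet : ∀ y ∈ (extChartAt 𝓘(ℂ, E) c).target, (H y).det ≠ 0 := fun y hy =>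
    (isInner_metricCoord g hy).det_formInner_ne_zero hβ
  set b : Fin n → E → ℂ := fun i y =>
    (chartDensity g c y : ℂ)⁻¹ * ∑ m, (H y)⁻¹ i m * B m y with hb
  have hbs : ∀ i, ∀ y ∈ (extChartAt 𝓘(ℂ, E) c).target, ContDiffAt ℝ ∞ (b i) y := by
    intro i y hy
    refine ContDiffAt.mul (ContDiffAt.inv (contDiffAt_ofReal (contDiffAt_chartDensity g hy))
      (Complex.ofReal_ne_zero.2 (chartDensity_pos g hy).ne')) (ContDiffAt.sum fun m _ =>
        ContDiffAt.mul ?_ (hB m).contDiffAt)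
    exact contDiffAt_matrix_inv (fun i j => contDiffAt_formInner (contDiffAt_metricCoord g hy)
      (isInner_metricCoord g hy) contDiffAt_const contDiffAt_const) (hdet y hy) i m
  have hb0 : ∀ i, ∀ y ∉ K, b i y = 0 := fun i y hy => by simp [b, hB0 _ y hy]
  refine ⟨fun y => ∑ i, conj (b i y) • β i, pushForm_mem_A0 ?_ hK hKt (fun y hy => ?_)
    (fun y => ?_), fun y hy j => ?_⟩
  · refine ContDiff.sum fun i _ => ?_
    exact (Complex.conjCLE.contDiff.comp
      (contDiff_of_eq_zero_off hK.isClosed hKt (hbs i) (hb0 i))).smul contDiff_const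
  · refine Finset.sum_eq_zero fun i _ => ?_
    rw [hb0 i y hy, map_zero]
    exact zero_smul ℂ (β i)
  · exact (typeSubmodule E k p q).sum_mem fun i _ =>
      (typeSubmodule E k p q).smul_mem _ (hβt i)
  · have hρ : (chartDensity g c y : ℂ) ≠ 0 := Complex.ofReal_ne_zero.2 (chartDensity_pos g hy).ne'
    rw [(isInner_metricCoord g hy).formInner_sum_right]
    have h1 : ∀ i, conj (conj (b i y)) * formInner (metricCoord g c y) (β j) (β i) =
        (chartDensity g c y : ℂ)⁻¹ * (H y j i * ((H y)⁻¹.mulVec (fun m => B m y)) i) := by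
      intro i
      rw [Complex.conj_conj]
      simp only [hb, hH, Matrix.of_apply, Matrix.mulVec, dotProduct]
      ring
    simp only [h1]
    rw [← Finset.mul_sum, mul_inv_cancel_left₀ hρ]
    have h2 : (H y).mulVec ((H y)⁻¹.mulVec fun m => B m y) = fun m => B m y := by
      rw [Matrix.mulVec_mulVec, Matrix.mul_nonsing_inv _ (isUnit_iff_ne_zero.2 (hdet y hy)),
        Matrix.one_mulVec]
    exact congrFun h2 j

/-- The formal adjoint of a first order operator, on a form supported in a chart. -/
theorem exists_adjoint_of_tsupport_subset (g : HermitianMetric E M) (c : M)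
    (L : (E →L[ℝ] E [⋀^Fin k]→L[ℝ] ℂ) →ₗ[ℂ] E [⋀^Fin l]→L[ℝ] ℂ)
    (D : A0 E M k p q →ₗ[ℂ] A0 E M l r s)
    (hD : ∀ u, ∀ y ∈ (extChartAt 𝓘(ℂ, E) c).target,
      coord (D u).1 c y = L (fderiv ℝ (coord u.1 c) y))
    (v : A0 E M l r s) (hv : tsupport v.1 ⊆ (extChartAt 𝓘(ℂ, E) c).source) :
    ∃ w : A0 E M k p q, ∀ u, ∫ x, pointInner g (D u).1 v.1 x ∂(vol g) =
      ∫ x, pointInner g u.1 w.1 x ∂(vol g) := by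
  set κ := extChartAt 𝓘(ℂ, E) c with hκ
  have hto : IsOpen κ.target := isOpen_extChartAt_target c
  set K : Set E := κ '' tsupport v.1
  have hK : IsCompact K := IsCompact.image_of_continuousOn v.2.2.2
    ((continuousOn_extChartAt c).mono hv)
  have hKt : K ⊆ κ.target := by
    rintro _ ⟨x, hx, rfl⟩
    exact κ.map_source (hv hx)
  -- Outside the target, `coord` takes values of no meaning; they are replaced by zero.
  set vt : E → E [⋀^Fin l]→L[ℝ] ℂ := κ.target.indicator (coord v.1 c) with hvt
  have hvt0 : ∀ y ∉ K, vt y = 0 := by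
    intro y hy
    by_cases hyt : y ∈ κ.target
    · rw [hvt, indicator_of_mem hyt]
      refine coord_eq_zero c (image_eq_zero_of_notMem_tsupport fun h => hy ⟨_, h, κ.right_inv hyt⟩)
    · rw [hvt, indicator_of_notMem hyt]
  have hvts : ∀ y ∈ κ.target, ContDiffAt ℝ ∞ vt y := by
    intro y hy
    refine ((v.2.1 c).contDiffAt (hto.mem_nhds hy)).congr_of_eventuallyEq ?_
    filter_upwards [hto.mem_nhds hy] with y' hy'
    rw [hvt, indicator_of_mem hy']
  obtain ⟨n, β, θ, hβ, hβt, hθ⟩ := exists_type_basis E k p q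
  -- With `u = ∑ u_j β_j` in the chart, the density times `h(D u, v)` equals `∑ A i j · ∂_i u_j`.
  -- The coefficients `A i j` are smooth with support in `K`.
  set A : Fin (Module.finrank ℝ E) → Fin n → E → ℂ := fun i j y => (chartDensity g c y : ℂ) *
    formInner (metricCoord g c y) (L (basisSingle i (β j))) (vt y) with hA
  have hAs : ∀ i j, ∀ y ∈ κ.target, ContDiffAt ℝ ∞ (A i j) y := fun i j y hy =>
    (contDiffAt_ofReal (contDiffAt_chartDensity g hy)).mul (contDiffAt_formInner
      (contDiffAt_metricCoord g hy) (isInner_metricCoord g hy) contDiffAt_const (hvts y hy))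
  have hA0 : ∀ i j, ∀ y ∉ K, A i j y = 0 := fun i j y hy => by
    simp only [hA, hvt0 y hy, formInner_zero_right, mul_zero]
  have hAc : ∀ i j, ContDiff ℝ ∞ (A i j) := fun i j =>
    contDiff_of_eq_zero_off hK.isClosed hKt (hAs i j) (hA0 i j)
  have hdA0 : ∀ i j, ∀ y ∉ K, fderiv ℝ (A i j) y = 0 := fun i j y hy => by
    have : A i j =ᶠ[𝓝 y] fun _ => 0 := by
      filter_upwards [hK.isClosed.isOpen_compl.mem_nhds hy] with y' hy'
      exact hA0 i j y' hy'
    rw [this.fderiv_eq]; simp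
  -- Integration by parts moves the derivatives onto `A`, leaving `∑ B j · u_j`; the form `w` is
  -- then chosen to have these pairings with the basis.
  set B : Fin n → E → ℂ := fun j y => -∑ i, fderiv ℝ (A i j) y (refBasis E i) with hB
  have hBc : ∀ j, ContDiff ℝ ∞ (B j) := fun j => (ContDiff.sum fun i _ =>
    ((hAc i j).fderiv_right (by simp)).clm_apply contDiff_const).neg
  have hB0 : ∀ j, ∀ y ∉ K, B j y = 0 := fun j y hy => by simp [hB, hdA0 _ j y hy]
  obtain ⟨w, hw, hwB⟩ := exists_representative g c hβ hβt hK hKt hBc hB0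
  refine ⟨⟨pushForm c w, hw⟩, fun u => ?_⟩
  set uj : Fin n → E → ℂ := fun j y => θ j (coord u.1 c y) with huj
  have hus : ∀ y ∈ κ.target, ContDiffAt ℝ ∞ (coord u.1 c) y := fun y hy =>
    (u.2.1 c).contDiffAt (hto.mem_nhds hy)
  have hujs : ∀ j, ∀ y ∈ κ.target, ContDiffAt ℝ ∞ (uj j) y := fun j y hy =>
    ((θ j).restrictScalars ℝ).contDiff.contDiffAt.comp y (hus y hy)
  have hujd : ∀ j, ∀ y ∈ κ.target, ∀ e, fderiv ℝ (uj j) y e = θ j (fderiv ℝ (coord u.1 c) y e) := by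
    intro j y hy e
    have h1 := ((θ j).restrictScalars ℝ).hasFDerivAt.comp y
      ((hus y hy).differentiableAt (by simp)).hasFDerivAt
    have h2 : HasFDerivAt (uj j) _ y := h1
    rw [h2.fderiv]; rfl
  -- the two integrands in coordinates
  have hleft : ∀ y ∈ κ.target, (chartDensity g c y : ℂ) *
      pointInner g (D u).1 v.1 (κ.symm y) =
        ∑ i, ∑ j, A i j y * fderiv ℝ (uj j) y (refBasis E i) := by
    intro y hy
    have h1 : ∀ i, basisSingle i (fderiv ℝ (coord u.1 c) y (refBasis E i)) =
        ∑ j, fderiv ℝ (uj j) y (refBasis E i) • basisSingle i (β j) := by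
      intro i
      rw [← basisSingle_sum]
      congr 1
      simp only [hujd _ y hy]
      exact hθ _ (IsOfType.fderiv (Eventually.of_forall fun y' => isOfType_coord u.2.2.1 c y') _)
    rw [pointInner_symm g _ _ hy, hD u y hy, sum_basisSingle (fderiv ℝ (coord u.1 c) y)]
    simp only [h1, map_sum, map_smul]
    have h2 : coord v.1 c y = vt y := by rw [hvt, indicator_of_mem hy]
    have h3 : ∀ (x : Fin (Module.finrank ℝ E) → E [⋀^Fin l]→L[ℝ] ℂ) (z : E [⋀^Fin l]→L[ℝ] ℂ),
        formInner (metricCoord g c y) (∑ i, x i) z =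
          ∑ i, formInner (metricCoord g c y) (x i) z := fun x z => by
      simpa using formInner_sum_left Finset.univ (metricCoord g c y) (fun _ => 1) x z
    rw [h2, h3, Finset.mul_sum]
    refine Finset.sum_congr rfl fun i _ => ?_
    rw [formInner_sum_left, Finset.mul_sum]
    exact Finset.sum_congr rfl fun j _ => by simp only [hA]; ring
  have hright : ∀ y ∈ κ.target, (chartDensity g c y : ℂ) *
      pointInner g u.1 (pushForm c w) (κ.symm y) = ∑ j, uj j y * B j y := by
    intro y hy
    rw [pointInner_symm g _ _ hy, coord_pushForm _ hy, hθ _ (isOfType_coord u.2.2.1 c y),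
      formInner_sum_left, Finset.mul_sum]
    refine Finset.sum_congr rfl fun j _ => ?_
    rw [← hwB y hy j]; ring
  have hint : ∀ {f : E → ℂ}, (∀ y ∈ κ.target, ContDiffAt ℝ ∞ f y) → (∀ y ∉ K, f y = 0) →
      Integrable f (refBasis E).addHaar := fun hf hf0 =>
    (contDiff_of_eq_zero_off hK.isClosed hKt hf hf0).continuous.integrable_of_hasCompactSupport
      (HasCompactSupport.intro hK hf0)
  have hI1 : ∀ i j, Integrable (fun y => A i j y * fderiv ℝ (uj j) y (refBasis E i))
      (refBasis E).addHaar := fun i j => hint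
    (fun y hy => (hAs i j y hy).mul (((hujs j y hy).fderiv_right (by simp)).clm_apply
      contDiffAt_const)) fun y hy => by rw [hA0 i j y hy, zero_mul]
  have hI2 : ∀ i j, Integrable (fun y => fderiv ℝ (A i j) y (refBasis E i) * uj j y)
      (refBasis E).addHaar := fun i j => hint
    (fun y hy => (((hAs i j y hy).fderiv_right (by simp)).clm_apply contDiffAt_const).mul
      (hujs j y hy)) fun y hy => by rw [hdA0 i j y hy]; simp
  have hI3 : ∀ i j, Integrable (fun y => A i j y * uj j y) (refBasis E).addHaar := fun i j =>
    hint (fun y hy => (hAs i j y hy).mul (hujs j y hy)) fun y hy => by rw [hA0 i j y hy, zero_mul]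
  -- The functions `uj j` need not be differentiable outside the chart. It is enough that they are
  -- so on the support of `A i j`, which lies in `K`.
  have hparts : ∀ i j, ∫ y, A i j y * fderiv ℝ (uj j) y (refBasis E i) ∂(refBasis E).addHaar =
      -∫ y, fderiv ℝ (A i j) y (refBasis E i) * uj j y ∂(refBasis E).addHaar := fun i j =>
    integral_mul_fderiv_eq_neg_fderiv_mul_of_integrable (hI2 i j) (hI1 i j) (hI3 i j)
      (fun y _ => (hAc i j).differentiable (by simp) y)
      fun y hy => (hujs j y (hKt (closure_minimal (fun y' hy' => by
        by_contra h; exact hy' (hA0 i j y' h)) hK.isClosed hy))).differentiableAt (by simp)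
  have hm : ∀ {a b m : ℕ} (α α' : A0 E M a b m), Measurable (pointInner g α.1 α'.1) := fun α α' =>
    measurable_pointInner g α.2.1.isMeasurableForm α'.2.1.isMeasurableForm
  rw [integral_vol_eq g c (hm (D u) v) fun x hx => by
      rw [pointInner, image_eq_zero_of_notMem_tsupport fun h => hx (hv h), formInner_zero_right],
    integral_vol_eq g c (hm u ⟨_, hw⟩) fun x hx => by
      simp only [pointInner, pushForm_of_notMem _ hx, formInner_zero_right],
    setIntegral_congr_fun hto.measurableSet hleft, setIntegral_congr_fun hto.measurableSet hright,
    setIntegral_eq_integral_of_forall_compl_eq_zero, setIntegral_eq_integral_of_forall_compl_eq_zero]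
  · rw [integral_finsetSum _ fun i _ => integrable_finsetSum _ fun j _ => hI1 i j]
    have h1 : ∀ i, ∫ y, ∑ j, A i j y * fderiv ℝ (uj j) y (refBasis E i) ∂(refBasis E).addHaar =
        ∑ j, -∫ y, fderiv ℝ (A i j) y (refBasis E i) * uj j y ∂(refBasis E).addHaar := fun i => by
      rw [integral_finsetSum _ fun j _ => hI1 i j]
      exact Finset.sum_congr rfl fun j _ => hparts i j
    simp only [h1]
    have h2 : ∀ y, ∑ j, uj j y * B j y =
        ∑ i, ∑ j, -(fderiv ℝ (A i j) y (refBasis E i) * uj j y) := by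
      intro y
      rw [Finset.sum_comm]
      refine Finset.sum_congr rfl fun j _ => ?_
      rw [Finset.sum_neg_distrib, ← Finset.sum_mul]
      simp only [hB]
      ring
    have hI2' : ∀ i j, Integrable (fun y => -(fderiv ℝ (A i j) y (refBasis E i) * uj j y))
        (refBasis E).addHaar := fun i j => (hI2 i j).neg
    simp only [h2]
    rw [integral_finsetSum _ fun i _ => integrable_finsetSum _ fun j _ => hI2' i j]
    refine Finset.sum_congr rfl fun i _ => ?_
    rw [integral_finsetSum _ fun j _ => hI2' i j]
    exact Finset.sum_congr rfl fun j _ => (integral_neg _).symm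
  · exact fun y hy => Finset.sum_eq_zero fun j _ => by rw [hB0 j y fun h => hy (hKt h), mul_zero]
  · exact fun y hy => Finset.sum_eq_zero fun i _ => Finset.sum_eq_zero fun j _ => by
      rw [hA0 i j y fun h => hy (hKt h), zero_mul]

/-- A linear relation that is defined everywhere contains the graph of a linear map. -/
theorem exists_linearMap_of_map_fst_eq_top {V W : Type*} [AddCommGroup V] [Module ℂ V]
    [AddCommGroup W] [Module ℂ W] {N : Submodule ℂ (V × W)}
    (h : N.map (LinearMap.fst ℂ V W) = ⊤) : ∃ f : V →ₗ[ℂ] W, ∀ v, (v, f v) ∈ N := by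
  obtain ⟨f, hf⟩ := ((LinearMap.fst ℂ V W).comp N.subtype).exists_rightInverse_of_surjective (by
    rw [LinearMap.range_comp, Submodule.range_subtype, h])
  refine ⟨(LinearMap.snd ℂ V W).comp (N.subtype.comp f), fun v => ?_⟩
  have h1 : (f v).1.1 = v := congrArg (fun T => T v) hf
  have h2 := (f v).2
  rw [← Prod.mk.eta (p := (f v).1), h1] at h2
  exact h2

/-- A first order operator has a formal adjoint. -/
theorem exists_isFormalAdjoint (g : HermitianMetric E M)
    (L : (E →L[ℝ] E [⋀^Fin k]→L[ℝ] ℂ) →ₗ[ℂ] E [⋀^Fin l]→L[ℝ] ℂ)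
    (D : A0 E M k p q →ₗ[ℂ] A0 E M l r s)
    (hD : ∀ (c : M) (u : A0 E M k p q), ∀ y ∈ (extChartAt 𝓘(ℂ, E) c).target,
      coord (D u).1 c y = L (fderiv ℝ (coord u.1 c) y)) :
    ∃ Q, IsFormalAdjoint g D Q := by
  -- All pairs `(v, w)` satisfying the adjoint identity form a linear relation. It contains a pair
  -- for every `v` supported in a chart, hence for every `v`, and a linear section of it is a formal
  -- adjoint.
  let N : Submodule ℂ (A0 E M l r s × A0 E M k p q) :=
    { carrier := {z | ∀ u, inner ℂ (toL2 g (D u)) (toL2 g z.1) = inner ℂ (toL2 g u) (toL2 g z.2)}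
      zero_mem' := fun u => by simp
      add_mem' := fun {a b} ha hb u => by simp [inner_add_right, ha u, hb u]
      smul_mem' := fun z a ha u => by simp [inner_smul_right, ha u] }
  have htop : N.map (LinearMap.fst ℂ _ _) = ⊤ := by
    refine eq_top_of_chart_supported fun c v hv => ?_
    obtain ⟨w, hw⟩ := exists_adjoint_of_tsupport_subset g c L D (hD c) v hv
    refine ⟨(v, w), fun u => ?_, rfl⟩
    dsimp only
    rw [← inner_conj_symm, inner_toL2, hw u, ← inner_toL2, inner_conj_symm]
  obtain ⟨f, hf⟩ := exists_linearMap_of_map_fst_eq_top (V := A0 E M l r s) (W := A0 E M k p q)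
    (N := N) htop
  exact ⟨f, fun u v => hf v u⟩

theorem isFormalAdjoint_formalAdjoint {g : HermitianMetric E M}
    {P : A0 E M k p q →ₗ[ℂ] A0 E M l r s} (h : ∃ Q, IsFormalAdjoint g P Q) :
    IsFormalAdjoint g P (formalAdjoint g P) := by
  rw [formalAdjoint, dif_pos h]
  exact h.choose_spec

theorem isFormalAdjoint_delStar (g : HermitianMetric E M) :
    IsFormalAdjoint g (del : A0 E M k p q →ₗ[ℂ] _) (delStar g) :=
  isFormalAdjoint_formalAdjoint (exists_isFormalAdjoint g delSymbol del fun _ u _ hy =>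
    (coord_del_and_delbar u.2.1 u.2.2.1 hy).1)

theorem isFormalAdjoint_delbarStar (g : HermitianMetric E M) :
    IsFormalAdjoint g (delbar : A0 E M k p q →ₗ[ℂ] _) (delbarStar g) :=
  isFormalAdjoint_formalAdjoint (exists_isFormalAdjoint g delbarSymbol delbar fun _ u _ hy =>
    (coord_del_and_delbar u.2.1 u.2.2.1 hy).2)

end FormalAdjointExists

/-! ### Application to the Bott–Chern and Aeppli Laplacians. -/

section StrongWeak

variable {E : Type*} [NormedAddCommGroup E] [NormedSpace ℂ E] [FiniteDimensional ℂ E]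
variable {M : Type*} [TopologicalSpace M] [ChartedSpace E M] [IsManifold 𝓘(ℂ, E) ω M]
variable [MeasurableSpace E] [BorelSpace E] [MeasurableSpace M] [BorelSpace M]
  [SecondCountableTopology M]
variable {k₁ p₁ q₁ k₂ p₂ q₂ k₃ p₃ q₃ k p q : ℕ} {g : HermitianMetric E M}

theorem IsFormalAdjoint.symm {P : A0 E M k₁ p₁ q₁ →ₗ[ℂ] A0 E M k₂ p₂ q₂}
    {Q : A0 E M k₂ p₂ q₂ →ₗ[ℂ] A0 E M k₁ p₁ q₁} (h : IsFormalAdjoint g P Q) :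
    IsFormalAdjoint g Q P := fun u v => by
  rw [← inner_conj_symm, ← h v u, inner_conj_symm]

theorem IsFormalAdjoint.comp {P : A0 E M k₁ p₁ q₁ →ₗ[ℂ] A0 E M k₂ p₂ q₂}
    {Q : A0 E M k₂ p₂ q₂ →ₗ[ℂ] A0 E M k₁ p₁ q₁} {P' : A0 E M k₂ p₂ q₂ →ₗ[ℂ] A0 E M k₃ p₃ q₃}
    {Q' : A0 E M k₃ p₃ q₃ →ₗ[ℂ] A0 E M k₂ p₂ q₂} (h' : IsFormalAdjoint g P' Q')
    (h : IsFormalAdjoint g P Q) : IsFormalAdjoint g (P' ∘ₗ P) (Q ∘ₗ Q') := fun u v => by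
  rw [LinearMap.comp_apply, LinearMap.comp_apply, h', h]

theorem IsFormalAdjoint.add {P P' : A0 E M k₁ p₁ q₁ →ₗ[ℂ] A0 E M k₂ p₂ q₂}
    {Q Q' : A0 E M k₂ p₂ q₂ →ₗ[ℂ] A0 E M k₁ p₁ q₁} (h : IsFormalAdjoint g P Q)
    (h' : IsFormalAdjoint g P' Q') : IsFormalAdjoint g (P + P') (Q + Q') := fun u v => by
  simp only [LinearMap.add_apply, map_add, inner_add_left, inner_add_right, h u v, h' u v]

theorem isFormalAdjoint_zero :
    IsFormalAdjoint g (0 : A0 E M k₁ p₁ q₁ →ₗ[ℂ] A0 E M k₂ p₂ q₂) 0 := fun u v => by simp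

/-- The difference of the two values is itself an admissible test form, so it is orthogonal to
itself. -/
theorem IsFormalAdjoint.toL2_eq {P : A0 E M k₁ p₁ q₁ →ₗ[ℂ] A0 E M k₂ p₂ q₂}
    {Q Q' : A0 E M k₂ p₂ q₂ →ₗ[ℂ] A0 E M k₁ p₁ q₁} (h : IsFormalAdjoint g P Q)
    (h' : IsFormalAdjoint g P Q') (v : A0 E M k₂ p₂ q₂) : toL2 g (Q v) = toL2 g (Q' v) := by
  rw [← sub_eq_zero, ← inner_self_eq_zero (𝕜 := ℂ), inner_sub_right, ← map_sub, ← h, ← h', sub_self]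

variable [T2Space M]

/-- This frees the weak extension from the particular formal adjoint chosen in its definition. -/
theorem IsFormalAdjoint.weakExt_eq {P : A0 E M k₁ p₁ q₁ →ₗ[ℂ] A0 E M k₂ p₂ q₂}
    {Q : A0 E M k₂ p₂ q₂ →ₗ[ℂ] A0 E M k₁ p₁ q₁} (h : IsFormalAdjoint g P Q) :
    weakExt g P = (opGraph (toL2 g) (toL2 g) Q).adjoint := by
  ext z
  rw [mem_adjoint_opGraph]
  refine forall_congr' fun w => ?_
  rw [(isFormalAdjoint_formalAdjoint ⟨Q, h⟩).toL2_eq h w, eq_comm]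

/-- The statement for `P` is the abstract theorem, and the one for `Q` follows by taking adjoints:
`Q_w = P_s* = P_w* = Q₀** = Q_s`. -/
theorem strongExt_eq_weakExt_of_isEssentiallySelfAdjoint
    {P : A0 E M k₁ p₁ q₁ →ₗ[ℂ] A0 E M k₂ p₂ q₂} {Q : A0 E M k₂ p₂ q₂ →ₗ[ℂ] A0 E M k₁ p₁ q₁}
    {S : A0 E M k₂ p₂ q₂ →ₗ[ℂ] A0 E M k₂ p₂ q₂} (hP : IsFormalAdjoint g P Q)
    (hS : IsFormalAdjoint g S S) (hQS : ∀ w, toL2 g (Q (S w)) = 0)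
    (h : IsEssentiallySelfAdjoint g (P ∘ₗ Q + S ^ 2)) :
    strongExt g P = weakExt g P ∧ strongExt g Q = weakExt g Q := by
  have h1 : strongExt g P = (opGraph (toL2 g) (toL2 g) Q).adjoint :=
    closure_eq_adjoint_of_unique (denseRange_toL2 g _ _ _) (denseRange_toL2 g _ _ _) hP hS hQS
      fun T T' hT hTs hT' hTs' => h.unique ⟨hT, hTs⟩ ⟨hT', hTs'⟩
  refine ⟨h1.trans hP.weakExt_eq.symm, ?_⟩
  have h2 : strongExt g Q = (opGraph (toL2 g) (toL2 g) Q).adjoint.adjoint :=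
    (adjoint_adjoint _).symm
  rw [hP.symm.weakExt_eq, h2, ← h1]
  exact adjoint_topologicalClosure _

theorem isFormalAdjoint_delDelbar (g : HermitianMetric E M) :
    IsFormalAdjoint g (delDelbar : A0 E M k p q →ₗ[ℂ] _) (delbarStarDelStar g) :=
  (isFormalAdjoint_delStar g).comp (isFormalAdjoint_delbarStar g)

theorem isFormalAdjoint_delDelStar (g : HermitianMetric E M) (k p q : ℕ) :
    IsFormalAdjoint g (delDelStar g k p q) (delDelStar g k p q) := by
  rcases k with _ | k <;> rcases p with _ | p
  · exact isFormalAdjoint_zero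
  · exact isFormalAdjoint_zero
  · exact isFormalAdjoint_zero
  · exact (isFormalAdjoint_delStar g).comp (isFormalAdjoint_delStar g).symm

theorem isFormalAdjoint_delbarDelbarStar (g : HermitianMetric E M) (k p q : ℕ) :
    IsFormalAdjoint g (delbarDelbarStar g k p q) (delbarDelbarStar g k p q) := by
  rcases k with _ | k <;> rcases q with _ | q
  · exact isFormalAdjoint_zero
  · exact isFormalAdjoint_zero
  · exact isFormalAdjoint_zero
  · exact (isFormalAdjoint_delbarStar g).comp (isFormalAdjoint_delbarStar g).symm

/-- Anticommute `∂` and `∂̄`, then use `∂² = 0`. -/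
theorem del_delbar_del (α : A0 E M k p q) : del (delbar (del α)) = 0 := by
  have h := congrArg del (del_delbar_add_delbar_del α)
  rwa [map_add, map_zero, del_del, zero_add] at h

theorem delbar_del_delbar (α : A0 E M k p q) : delbar (del (delbar α)) = 0 := by
  have h := congrArg delbar (del_delbar_add_delbar_del α)
  rwa [map_add, map_zero, delbar_delbar, add_zero] at h

theorem delDelbar_delDelStar (g : HermitianMetric E M) (k p q : ℕ) (w : A0 E M k p q) :
    delDelbar (delDelStar g k p q w) = 0 := by
  rcases k with _ | k <;> rcases p with _ | p
  · exact map_zero delDelbar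
  · exact map_zero delDelbar
  · exact map_zero delDelbar
  · exact del_delbar_del (delStar g w)

theorem delDelbar_delbarDelbarStar (g : HermitianMetric E M) (k p q : ℕ) (w : A0 E M k p q) :
    delDelbar (delbarDelbarStar g k p q w) = 0 := by
  rcases k with _ | k <;> rcases q with _ | q
  · exact map_zero delDelbar
  · exact map_zero delDelbar
  · exact map_zero delDelbar
  · change del (delbar (delbar (delbarStar g w))) = 0
    rw [delbar_delbar, map_zero]

/-- Here `S = ∂*∂ + ∂̄*∂̄` kills the range of `∂∂̄`, and the required `∂̄*∂* S = 0` is the adjoint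
of this identity. -/
theorem strongExt_eq_weakExt_of_boxBC
    (h : IsEssentiallySelfAdjoint g (boxBC g k p q)) :
    strongExt g (delDelbar : A0 E M k p q →ₗ[ℂ] A0 E M (k + 2) (p + 1) (q + 1)) =
        weakExt g delDelbar ∧
      strongExt g (delbarStarDelStar g : A0 E M (k + 2) (p + 1) (q + 1) →ₗ[ℂ] A0 E M k p q) =
        weakExt g (delbarStarDelStar g) := by
  have hP := isFormalAdjoint_delDelbar (k := k) (p := p) (q := q) g
  have hS : IsFormalAdjoint g
      (delStar g ∘ₗ del + delbarStar g ∘ₗ delbar : A0 E M (k + 2) (p + 1) (q + 1) →ₗ[ℂ] _)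
      (delStar g ∘ₗ del + delbarStar g ∘ₗ delbar) :=
    ((isFormalAdjoint_delStar g).symm.comp (isFormalAdjoint_delStar g)).add
      ((isFormalAdjoint_delbarStar g).symm.comp (isFormalAdjoint_delbarStar g))
  refine strongExt_eq_weakExt_of_isEssentiallySelfAdjoint hP hS (fun w => ?_) h
  rw [← inner_self_eq_zero (𝕜 := ℂ), ← hP, ← hS]
  have hz : ∀ v : A0 E M k p q,
      (delStar g ∘ₗ del + delbarStar g ∘ₗ delbar :
        A0 E M (k + 2) (p + 1) (q + 1) →ₗ[ℂ] _) (delDelbar v) = 0 := fun v => by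
    change delStar g (del (del (delbar v))) + delbarStar g (delbar (del (delbar v))) = 0
    rw [del_del, delbar_del_delbar, map_zero, map_zero, add_zero]
  rw [hz, map_zero, inner_zero_left]

/-- The roles are exchanged: `P = ∂̄*∂*`, `Q = ∂∂̄`, and `∂∂̄` kills the ranges of `∂∂*` and `∂̄∂̄*`
directly. -/
theorem strongExt_eq_weakExt_of_boxA
    (h : IsEssentiallySelfAdjoint g (boxA g k p q)) :
    strongExt g (delDelbar : A0 E M k p q →ₗ[ℂ] A0 E M (k + 2) (p + 1) (q + 1)) =
        weakExt g delDelbar ∧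
      strongExt g (delbarStarDelStar g : A0 E M (k + 2) (p + 1) (q + 1) →ₗ[ℂ] A0 E M k p q) =
        weakExt g (delbarStarDelStar g) := by
  refine (strongExt_eq_weakExt_of_isEssentiallySelfAdjoint (isFormalAdjoint_delDelbar g).symm
    ((isFormalAdjoint_delDelStar g k p q).add (isFormalAdjoint_delbarDelbarStar g k p q))
    (fun w => ?_) h).symm
  rw [LinearMap.add_apply, map_add, delDelbar_delDelStar, delDelbar_delbarDelbarStar, add_zero,
    map_zero]

end StrongWeak

end ABC

end

theorem mainTheorem4 {E : Type*} [NormedAddCommGroup E] [NormedSpace ℂ E] [FiniteDimensional ℂ E]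
    [MeasurableSpace E] [BorelSpace E]
    {M : Type*} [TopologicalSpace M] [T2Space M] [SecondCountableTopology M] [ChartedSpace E M]
    [IsManifold 𝓘(ℂ, E) ω M] [MeasurableSpace M] [BorelSpace M]
    (g : HermitianMetric E M) (p q : ℕ)
    (h : IsEssentiallySelfAdjoint g (boxBC g (p + q) p q) ∨
      IsEssentiallySelfAdjoint g (boxA g (p + q) p q)) :
    strongExt g (delDelbar : A0 E M (p + q) p q →ₗ[ℂ] A0 E M (p + q + 2) (p + 1) (q + 1)) =
        weakExt g delDelbar ∧
      strongExt g (delbarStarDelStar g :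
          A0 E M (p + q + 2) (p + 1) (q + 1) →ₗ[ℂ] A0 E M (p + q) p q) =
        weakExt g (delbarStarDelStar g) :=
  h.elim strongExt_eq_weakExt_of_boxBC strongExt_eq_weakExt_of_boxA
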